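/- \textbf{Setting.} Consider a mixture of $P$ polyatomic gases with masses $m_i>0$ and parameters $\alpha_i>-1$, and put $\mathrm m=\sum_\ell m_\ell$, $\mu_{ij}=\frac{m_im_j}{m_i+m_j}$, $\bar s_{ij}=\min\{\frac{m_i}{m_i+m_j},\frac{m_j}{m_i+m_j}\}$, $\langle v,I\rangle_i=\big(1+\frac{m_i}{2\mathrm m}|v|^2+\frac{I}{\mathrm m}\big)^{1/2}$ for $(v,I)\in\mathbb R^3\times[0,\infty)$, and $\|f\|_{L^p_{i,k}}=\|f\langle\cdot\rangle_i^k\|_{L^p(\mathrm dv\,\mathrm dI)}$. For $(v,I),(v_*,I_*)$ let $u=v-v_*$, $\hat u=u/|u|$, $E_{ij}=\frac{\mu_{ij}}2|u|^2+I+I_*$, $V_{ij}=\frac{m_iv+m_jv_*}{m_i+m_j}$, and for $\sigma\in\mathbb S^2$, $r,R\in[0,1]$ let $$v'=V_{ij}+\tfrac{m_j}{m_i+m_j}\sqrt{\tfrac{2RE_{ij}}{\mu_{ij}}}\,\sigma,\quad v'_*=V_{ij}-\tfrac{m_i}{m_i+m_j}\sqrt{\tfrac{2RE_{ij}}{\mu_{ij}}}\,\sigma,\quad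 I'=r(1-R)E_{ij},\quad I'_*=(1-r)(1-R)E_{ij},$$ $\sigma'=\hat u$, $R'=\frac{\mu_{ij}|u|^2}{2E_{ij}}$, $r'=\frac{I}{I+I_*}$, and $d_{ij}(r,R)=r^{\alpha_i}(1-r)^{\alpha_j}(1-R)^{\alpha_i+\alpha_j+1}\sqrt R$. The measurable kernels $\mathcal B_{ij}\ge0$ satisfy, for $u\ne0$, $I,I_*>0$, $r,R\in(0,1)$, $$\mathcal B_{ij}(v,v_*,I,I_*,\sigma,r,R)=\mathcal B_{ij}(v',v'_*,I',I'_*,\sigma',r',R')=\mathcal B_{ji}(v_*,v,I_*,I,-\sigma,1-r,R),$$ $$b_{ij}(\hat u\cdot\sigma)\,\tilde b^{lb}_{ij}(r,R)\Big(\frac{E_{ij}}{\mathrm m}\Big)^{\gamma_{ij}/2}\le\mathcal B_{ij}\le b_{ij}(\hat u\cdot\sigma)\,\tilde b^{ub}_{ij}(r,R)\Big(\frac{E_{ij}}{\mathrm m}\Big)^{\gamma_{ij}/2},$$ where $\gamma_{ij}=\gamma_{ji}\in[0,2]$, $b_{ij}=b_{ji}\ge0$ is integrable on $[-1,1]$,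 $\tilde b^{lb}_{ij},\tilde b^{ub}_{ij}\ge0$ belong to $L^1([0,1]^2;d_{ij}\,\mathrm dr\,\mathrm dR)$. Write $\|b\|_{L^1}=2\pi\int_{-1}^1|b(s)|\,\mathrm ds$. Set $$Q^+_{ij}(f,g)(v,I)=\int f(v',I')\,g(v'_*,I'_*)\Big(\frac I{I'}\Big)^{\alpha_i}\Big(\frac{I_*}{I'_*}\Big)^{\alpha_j}\mathcal B_{ij}\,d_{ij}\,\mathrm d\sigma\,\mathrm dr\,\mathrm dR\,\mathrm dv_*\,\mathrm dI_*,$$ $$Q^-_{ij}(f,g)(v,I)=f(v,I)\int g(v_*,I_*)\,\mathcal B_{ij}\,d_{ij}\,\mathrm d\sigma\,\mathrm dr\,\mathrm dR\,\mathrm dv_*\,\mathrm dI_*,$$ (integrals over $\mathbb R^3\times[0,\infty)\times\mathbb S^2\times[0,1]^2$), and, for $p\ge1$ and $k\ge0$, $$\mathcal Q^\pm_{ij}[f,g]=\int_{\mathbb R^3\times[0,\infty)}\Big(Q^\pm_{ij}(f,g)\,f^{p-1}\langle v,I\rangle_i^{kp}+Q^\pm_{ji}(g,f)\,g^{p-1}\langle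 v,I\rangle_j^{kp}\Big)\mathrm dv\,\mathrm dI,\qquad \mathcal Q_{ij}=\mathcal Q^+_{ij}-\mathcal Q^-_{ij}.$$ \textbf{Constants.} Let $\frac1q=1-\frac1p$ ($\frac1q=0$ if $p=1$) and $n=k+\gamma_{ij}+1$. Put $H[f]=\int f|\log f|\,\mathrm dv\,\mathrm dI$, $$\rho_{ij}(q)=\int_{[0,1]^2}r^{-(1+\gamma_{ij}/2)/q}(1-R)^{-1/q}d_{ij}\,\tilde b^{ub}_{ij}\,\mathrm dr\,\mathrm dR,\qquad c_{ij}=2^{\frac{\gamma_{ij}}{2q}}\,\bar s_{ij}^{-\frac{3+\gamma_{ij}}q}\rho_{ij}(q).$$ Let $\omega_{ij}$ be the volume of $\{(w,J)\in\mathbb R^3\times[0,\infty):\frac{\mu_{ij}}{2\mathrm m}|w|^2+\frac J{\mathrm m}\le1\}$. For a density $g$ of species $j$ let $$\delta^5=\frac{\|g\|_{L^1}}{4\,\omega_{ij}}e^{-4H[g]/\|g\|_{L^1}},\quad L_1=\min\{1,2^{1-\gamma_{ij}}\}\Big(\frac{\bar s_{ij}}2\Big)^{\gamma_{ij}/2},\quad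 L_2=\tfrac12\,\delta^{\gamma_{ij}}\|g\|_{L^1},$$ $$c^{lb}_{ij}[g]=\frac{L_2}2\min\Big\{1,\frac{L_1\|g\|_{L^1}}{L_2+\|g\|_{L^1_{j,\gamma_{ij}}}}\Big\}\,\|\tilde b^{lb}_{ij}\|_{L^1(d_{ij}\mathrm dr\mathrm dR)},$$ $$c^j[g]=\|g\|_{L^1_{j,n}}^{(n-1)/n}\Big(H[g]+\tfrac{k+\gamma_{ij}+6}2\|g\|_{L^1_{j,\min\{2,n\}}}\Big)^{1/n},\qquad \hat c_j=\|\langle\cdot\rangle_j^{-6}\|_{L^1},$$ and likewise with the roles of $(i,f)$ and $(j,g)$ exchanged. Further, $$C_1^{ij}[f,g]=2^{\frac{p-1}{2p}}\Big(c_{ij}\|g\|_{L^1_{j,k+\gamma_{ij}}}+\tfrac{c_{ij}}q\|f\|_{L^1_{i,k+\gamma_{ij}}}+\tfrac{c_{ji}}p\|g\|_{L^1_{j,k+\gamma_{ij}}}\Big),\qquad C_2^{ij}[f,g]=c_{ij}c^j[g]+\tfrac{c_{ij}}q c^i[f]+\tfrac{c_{ji}}p c^j[g],$$ $$\varepsilon=\tfrac14\|b_{ij}\|_{L^1}\min\Big\{\frac{c^{lb}_{ij}[g]}{C_1^{ij}[f,g]},\frac{c^{lb}_{ji}[f]}{C_1^{ji}[g,f]}\Big\}.$$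 Given a decomposition $b_{ij}=b^1_{ij}+b^\infty_{ij}$ with $\|b^1_{ij}\|_{L^1}\le\varepsilon$, $b^\infty_{ij}\in L^\infty$, put $$\tilde\varepsilon=\frac q{64\pi}\frac{\|b_{ij}\|_{L^1}}{\|b^\infty_{ij}\|_{L^\infty}}\min\Big\{\frac{c^{lb}_{ij}[g]}{c_{ij}},\frac{c^{lb}_{ji}[f]}{c_{ji}}\Big\},\qquad K=\exp\Big(\Big[32\pi\frac{\|b^\infty_{ij}\|_{L^\infty}}{\|b_{ij}\|_{L^1}}\max\Big\{\frac{C_2^{ij}[f,g]}{c^{lb}_{ij}[g]},\frac{C_2^{ji}[g,f]}{c^{lb}_{ji}[f]}\Big\}\Big]^{n}\Big),$$ $$B_{ij}[f,g]=\frac{K^p}{p\,\tilde\varepsilon^{\,p-1}}(c_{ij}+c_{ji})\Big(\hat c_j\|f\|^p_{L^1_{i,\gamma_{ij}/p+k}}+\hat c_i\|g\|^p_{L^1_{j,\gamma_{ij}/p+k}}\Big)\qquad(\tilde\varepsilon^{\,p-1}=1\text{ if }p=1;\ \text{terms with factor }\|b^\infty_{ij}\|_{L^\infty}=0\text{ vanish}).$$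 \textbf{Statement.} Let $p\in[1,\infty)$, $k\ge0$, and let $f,g\ge0$ be not a.e. zero, with $f\in L^p_{i,\gamma_{ij}/p+k}\cap L^1_{i,k+\gamma_{ij}+1}$, $g\in L^p_{j,\gamma_{ij}/p+k}\cap L^1_{j,k+\gamma_{ij}+1}$, $H[f],H[g]<\infty$. Assume $\rho_{ij}(q),\rho_{ji}(q)<\infty$ and that $\tilde b^{lb}_{ij},\tilde b^{lb}_{ji}$ are not a.e. zero. Then $\mathcal Q^+_{ij}[f,g]$ and $\mathcal Q^-_{ij}[f,g]$ are finite, a decomposition $b_{ij}=b_{ij}^1+b_{ij}^\infty$ as above exists, and for every such decomposition $$\mathcal Q_{ij}[f,g]\le-\tfrac12\|b_{ij}\|_{L^1}\Big(c^{lb}_{ij}[g]\,\|f\|^p_{L^p_{i,\gamma_{ij}/p+k}}+c^{lb}_{ji}[f]\,\|g\|^p_{L^p_{j,\gamma_{ij}/p+k}}\Big)+4\pi\|b^\infty_{ij}\|_{L^\infty}B_{ij}[f,g].$$ -/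

import Mathlib

open MeasureTheory Set
open scoped ENNReal

noncomputable section

/-- Velocity space `ℝ³` with the Euclidean norm. -/
abbrev Vel : Type := EuclideanSpace ℝ (Fin 3)

/-- Velocity - internal energy pairs `(v, I)`; only `I ≥ 0` is charged by `stateMeasure`. -/
abbrev MolState : Type := Vel × ℝ

/-- The measure `dv dI` on `ℝ³ × [0, ∞)`. -/
def stateMeasure : Measure MolState :=
  (volume : Measure Vel).prod (volume.restrict (Ici (0 : ℝ)))

/-- The surface measure `dσ` on the unit sphere of `ℝ³` (total mass `4π`). -/
def sphereMeasure : Measure (Metric.sphere (0 : Vel) 1) :=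
  (volume : Measure Vel).toSphere

/-- The measure `dr dR` on `[0, 1]²`. -/
def exchangeMeasure : Measure (ℝ × ℝ) :=
  (volume.restrict (Icc (0 : ℝ) 1)).prod (volume.restrict (Icc (0 : ℝ) 1))

/-- The measure `dσ dr dR` on `𝕊² × [0, 1]²`. -/
def collisionMeasure : Measure (Metric.sphere (0 : Vel) 1 × (ℝ × ℝ)) :=
  sphereMeasure.prod exchangeMeasure

/-- The direction `û = u / |u|`. -/
def unitDir (u : Vel) : Vel := ‖u‖⁻¹ • u

/-- A mixture of `P` polyatomic gases: masses `m_i > 0` and parameters `α_i > -1`. -/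
structure GasMixture (P : ℕ) where
  m : Fin P → ℝ
  m_pos : ∀ i, 0 < m i
  α : Fin P → ℝ
  neg_one_lt_α : ∀ i, -1 < α i

namespace GasMixture

variable {P : ℕ} (M : GasMixture P)

/-- `𝗆 = ∑ m_ℓ`. -/
def totalMass : ℝ := ∑ l, M.m l

/-- The reduced mass `μ_ij`. -/
def redMass (i j : Fin P) : ℝ := M.m i * M.m j / (M.m i + M.m j)

/-- `s̄_ij = min {m_i / (m_i + m_j), m_j / (m_i + m_j)}`. -/
def minRatio (i j : Fin P) : ℝ :=
  min (M.m i / (M.m i + M.m j)) (M.m j / (M.m i + M.m j))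

/-- The Lebesgue bracket `⟨v, I⟩_i`. -/
def bracket (i : Fin P) (x : MolState) : ℝ :=
  √(1 + M.m i / (2 * M.totalMass) * ‖x.1‖ ^ 2 + x.2 / M.totalMass)

/-- Membership in `L^p_{i,k}`, for real `p ≥ 1`. -/
def InLp (i : Fin P) (p k : ℝ) (f : MolState → ℝ) : Prop :=
  MemLp (fun x => f x * M.bracket i x ^ k) (ENNReal.ofReal p) stateMeasure

/-- The norm of `L^p_{i,k}`, for real `p ≥ 1`. -/
def norm (i : Fin P) (p k : ℝ) (f : MolState → ℝ) : ℝ :=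
  (eLpNorm (fun x => f x * M.bracket i x ^ k) (ENNReal.ofReal p) stateMeasure).toReal

/-- The energy `E_ij` in the centre-of-mass frame; `x = (v, I)`, `y = (v_*, I_*)`. -/
def energy (i j : Fin P) (x y : MolState) : ℝ :=
  M.redMass i j / 2 * ‖x.1 - y.1‖ ^ 2 + x.2 + y.2

/-- The centre-of-mass velocity `V_ij`. -/
def velCM (i j : Fin P) (x y : MolState) : Vel :=
  (M.m i + M.m j)⁻¹ • (M.m i • x.1 + M.m j • y.1)

/-- `(v', I')` in the Borgnakke-Larsen parametrization. -/
def post (i j : Fin P) (x y : MolState) (σ : Vel) (r R : ℝ) : MolState :=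
  (M.velCM i j x y +
      (M.m j / (M.m i + M.m j) * √(2 * R * M.energy i j x y / M.redMass i j)) • σ,
    r * (1 - R) * M.energy i j x y)

/-- `(v'_*, I'_*)` in the Borgnakke-Larsen parametrization. -/
def postStar (i j : Fin P) (x y : MolState) (σ : Vel) (r R : ℝ) : MolState :=
  (M.velCM i j x y -
      (M.m i / (M.m i + M.m j) * √(2 * R * M.energy i j x y / M.redMass i j)) • σ,
    (1 - r) * (1 - R) * M.energy i j x y)

/-- `r' = I / (I + I_*)`. -/
def rPrime (x y : MolState) : ℝ := x.2 / (x.2 + y.2)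

/-- `R' = μ_ij |u|² / (2 E_ij)`. -/
def RPrime (i j : Fin P) (x y : MolState) : ℝ :=
  M.redMass i j * ‖x.1 - y.1‖ ^ 2 / (2 * M.energy i j x y)

/-- The weight `d_ij(r, R)`. -/
def dWeight (i j : Fin P) (r R : ℝ) : ℝ :=
  r ^ M.α i * (1 - r) ^ M.α j * (1 - R) ^ (M.α i + M.α j + 1) * √R

/-- Collision configurations off the null set on which `û`, `r'` or the powers of the energies
degenerate. It is invariant under the pre-post transformation. -/
def Admissible (x y : MolState) (σ : Vel) (r R : ℝ) : Prop :=
  x.1 ≠ y.1 ∧ 0 < x.2 ∧ 0 < y.2 ∧ ‖σ‖ = 1 ∧ r ∈ Ioo (0 : ℝ) 1 ∧ R ∈ Ioo (0 : ℝ) 1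

end GasMixture

/-- A family of collision kernels `B_ij` for the mixture, with the bounds
`b_ij b̃^lb_ij B̃_ij ≤ B_ij ≤ b_ij b̃^ub_ij B̃_ij`, `B̃_ij = (E_ij / 𝗆)^(γ_ij / 2)`,
and integrable angular part. -/
structure CollisionKernel {P : ℕ} (M : GasMixture P) where
  /-- `B i j (v, I) (v_*, I_*) σ r R`; only unit vectors `σ` matter. -/
  B : Fin P → Fin P → MolState → MolState → Vel → ℝ → ℝ → ℝ
  γ : Fin P → Fin P → ℝ
  /-- angular part, on `[-1, 1]` -/
  b : Fin P → Fin P → ℝ → ℝ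
  /-- lower and upper profiles in `(r, R)` -/
  blb : Fin P → Fin P → ℝ → ℝ → ℝ
  bub : Fin P → Fin P → ℝ → ℝ → ℝ
  measurable_B : ∀ i j, Measurable
    (fun z : MolState × MolState × Vel × ℝ × ℝ => B i j z.1 z.2.1 z.2.2.1 z.2.2.2.1 z.2.2.2.2)
  γ_symm : ∀ i j, γ i j = γ j i
  γ_mem : ∀ i j, γ i j ∈ Icc (0 : ℝ) 2
  b_nonneg : ∀ i j, ∀ s ∈ Icc (-1 : ℝ) 1, 0 ≤ b i j s
  b_symm : ∀ i j, ∀ s ∈ Icc (-1 : ℝ) 1, b i j s = b j i s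
  b_integrable : ∀ i j, IntegrableOn (b i j) (Icc (-1 : ℝ) 1)
  blb_nonneg : ∀ i j, ∀ r ∈ Ioo (0 : ℝ) 1, ∀ R ∈ Ioo (0 : ℝ) 1, 0 ≤ blb i j r R
  bub_nonneg : ∀ i j, ∀ r ∈ Ioo (0 : ℝ) 1, ∀ R ∈ Ioo (0 : ℝ) 1, 0 ≤ bub i j r R
  blb_integrable : ∀ i j,
    Integrable (fun z : ℝ × ℝ => blb i j z.1 z.2 * M.dWeight i j z.1 z.2) exchangeMeasure
  bub_integrable : ∀ i j,
    Integrable (fun z : ℝ × ℝ => bub i j z.1 z.2 * M.dWeight i j z.1 z.2) exchangeMeasure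
  lower_bound : ∀ i j x y σ r R, GasMixture.Admissible x y σ r R →
    b i j (inner ℝ (unitDir (x.1 - y.1)) σ) * blb i j r R *
      (M.energy i j x y / M.totalMass) ^ (γ i j / 2) ≤ B i j x y σ r R
  upper_bound : ∀ i j x y σ r R, GasMixture.Admissible x y σ r R →
    B i j x y σ r R ≤ b i j (inner ℝ (unitDir (x.1 - y.1)) σ) * bub i j r R *
      (M.energy i j x y / M.totalMass) ^ (γ i j / 2)
  /-- microreversibility: exchange of pre- and post-collisional states -/
  micro_prePost : ∀ i j x y σ r R, GasMixture.Admissible x y σ r R →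
    B i j (M.post i j x y σ r R) (M.postStar i j x y σ r R) (unitDir (x.1 - y.1))
      (GasMixture.rPrime x y) (M.RPrime i j x y) = B i j x y σ r R
  /-- microreversibility: exchange of the colliding molecules -/
  micro_swap : ∀ i j x y σ r R, GasMixture.Admissible x y σ r R →
    B j i y x (-σ) (1 - r) R = B i j x y σ r R

/-- `‖b‖_{L¹(𝕊²)} = 2π ∫_{-1}^{1} |b|` for an angular function `b`. -/
def angularL1 (b : ℝ → ℝ) : ℝ := 2 * Real.pi * ∫ s in Icc (-1 : ℝ) 1, |b s|

/-- `‖b‖_{L^∞}` for an angular function `b`. -/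
def angularLinf (b : ℝ → ℝ) : ℝ :=
  (eLpNorm b ⊤ (volume.restrict (Icc (-1 : ℝ) 1))).toReal

/-- A decomposition `b = b₁ + b_∞` with `‖b₁‖_{L¹} ≤ ε` and `b_∞ ∈ L^∞`. -/
structure IsAngularDecomp (b : ℝ → ℝ) (ε : ℝ) (b₁ bInf : ℝ → ℝ) : Prop where
  add_eq : ∀ᵐ s ∂(volume.restrict (Icc (-1 : ℝ) 1)), b s = b₁ s + bInf s
  integrable : IntegrableOn b₁ (Icc (-1 : ℝ) 1)
  small : angularL1 b₁ ≤ ε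
  bounded : MemLp bInf ⊤ (volume.restrict (Icc (-1 : ℝ) 1))

/-- `H[f] < ∞`. -/
def FiniteEntropy (f : MolState → ℝ) : Prop :=
  Integrable (fun x => f x * |Real.log (f x)|) stateMeasure

/-- `H[f] = ∫ f |log f| dv dI`. -/
def entropyH (f : MolState → ℝ) : ℝ := ∫ x, f x * |Real.log (f x)| ∂stateMeasure

namespace CollisionKernel

variable {P : ℕ} {M : GasMixture P} (Q : CollisionKernel M)

/-- The gain operator `Q⁺_ij(f, g)(v, I)`, an integral of a nonnegative function. -/
def gain (i j : Fin P) (f g : MolState → ℝ) (x : MolState) : ℝ≥0∞ :=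
  ∫⁻ y, ∫⁻ w, ENNReal.ofReal
      (f (M.post i j x y w.1 w.2.1 w.2.2) * g (M.postStar i j x y w.1 w.2.1 w.2.2) *
        (x.2 / (M.post i j x y w.1 w.2.1 w.2.2).2) ^ M.α i *
        (y.2 / (M.postStar i j x y w.1 w.2.1 w.2.2).2) ^ M.α j *
        Q.B i j x y w.1 w.2.1 w.2.2 * M.dWeight i j w.2.1 w.2.2)
    ∂collisionMeasure ∂stateMeasure

/-- The collision frequency `ν_ij[g](v, I)`. -/
def freq (i j : Fin P) (g : MolState → ℝ) (x : MolState) : ℝ≥0∞ :=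
  ∫⁻ y, ∫⁻ w, ENNReal.ofReal
      (g y * Q.B i j x y w.1 w.2.1 w.2.2 * M.dWeight i j w.2.1 w.2.2)
    ∂collisionMeasure ∂stateMeasure

/-- The loss operator `Q⁻_ij(f, g)(v, I) = f(v, I) ν_ij[g](v, I)`. -/
def loss (i j : Fin P) (f g : MolState → ℝ) (x : MolState) : ℝ≥0∞ :=
  ENNReal.ofReal (f x) * Q.freq i j g x

/-- The bilinear form `𝒬⁺_ij[f, g]` of the gain operator. -/
def gainForm (i j : Fin P) (p k : ℝ) (f g : MolState → ℝ) : ℝ≥0∞ :=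
  ∫⁻ x, (Q.gain i j f g x * ENNReal.ofReal (f x ^ (p - 1) * M.bracket i x ^ (k * p)) +
    Q.gain j i g f x * ENNReal.ofReal (g x ^ (p - 1) * M.bracket j x ^ (k * p))) ∂stateMeasure

/-- The bilinear form `𝒬⁻_ij[f, g]` of the loss operator. -/
def lossForm (i j : Fin P) (p k : ℝ) (f g : MolState → ℝ) : ℝ≥0∞ :=
  ∫⁻ x, (Q.loss i j f g x * ENNReal.ofReal (f x ^ (p - 1) * M.bracket i x ^ (k * p)) +
    Q.loss j i g f x * ENNReal.ofReal (g x ^ (p - 1) * M.bracket j x ^ (k * p))) ∂stateMeasure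

/-- `𝒬_ij[f, g] = 𝒬⁺_ij[f, g] - 𝒬⁻_ij[f, g]`, meaningful when both are finite. -/
def bilinForm (i j : Fin P) (p k : ℝ) (f g : MolState → ℝ) : ℝ :=
  (Q.gainForm i j p k f g).toReal - (Q.lossForm i j p k f g).toReal

/-- The integrand of `ρ_ij(q)`. Throughout, the exponent `q ∈ (1, ∞]` conjugate to `p` enters
through `1 / q = 1 - 1 / p`. -/
def rhoIntegrand (i j : Fin P) (p : ℝ) (z : ℝ × ℝ) : ℝ :=
  z.1 ^ (-((1 + Q.γ i j / 2) * (1 - 1 / p))) * (1 - z.2) ^ (-(1 - 1 / p)) *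
    M.dWeight i j z.1 z.2 * Q.bub i j z.1 z.2

/-- `ρ_ij(q) < ∞`. -/
def RhoFinite (i j : Fin P) (p : ℝ) : Prop :=
  Integrable (Q.rhoIntegrand i j p) exchangeMeasure

/-- `ρ_ij(q)`. -/
def rho (i j : Fin P) (p : ℝ) : ℝ := ∫ z, Q.rhoIntegrand i j p z ∂exchangeMeasure

/-- `c_ij(q) = 2^(γ_ij / (2q)) s̄_ij^(-(3 + γ_ij) / q) ρ_ij(q)`. -/
def cq (i j : Fin P) (p : ℝ) : ℝ :=
  2 ^ (Q.γ i j / 2 * (1 - 1 / p)) * M.minRatio i j ^ (-((3 + Q.γ i j) * (1 - 1 / p))) *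
    Q.rho i j p

/-- `‖b̃^lb_ij‖_{L¹(d_ij dr dR)}`. -/
def blbNorm (i j : Fin P) : ℝ :=
  ∫ z, Q.blb i j z.1 z.2 * M.dWeight i j z.1 z.2 ∂exchangeMeasure

/-- Volume of `{(w, J) : μ_ij |w|² / (2𝗆) + J / 𝗆 ≤ 1, J ≥ 0}`. The same set with right-hand side
`δ²` has `δ⁵` times this volume. -/
def unitBallVol (M : GasMixture P) (i j : Fin P) : ℝ :=
  (stateMeasure {y : MolState |
    M.redMass i j / (2 * M.totalMass) * ‖y.1‖ ^ 2 + y.2 / M.totalMass ≤ 1}).toReal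

/-- `δ_ij[g]`: `4 e^(4 H[g] / ‖g‖_{L¹})` times the volume above times `δ⁵` equals `‖g‖_{L¹}`. -/
def delta (M : GasMixture P) (i j : Fin P) (g : MolState → ℝ) : ℝ :=
  (M.norm j 1 0 g * Real.exp (-(4 * entropyH g / M.norm j 1 0 g)) /
    (4 * unitBallVol M i j)) ^ (1 / 5 : ℝ)

/-- `L₁ = min {1, 2^(1 - γ_ij)} (s̄_ij / 2)^(γ_ij / 2)`. -/
def lowL1 (i j : Fin P) : ℝ :=
  min 1 (2 ^ (1 - Q.γ i j)) * (M.minRatio i j / 2) ^ (Q.γ i j / 2)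

/-- `L₂ = δ^γ_ij ‖g‖_{L¹} / 2`. -/
def lowL2 (i j : Fin P) (g : MolState → ℝ) : ℝ :=
  delta M i j g ^ Q.γ i j * M.norm j 1 0 g / 2

/-- `c^lb_ij[g]`; here `g` describes species `j`. -/
def clb (i j : Fin P) (g : MolState → ℝ) : ℝ :=
  Q.lowL2 i j g / 2 *
    min 1 (Q.lowL1 i j * M.norm j 1 0 g / (Q.lowL2 i j g + M.norm j 1 (Q.γ i j) g)) *
    Q.blbNorm i j

/-- `C₁^{ij}[f, g]`. -/
def C1 (i j : Fin P) (p k : ℝ) (f g : MolState → ℝ) : ℝ :=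
  2 ^ ((p - 1) / (2 * p)) *
    (Q.cq i j p * M.norm j 1 (k + Q.γ i j) g +
      (1 - 1 / p) * Q.cq i j p * M.norm i 1 (k + Q.γ i j) f +
      1 / p * Q.cq j i p * M.norm j 1 (k + Q.γ i j) g)

/-- For a density `g` of species `l` and rate `γ`, with `n = k + γ + 1` and `ℓ = k + γ + 6`:
`‖g‖_{L¹_{l,n}}^((n - 1) / n) (H[g] + (ℓ / 2) ‖g‖_{L¹_{l,min(2,n)}})^(1 / n)`. -/
def entropyConst (M : GasMixture P) (l : Fin P) (k γ : ℝ) (g : MolState → ℝ) : ℝ :=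
  M.norm l 1 (k + γ + 1) g ^ ((k + γ) / (k + γ + 1)) *
    (entropyH g + (k + γ + 6) / 2 * M.norm l 1 (min 2 (k + γ + 1)) g) ^ (1 / (k + γ + 1))

/-- `C₂^{ij}[f, g]`. -/
def C2 (i j : Fin P) (p k : ℝ) (f g : MolState → ℝ) : ℝ :=
  Q.cq i j p * entropyConst M j k (Q.γ i j) g +
    (1 - 1 / p) * Q.cq i j p * entropyConst M i k (Q.γ i j) f +
    1 / p * Q.cq j i p * entropyConst M j k (Q.γ i j) g

/-- The level `ε` at which the angular part is decomposed. -/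
def eps (i j : Fin P) (p k : ℝ) (f g : MolState → ℝ) : ℝ :=
  1 / 4 * angularL1 (Q.b i j) *
    min (Q.clb i j g / Q.C1 i j p k f g) (Q.clb j i f / Q.C1 j i p k g f)

/-- The parameter `ε̃`; it is only used through `ε̃^(p - 1)`, which is `1` for `p = 1`. -/
def epsTilde (i j : Fin P) (p : ℝ) (f g : MolState → ℝ) (βInf : ℝ) : ℝ :=
  1 / (64 * Real.pi * (1 - 1 / p)) * (angularL1 (Q.b i j) / βInf) *
    min (Q.clb i j g / Q.cq i j p) (Q.clb j i f / Q.cq j i p)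

/-- The truncation level `K`; `βInf` stands for `‖b^∞_ij‖_{L^∞}`. -/
def truncK (i j : Fin P) (p k : ℝ) (f g : MolState → ℝ) (βInf : ℝ) : ℝ :=
  Real.exp ((32 * Real.pi * (βInf / angularL1 (Q.b i j)) *
    max (Q.C2 i j p k f g / Q.clb i j g) (Q.C2 j i p k g f / Q.clb j i f)) ^
      (k + Q.γ i j + 1))

/-- `ĉ_l = ‖⟨·⟩_l^(-6)‖_{L¹}`. -/
def cHat (M : GasMixture P) (l : Fin P) : ℝ := M.norm l 1 (-6) (fun _ => 1)

/-- The constant `B_ij[f, g]`; `βInf` stands for `‖b^∞_ij‖_{L^∞}`. -/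
def Bconst (i j : Fin P) (p k : ℝ) (f g : MolState → ℝ) (βInf : ℝ) : ℝ :=
  Q.truncK i j p k f g βInf ^ p / (p * Q.epsTilde i j p f g βInf ^ (p - 1)) *
    (Q.cq i j p + Q.cq j i p) *
    (cHat M j * M.norm i 1 (Q.γ i j / p + k) f ^ p +
      cHat M i * M.norm j 1 (Q.γ i j / p + k) g ^ p)

end CollisionKernel

end

/-!
The loss form dominates `‖b‖ (c^lb[g] X + c^lb[f] Y)`, where `X` and `Y` are the `p`-th powers of the norms of `f` and `g`
with weight `γ/p + k`, and the gain form is bounded by half of this expression plus a constant.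

*Gain, weak form.* Pairs of states are described by the velocity of the centre of mass, the relative
energy `E` and the Borgnakke-Larsen parameters `(σ, r, R)` (`GasMixture.lintegral_pair_eq`). The
pre-post transformation only exchanges these parameters with those of the collision, so that with
microreversibility the integral of `Q⁺(f, g) φ` becomes the integral of `f g φ(v', I')`
(`CollisionKernel.lintegral_gain_mul`).

*Gain, trilinear estimates.* The power `E^(γ/2)` of the kernel has to be shared between the
incoming densities and the factor at `(v', I')` without losing moments. For `û · σ > 0` the vector
`v' - v_*` is a sum of two vectors at an acute angle, so `E` is controlled by `⟨v', I'⟩` and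
`⟨v_*, I_*⟩`; for `û · σ < 0` the same holds with `⟨v, I⟩` (`energy_div_le_of_acute`,
`energy_div_le_of_obtuse`, `weight_le`). Hence the gain form is dominated by two trilinear forms, in
each of which only one incoming density carries the `L^p` norm (`lintegral_gain_le_tri`). Such a
form is estimated by Hölder's inequality in the state of one incoming molecule and `σ`; the map to
the outgoing state has constant Jacobian for fixed `σ`, and the remaining mean of the angular weight
is at most its mean over the sphere, because the cosine of the deflected direction is an expanding
function of the original cosine where it is positive (`lintegral_post_le`, `lintegral_cosine_le`,
`tri_le_right`, `tri_le_left`). The `(r, R)` integral that results is `c_ij(q)`.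

*Absorption.* The part `b₁` of `b`, small in `L¹`, contributes at most a quarter of the loss. For
the bounded part either incoming molecule may be moved in Hölder's inequality, so the density which
carries no `L^p` norm can be truncated at the level `K ⟨·⟩^(-(k + γ + 6))`: the part above has
small mass by the entropy bound (`lintegral_largePart_le`), the part below is in `L^p` with a norm
independent of the density (`lintegral_smallPart_le`), and Young's inequality turns its contribution
into a small multiple of the loss and the constant `B` (`lintegral_gain_le`, `gainForm_le`).

*Loss.* A density of finite entropy cannot concentrate on the small set where `E ≤ δ² 𝗆`, so the
`γ/2`-moment of `E` is bounded below by `L₂`; it also grows like `⟨x⟩^γ`. A convex combination of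
both bounds gives a lower bound by a multiple of `⟨x⟩^γ` (`le_integral_energy_rpow`, `le_freq`).

The three contributions to the gain, a quarter and twice an eighth of the loss, add up to one half
(`gain_le_half_loss`).
-/

/-! ### Polar coordinates and zonal integrals in `ℝ³` -/

instance : IsFiniteMeasure sphereMeasure := by unfold sphereMeasure; infer_instance

lemma measurable_unitDir : Measurable unitDir := by
  unfold unitDir; fun_prop

lemma norm_unitDir {u : Vel} (hu : u ≠ 0) : ‖unitDir u‖ = 1 := by
  simp [unitDir, norm_smul, hu]

lemma unitDir_smul {c : ℝ} (hc : 0 < c) (u : Vel) : unitDir (c • u) = unitDir u := by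
  unfold unitDir
  rw [norm_smul, smul_smul, Real.norm_of_nonneg hc.le, mul_inv, mul_right_comm,
    inv_mul_cancel₀ hc.ne', one_mul]

lemma unitDir_neg (u : Vel) : unitDir (-u) = -unitDir u := by simp [unitDir]

lemma lintegral_Vel_polar (H : Vel → ℝ≥0∞) (hH : Measurable H) :
    ∫⁻ u, H u = ∫⁻ σ : Metric.sphere (0 : Vel) 1, (∫⁻ ρ in Ioi (0 : ℝ),
      ENNReal.ofReal (ρ ^ 2) * H (ρ • (σ : Vel))) ∂sphereMeasure := by
  have h1 : ∫⁻ u, H u = ∫⁻ u : ({(0 : Vel)}ᶜ : Set Vel), H u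
      ∂((volume : Measure Vel).comap Subtype.val) := by
    rw [lintegral_subtype_comap (measurableSet_singleton _).compl H, restrict_compl_singleton]
  have h2 := (volume : Measure Vel).measurePreserving_homeomorphUnitSphereProd.symm
    (homeomorphUnitSphereProd Vel).toMeasurableEquiv
  rw [h1, ← h2.lintegral_comp (by fun_prop)]
  rw [lintegral_prod _ (by
    apply Measurable.aemeasurable
    exact (hH.comp measurable_subtype_coe).comp h2.measurable)]
  refine lintegral_congr fun σ => ?_
  have h3 : Module.finrank ℝ Vel - 1 = 2 := by simp
  rw [h3, Measure.volumeIoiPow, lintegral_withDensity_eq_lintegral_mul]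
  · rw [← lintegral_subtype_comap measurableSet_Ioi]
    rfl
  · fun_prop
  · exact (hH.comp measurable_subtype_coe).comp (h2.measurable.comp measurable_prodMk_left)

lemma lintegral_Vel_eq_coords (H : Vel → ℝ≥0∞) (hH : Measurable H) :
    ∫⁻ u, H u = ∫⁻ a : ℝ, ∫⁻ z : ℝ × ℝ, H (!₂[a, z.1, z.2]) := by
  rw [← (PiLp.volume_preserving_toLp (Fin 3)).lintegral_comp hH]
  rw [← (volume_preserving_piFinSuccAbove (fun _ : Fin 3 => ℝ) 0).symm.lintegral_comp
    (f := fun a => H (WithLp.toLp 2 a)) (hH.comp (WithLp.measurable_toLp _ _))]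
  rw [Measure.volume_eq_prod, lintegral_prod _ (by
    apply Measurable.aemeasurable
    exact (hH.comp (WithLp.measurable_toLp _ _)).comp (MeasurableEquiv.measurable _))]
  refine lintegral_congr fun a => ?_
  rw [← (volume_preserving_finTwoArrow ℝ).lintegral_comp (f := fun z => H !₂[a, z.1, z.2]) (by
    fun_prop)]
  refine lintegral_congr fun z => ?_
  congr 2
  ext i
  fin_cases i <;> rfl

lemma lintegral_radial_plane (G : ℝ → ℝ≥0∞) (hG : Measurable G) :
    ∫⁻ z : ℝ × ℝ, G (√(z.1 ^ 2 + z.2 ^ 2)) =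
      ENNReal.ofReal (2 * Real.pi) * ∫⁻ ρ in Ioi (0 : ℝ), ENNReal.ofReal ρ * G ρ := by
  rw [← lintegral_comp_polarCoord_symm, polarCoord_target, Measure.volume_eq_prod,
    ← Measure.prod_restrict, lintegral_prod _ (by
      apply Measurable.aemeasurable
      simp only [polarCoord_symm_apply]
      fun_prop), ← lintegral_const_mul _ (by fun_prop)]
  refine setLIntegral_congr_fun measurableSet_Ioi fun ρ hρ => ?_
  have : ∀ t : ℝ, √((ρ * Real.cos t) ^ 2 + (ρ * Real.sin t) ^ 2) = ρ := by
    intro t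
    rw [show (ρ * Real.cos t) ^ 2 + (ρ * Real.sin t) ^ 2 = ρ ^ 2 *
      (Real.sin t ^ 2 + Real.cos t ^ 2) by ring, Real.sin_sq_add_cos_sq, mul_one,
      Real.sqrt_sq (le_of_lt hρ)]
  simp only [polarCoord_symm_apply, this, smul_eq_mul, lintegral_const, Measure.restrict_apply_univ,
    Real.volume_Ioo]
  rw [mul_comm]
  congr 2
  ring

lemma lintegral_cos_Ioo (φ : ℝ → ℝ≥0∞) :
    ∫⁻ t in Ioo (0 : ℝ) Real.pi, ENNReal.ofReal (Real.sin t) * φ (Real.cos t) =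
      ∫⁻ s in Icc (-1 : ℝ) 1, φ s := by
  have himg : Real.cos '' Ioo 0 Real.pi = Ioo (-1) 1 := by
    ext s
    constructor
    · rintro ⟨t, ht, rfl⟩
      have h1 := Real.strictAntiOn_cos (left_mem_Icc.2 Real.pi_pos.le)
        (Ioo_subset_Icc_self ht) ht.1
      have h2 := Real.strictAntiOn_cos (Ioo_subset_Icc_self ht)
        (right_mem_Icc.2 Real.pi_pos.le) ht.2
      simp at h1 h2
      exact ⟨h2, h1⟩
    · intro hs
      exact ⟨Real.arccos s, ⟨Real.arccos_pos.2 hs.2, Real.arccos_lt_pi.2 hs.1⟩,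
        Real.cos_arccos hs.1.le hs.2.le⟩
  rw [← Measure.restrict_congr_set Ioo_ae_eq_Icc, ← himg,
    lintegral_image_eq_lintegral_abs_deriv_mul measurableSet_Ioo
      (fun x _ => (Real.hasDerivAt_cos x).hasDerivWithinAt)
      (Real.injOn_cos.mono Ioo_subset_Icc_self)]
  refine setLIntegral_congr_fun measurableSet_Ioo fun t ht => ?_
  simp only [abs_neg, abs_of_pos (Real.sin_pos_of_mem_Ioo ht)]

/-- Polar coordinates in the half-plane `ρ > 0`: a function of the angle and a function of the radius
integrate separately, and the cosine of the angle is uniform for the weight `ρ`. -/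
lemma lintegral_halfPlane (φ h : ℝ → ℝ≥0∞) (hφ : Measurable φ) (hh : Measurable h) :
    ∫⁻ a : ℝ, ∫⁻ ρ in Ioi (0 : ℝ), ENNReal.ofReal ρ *
        (φ (a / √(a ^ 2 + ρ ^ 2)) * h (√(a ^ 2 + ρ ^ 2))) =
      (∫⁻ s in Ioi (0 : ℝ), ENNReal.ofReal (s ^ 2) * h s) * ∫⁻ s in Icc (-1 : ℝ) 1, φ s := by
  have e1 : ∫⁻ a : ℝ, ∫⁻ ρ in Ioi (0 : ℝ), ENNReal.ofReal ρ *
        (φ (a / √(a ^ 2 + ρ ^ 2)) * h (√(a ^ 2 + ρ ^ 2))) =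
      ∫⁻ z : ℝ × ℝ, (Ioi (0 : ℝ)).indicator (fun ρ => ENNReal.ofReal ρ *
        (φ (z.1 / √(z.1 ^ 2 + ρ ^ 2)) * h (√(z.1 ^ 2 + ρ ^ 2)))) z.2 := by
    rw [Measure.volume_eq_prod, lintegral_prod]
    · refine lintegral_congr fun a => ?_
      exact (lintegral_indicator measurableSet_Ioi _).symm
    · apply Measurable.aemeasurable
      have : (fun z : ℝ × ℝ => (Ioi (0 : ℝ)).indicator (fun ρ => ENNReal.ofReal ρ *
        (φ (z.1 / √(z.1 ^ 2 + ρ ^ 2)) * h (√(z.1 ^ 2 + ρ ^ 2)))) z.2) =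
        (Prod.snd ⁻¹' Ioi (0 : ℝ)).indicator (fun z : ℝ × ℝ => ENNReal.ofReal z.2 *
        (φ (z.1 / √(z.1 ^ 2 + z.2 ^ 2)) * h (√(z.1 ^ 2 + z.2 ^ 2)))) := by
        ext z; simp [indicator]
      rw [this]
      refine Measurable.indicator ?_ (measurable_snd measurableSet_Ioi)
      fun_prop
  rw [e1, ← lintegral_comp_polarCoord_symm, polarCoord_target]
  have e2 : ∀ p ∈ Ioi (0 : ℝ) ×ˢ Ioo (-Real.pi) Real.pi, ENNReal.ofReal p.1 •
      (Ioi (0 : ℝ)).indicator (fun ρ => ENNReal.ofReal ρ *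
        (φ ((polarCoord.symm p).1 / √((polarCoord.symm p).1 ^ 2 + ρ ^ 2)) *
          h (√((polarCoord.symm p).1 ^ 2 + ρ ^ 2)))) (polarCoord.symm p).2 =
      (ENNReal.ofReal (p.1 ^ 2) * h p.1) * (Ioo 0 Real.pi).indicator
        (fun t => ENNReal.ofReal (Real.sin t) * φ (Real.cos t)) p.2 := by
    rintro ⟨s, t⟩ ⟨hs, ht⟩
    simp only [mem_Ioi, mem_Ioo] at hs ht
    simp only [polarCoord_symm_apply, smul_eq_mul]
    have hsq : √((s * Real.cos t) ^ 2 + (s * Real.sin t) ^ 2) = s := by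
      rw [show (s * Real.cos t) ^ 2 + (s * Real.sin t) ^ 2 = s ^ 2 *
        (Real.sin t ^ 2 + Real.cos t ^ 2) by ring, Real.sin_sq_add_cos_sq, mul_one,
        Real.sqrt_sq hs.le]
    by_cases h0 : 0 < t
    · have hsin := Real.sin_pos_of_mem_Ioo ⟨h0, ht.2⟩
      rw [indicator_of_mem (by exact mul_pos hs hsin), indicator_of_mem (by exact ⟨h0, ht.2⟩),
        hsq, mul_div_cancel_left₀ _ hs.ne', ENNReal.ofReal_mul hs.le, pow_two,
        ENNReal.ofReal_mul hs.le]
      ring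
    · have hsin : Real.sin t ≤ 0 := Real.sin_nonpos_of_nonpos_of_neg_pi_le (not_lt.1 h0) ht.1.le
      rw [indicator_of_notMem, indicator_of_notMem (by simp [h0])]
      · simp
      · simp only [mem_Ioi, not_lt]
        exact mul_nonpos_of_nonneg_of_nonpos hs.le hsin
  rw [setLIntegral_congr_fun (measurableSet_Ioi.prod measurableSet_Ioo) e2,
    Measure.volume_eq_prod, ← Measure.prod_restrict, lintegral_prod_mul (f := fun s => ENNReal.ofReal (s ^ 2) * h s)
      (g := (Ioo 0 Real.pi).indicator fun t => ENNReal.ofReal (Real.sin t) * φ (Real.cos t))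
      (by fun_prop) (by
      refine (Measurable.indicator (by fun_prop) measurableSet_Ioo).aemeasurable)]
  congr 1
  rw [lintegral_indicator measurableSet_Ioo, Measure.restrict_restrict measurableSet_Ioo,
    inter_eq_left.2 (Ioo_subset_Ioo_left (by linarith [Real.pi_pos])), lintegral_cos_Ioo]

/-- The zonal integration formula on `𝕊²`: the coordinate of a uniform point along a fixed axis is
uniformly distributed on `[-1, 1]`. -/
lemma lintegral_sphere_inner {e : Vel} (he : ‖e‖ = 1) (φ : ℝ → ℝ≥0∞) (hφ : Measurable φ) :
    ∫⁻ σ, φ (inner ℝ e (σ : Vel)) ∂sphereMeasure =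
      ENNReal.ofReal (2 * Real.pi) * ∫⁻ s in Icc (-1 : ℝ) 1, φ s := by
  -- Compare two evaluations of the integral of `φ (⟨e, u⟩ / ‖u‖)` over the unit ball.
  let h : ℝ → ℝ≥0∞ := (Iio (1 : ℝ)).indicator 1
  have hh : Measurable h := measurable_one.indicator measurableSet_Iio
  have hconst : (∫⁻ s in Ioi (0 : ℝ), ENNReal.ofReal (s ^ 2) * h s) ≠ 0 ∧
      (∫⁻ s in Ioi (0 : ℝ), ENNReal.ofReal (s ^ 2) * h s) ≠ ⊤ := by
    have : ∫⁻ s in Ioi (0 : ℝ), ENNReal.ofReal (s ^ 2) * h s =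
        ∫⁻ s in Ioo (0 : ℝ) 1, ENNReal.ofReal (s ^ 2) := by
      rw [← Ioi_inter_Iio, inter_comm, ← Measure.restrict_restrict measurableSet_Iio,
        ← lintegral_indicator measurableSet_Iio]
      refine lintegral_congr fun s => ?_
      by_cases hs : s ∈ Iio (1 : ℝ) <;> simp [h, hs]
    rw [this]
    constructor
    · rw [← pos_iff_ne_zero, setLIntegral_pos_iff (by fun_prop)]
      have : (Function.support fun s : ℝ => ENNReal.ofReal (s ^ 2)) ∩ Ioo 0 1 = Ioo 0 1 := by
        refine inter_eq_right.2 fun s hs => ?_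
        simp [hs.1.ne']
      rw [this]; simp
    · refine ne_top_of_le_ne_top (b := ∫⁻ s in Ioo (0 : ℝ) 1, 1) (by simp) ?_
      refine setLIntegral_mono (by fun_prop) fun s hs => ?_
      rw [← ENNReal.ofReal_one]
      exact ENNReal.ofReal_le_ofReal (pow_le_one₀ hs.1.le hs.2.le)
  have key1 : ∫⁻ u : Vel, φ (inner ℝ e u / ‖u‖) * h ‖u‖ =
      (∫⁻ s in Ioi (0 : ℝ), ENNReal.ofReal (s ^ 2) * h s) *
        ∫⁻ σ, φ (inner ℝ e (σ : Vel)) ∂sphereMeasure := by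
    rw [lintegral_Vel_polar _ (by fun_prop), mul_comm, ← lintegral_mul_const _ (by fun_prop)]
    refine lintegral_congr fun σ => ?_
    rw [← lintegral_const_mul _ (by fun_prop)]
    refine setLIntegral_congr_fun measurableSet_Ioi fun ρ hρ => ?_
    have hρ' : 0 < ρ := hρ
    have hσ : ‖(σ : Vel)‖ = 1 := by simp
    simp only [norm_smul, hσ, mul_one, Real.norm_of_nonneg hρ'.le, inner_smul_right,
      mul_div_cancel_left₀ _ hρ'.ne']
    ring
  obtain ⟨T, hT⟩ : ∃ T : Vel ≃ₗᵢ[ℝ] Vel, T (EuclideanSpace.single 0 1) = e := by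
    obtain ⟨b, hb⟩ := Orthonormal.exists_orthonormalBasis_extension_of_card_eq
      (𝕜 := ℝ) (E := Vel) (ι := Fin 3) (by simp) (v := fun _ => e) (s := {0}) (by
        exact ⟨fun _ => he, fun i j hij => (hij (Subsingleton.elim i j)).elim⟩)
    refine ⟨b.repr.symm, ?_⟩
    rw [OrthonormalBasis.repr_symm_single]
    exact hb 0 rfl
  have key2 : ∫⁻ u : Vel, φ (inner ℝ e u / ‖u‖) * h ‖u‖ =
      (∫⁻ s in Ioi (0 : ℝ), ENNReal.ofReal (s ^ 2) * h s) *
       (ENNReal.ofReal (2 * Real.pi) * ∫⁻ s in Icc (-1 : ℝ) 1, φ s) := by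
    rw [← T.measurePreserving.lintegral_comp (by fun_prop)]
    have : ∀ u : Vel, φ (inner ℝ e (T u) / ‖T u‖) * h ‖T u‖ = φ (u 0 / ‖u‖) * h ‖u‖ := by
      intro u
      rw [← hT, LinearIsometryEquiv.inner_map_map, LinearIsometryEquiv.norm_map]
      simp [EuclideanSpace.inner_single_left]
    simp_rw [this]
    rw [lintegral_Vel_eq_coords _ (by fun_prop)]
    have hn : ∀ a : ℝ, ∀ z : ℝ × ℝ, ‖(!₂[a, z.1, z.2] : Vel)‖ =
        √(a ^ 2 + √(z.1 ^ 2 + z.2 ^ 2) ^ 2) := by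
      intro a z
      rw [EuclideanSpace.norm_eq, Real.sq_sqrt (by positivity)]
      simp [Fin.sum_univ_three, add_assoc]
    simp_rw [hn]
    have : ∀ a : ℝ, ∫⁻ z : ℝ × ℝ, φ (a / √(a ^ 2 + √(z.1 ^ 2 + z.2 ^ 2) ^ 2)) *
        h (√(a ^ 2 + √(z.1 ^ 2 + z.2 ^ 2) ^ 2)) = ENNReal.ofReal (2 * Real.pi) *
        ∫⁻ ρ in Ioi (0 : ℝ), ENNReal.ofReal ρ *
          (φ (a / √(a ^ 2 + ρ ^ 2)) * h (√(a ^ 2 + ρ ^ 2))) := fun a =>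
      lintegral_radial_plane (fun ρ => φ (a / √(a ^ 2 + ρ ^ 2)) * h (√(a ^ 2 + ρ ^ 2)))
        (by fun_prop)
    refine (lintegral_congr this).trans ?_
    rw [lintegral_const_mul _ (by
      apply Measurable.lintegral_prod_right'
        (f := fun z : ℝ × ℝ => ENNReal.ofReal z.2 *
          (φ (z.1 / √(z.1 ^ 2 + z.2 ^ 2)) * h (√(z.1 ^ 2 + z.2 ^ 2))))
      fun_prop), lintegral_halfPlane φ h hφ hh]
    ring
  rw [key1] at key2
  exact (ENNReal.mul_right_inj hconst.1 hconst.2).1 key2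

/-! ### Energy fractions and angular averages -/

lemma stateMeasure_eq : stateMeasure =
    (volume : Measure Vel).prod (volume.restrict (Ioi (0 : ℝ))) := by
  rw [stateMeasure, Measure.restrict_congr_set Ioi_ae_eq_Ici]

lemma exchangeMeasure_eq : exchangeMeasure =
    (volume.restrict (Ioo (0 : ℝ) 1)).prod (volume.restrict (Ioo (0 : ℝ) 1)) := by
  rw [exchangeMeasure, Measure.restrict_congr_set Ioo_ae_eq_Icc]

instance : SFinite stateMeasure := by unfold stateMeasure; infer_instance

instance : IsFiniteMeasure exchangeMeasure := by unfold exchangeMeasure; infer_instance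

instance : IsFiniteMeasure collisionMeasure := by unfold collisionMeasure; infer_instance

/-- Two energies in terms of their sum `s` and the fraction `r` that goes to the first. -/
lemma lintegral_Ioi_Ioi_eq (h : ℝ → ℝ → ℝ≥0∞) (hh : Measurable fun z : ℝ × ℝ => h z.1 z.2) :
    ∫⁻ a in Ioi (0 : ℝ), ∫⁻ b in Ioi (0 : ℝ), h a b =
      ∫⁻ s in Ioi (0 : ℝ), ENNReal.ofReal s * ∫⁻ r in Ioo (0 : ℝ) 1, h (r * s) ((1 - r) * s) := by
  let k : ℝ → ℝ → ℝ≥0∞ := fun a b => ({z : ℝ × ℝ | 0 < z.1 ∧ 0 < z.2}.indicator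
    (fun z => h z.1 z.2)) (a, b)
  have hset : MeasurableSet {z : ℝ × ℝ | 0 < z.1 ∧ 0 < z.2} :=
    (measurableSet_lt measurable_const measurable_fst).inter
      (measurableSet_lt measurable_const measurable_snd)
  have hk : Measurable fun z : ℝ × ℝ => k z.1 z.2 := hh.indicator hset
  have hkt : Measurable (Function.uncurry fun a s : ℝ => k a (s - a)) :=
    hk.comp (g := fun z : ℝ × ℝ => k z.1 z.2) (f := fun z : ℝ × ℝ => (z.1, z.2 - z.1)) (by fun_prop)
  calc ∫⁻ a in Ioi (0 : ℝ), ∫⁻ b in Ioi (0 : ℝ), h a b = ∫⁻ a, ∫⁻ b, k a b := by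
        rw [← lintegral_indicator measurableSet_Ioi]
        refine lintegral_congr fun a => ?_
        by_cases ha : 0 < a
        · rw [indicator_of_mem (by exact ha), ← lintegral_indicator measurableSet_Ioi]
          refine lintegral_congr fun b => ?_
          by_cases hb : 0 < b <;> simp [k, ha, hb]
        · rw [indicator_of_notMem (by exact ha)]
          simp [k, ha]
    _ = ∫⁻ a, ∫⁻ s, k a (s - a) := by
        refine lintegral_congr fun a => ?_
        rw [lintegral_sub_right_eq_self (fun b => k a b)]
    _ = ∫⁻ s, ∫⁻ a, k a (s - a) := lintegral_lintegral_swap hkt.aemeasurable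
    _ = _ := by
        rw [← lintegral_indicator measurableSet_Ioi]
        refine lintegral_congr fun s => ?_
        by_cases hs : 0 < s
        · rw [indicator_of_mem (by exact hs)]
          have h1 : ∫⁻ a, k a (s - a) = ∫⁻ a in Ioo 0 s, h a (s - a) := by
            rw [← lintegral_indicator measurableSet_Ioo]
            refine lintegral_congr fun a => ?_
            by_cases ha : a ∈ Ioo 0 s
            · have : 0 < a ∧ 0 < s - a := ⟨ha.1, sub_pos.2 ha.2⟩
              rw [indicator_of_mem ha]
              simp only [k]
              rw [indicator_of_mem (by exact this)]
            · have : ¬ (0 < a ∧ 0 < s - a) := fun h => ha ⟨h.1, sub_pos.1 h.2⟩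
              rw [indicator_of_notMem ha]
              simp only [k]
              rw [indicator_of_notMem (by exact this)]
          have himg : (fun r => r * s) '' Ioo 0 1 = Ioo 0 s := by
            rw [image_mul_right_Ioo 0 1 hs]; simp
          rw [h1, ← himg, lintegral_image_eq_lintegral_abs_deriv_mul measurableSet_Ioo
            (f' := fun _ => s) (fun r _ => by
              simpa using ((hasDerivAt_id r).mul_const s).hasDerivWithinAt)
            (fun r _ r' _ hrr => by simpa [hs.ne'] using hrr), abs_of_pos hs]
          rw [lintegral_const_mul' _ _ ENNReal.ofReal_ne_top]
          congr 1
          refine lintegral_congr fun r => ?_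
          congr 1; ring
        · rw [indicator_of_notMem (by exact hs), lintegral_eq_zero_iff' (by
            exact (hkt.comp measurable_prodMk_right).aemeasurable)]
          refine Filter.Eventually.of_forall fun a => ?_
          simp only [k, Pi.zero_apply]
          rw [indicator_of_notMem]
          rintro ⟨h1, h2⟩
          simp only at h1 h2
          linarith

/-- The one-dimensional estimate behind `lintegral_sphere_unitDir_sub_le`: if `t = ẑ · σ` and
`κ = c / |z|`, the cosine between `z - cσ` and `σ` is `(t - κ) / √(1 - 2κt + κ²)`, and this function
of `t` has slope at least `1` where it is positive. -/
lemma lintegral_cosine_le {κ : ℝ} (hκ : 0 ≤ κ) (β : ℝ → ℝ≥0∞)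
    (hβ0 : ∀ s ≤ 0, β s = 0) :
    ∫⁻ t in Icc (-1 : ℝ) 1, β ((t - κ) / √(1 - 2 * κ * t + κ ^ 2)) ≤
      ∫⁻ s in Icc (-1 : ℝ) 1, β s := by
  -- `ψ > 0` only for `t > κ`; there `1 - 2κt + κ² ≤ min 1 (1 - κt)`, which gives `ψ' ≥ 1`.
  set ψ : ℝ → ℝ := fun t => (t - κ) / √(1 - 2 * κ * t + κ ^ 2) with hψ
  have hD : ∀ t ∈ Ioo κ 1, 0 < 1 - 2 * κ * t + κ ^ 2 := by
    rintro t ⟨h1, h2⟩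
    nlinarith [mul_nonneg hκ (sub_nonneg.2 h2.le), sq_nonneg (1 - κ), mul_pos (sub_pos.2 (h1.trans h2)) (sub_pos.2 (h1.trans h2))]
  have hderiv : ∀ t ∈ Ioo κ 1, HasDerivAt ψ
      ((1 - κ * t) / ((1 - 2 * κ * t + κ ^ 2) * √(1 - 2 * κ * t + κ ^ 2))) t := by
    intro t ht
    have hd := hD t ht
    have h1 : HasDerivAt (fun t : ℝ => 1 - 2 * κ * t + κ ^ 2) (-(2 * κ)) t := by
      simpa using (((hasDerivAt_id t).const_mul (2 * κ)).const_sub 1).add_const (κ ^ 2)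
    have h2 := ((hasDerivAt_id t).sub_const κ).div (h1.sqrt hd.ne') (Real.sqrt_pos.2 hd).ne'
    refine h2.congr_deriv ?_
    have hs := Real.sq_sqrt hd.le
    have hs0 := Real.sqrt_pos.2 hd
    set q := √(1 - 2 * κ * t + κ ^ 2) with hq
    rw [← hs]
    field_simp
    simp only [id]
    rw [hs]
    ring
  have hge : ∀ t ∈ Ioo κ 1,
      1 ≤ (1 - κ * t) / ((1 - 2 * κ * t + κ ^ 2) * √(1 - 2 * κ * t + κ ^ 2)) := by
    intro t ht
    have hd := hD t ht
    have hle : 1 - 2 * κ * t + κ ^ 2 ≤ 1 - κ * t := by nlinarith [mul_nonneg hκ (sub_nonneg.2 ht.1.le)]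
    have hle1 : √(1 - 2 * κ * t + κ ^ 2) ≤ 1 := by
      refine (Real.sqrt_le_left zero_le_one).2 ?_
      nlinarith [mul_nonneg hκ (sub_nonneg.2 ht.1.le)]
    rw [one_le_div (mul_pos hd (Real.sqrt_pos.2 hd))]
    exact (mul_le_of_le_one_right hd.le hle1).trans hle
  have hmono : StrictMonoOn ψ (Ioo κ 1) := by
    refine strictMonoOn_of_deriv_pos (convex_Ioo _ _)
      (fun t ht => (hderiv t ht).continuousAt.continuousWithinAt) fun t ht => ?_
    rw [interior_Ioo] at ht
    rw [(hderiv t ht).deriv]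
    exact one_pos.trans_le (hge t ht)
  have himg : ψ '' Ioo κ 1 ⊆ Icc (-1) 1 := by
    rintro _ ⟨t, ht, rfl⟩
    have hd := hD t ht
    have hpos := Real.sqrt_pos.2 hd
    have ht0 : 0 ≤ t - κ := sub_nonneg.2 ht.1.le
    refine ⟨by linarith [div_nonneg ht0 hpos.le], ?_⟩
    rw [hψ]
    simp only
    rw [div_le_one hpos]
    refine Real.le_sqrt_of_sq_le ?_
    nlinarith [ht.1, ht.2]
  calc ∫⁻ t in Icc (-1 : ℝ) 1, β (ψ t) = ∫⁻ t in Ioo (-1 : ℝ) 1, β (ψ t) := by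
        rw [Measure.restrict_congr_set Ioo_ae_eq_Icc]
    _ ≤ ∫⁻ t in Ioo κ 1, β (ψ t) := by
        rw [← lintegral_indicator measurableSet_Ioo, ← lintegral_indicator measurableSet_Ioo]
        refine lintegral_mono fun t => ?_
        by_cases ht : t ∈ Ioo κ 1
        · rw [indicator_of_mem ht]
          exact indicator_le_self _ _ _
        · by_cases ht' : t ∈ Ioo (-1 : ℝ) 1
          · rw [indicator_of_mem ht', hβ0]
            · exact zero_le
            · refine div_nonpos_of_nonpos_of_nonneg ?_ (Real.sqrt_nonneg _)
              by_contra h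
              exact ht ⟨by linarith, ht'.2⟩
          · rw [indicator_of_notMem ht']; exact zero_le
    _ ≤ ∫⁻ t in Ioo κ 1, ENNReal.ofReal
          |(1 - κ * t) / ((1 - 2 * κ * t + κ ^ 2) * √(1 - 2 * κ * t + κ ^ 2))| * β (ψ t) := by
        refine setLIntegral_mono' measurableSet_Ioo fun t ht => ?_
        have h1 := (hge t ht).trans (le_abs_self _)
        calc β (ψ t) = 1 * β (ψ t) := (one_mul _).symm
          _ ≤ _ := by
            gcongr
            rw [← ENNReal.ofReal_one]
            exact ENNReal.ofReal_le_ofReal h1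
    _ = ∫⁻ s in ψ '' Ioo κ 1, β s :=
        (lintegral_image_eq_lintegral_abs_deriv_mul measurableSet_Ioo
          (fun t ht => (hderiv t ht).hasDerivWithinAt) hmono.injOn β).symm
    _ ≤ _ := lintegral_mono_set himg

/-- For an angular weight `β` that charges acute angles only, averaging `β` over `σ` along the
directions `z - cσ` costs no more than averaging it over the sphere. -/
lemma lintegral_sphere_unitDir_sub_le (β : ℝ → ℝ≥0∞) (hβ : Measurable β)
    (hβ0 : ∀ s ≤ 0, β s = 0) {z : Vel} (hz : z ≠ 0) {c : ℝ} (hc : 0 ≤ c) :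
    ∫⁻ σ : Metric.sphere (0 : Vel) 1, β (inner ℝ (unitDir (z - c • (σ : Vel))) (σ : Vel))
      ∂sphereMeasure ≤ ENNReal.ofReal (2 * Real.pi) * ∫⁻ s in Icc (-1 : ℝ) 1, β s := by
  have hz' : 0 < ‖z‖ := norm_pos_iff.2 hz
  have key : ∀ σ : Metric.sphere (0 : Vel) 1,
      inner ℝ (unitDir (z - c • (σ : Vel))) (σ : Vel) =
        (inner ℝ (unitDir z) (σ : Vel) - c / ‖z‖) /
          √(1 - 2 * (c / ‖z‖) * inner ℝ (unitDir z) (σ : Vel) + (c / ‖z‖) ^ 2) := by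
    intro σ
    have hσ : ‖(σ : Vel)‖ = 1 := by simp
    set t := inner ℝ (unitDir z) (σ : Vel) with ht
    have hzσ : inner ℝ z (σ : Vel) = ‖z‖ * t := by
      rw [ht, unitDir, real_inner_smul_left, ← mul_assoc, mul_inv_cancel₀ hz'.ne', one_mul]
    have hn : ‖z - c • (σ : Vel)‖ = ‖z‖ * √(1 - 2 * (c / ‖z‖) * t + (c / ‖z‖) ^ 2) := by
      rw [← Real.sqrt_sq (norm_nonneg (z - c • (σ : Vel)))]
      rw [← Real.sqrt_sq hz'.le, ← Real.sqrt_mul (sq_nonneg _), Real.sqrt_sq hz'.le]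
      congr 1
      rw [norm_sub_sq_real, real_inner_smul_right, hzσ, norm_smul, hσ, mul_one, Real.norm_eq_abs,
        sq_abs]
      field_simp
    rw [unitDir, real_inner_smul_left, inner_sub_left, hzσ, real_inner_smul_left,
      real_inner_self_eq_norm_sq, hσ, hn]
    rw [inv_mul_eq_div, mul_comm ‖z‖ (√_), ← div_div]
    rw [div_right_comm]
    congr 1
    field_simp
  simp_rw [key]
  rw [lintegral_sphere_inner (norm_unitDir hz)
    (fun t => β ((t - c / ‖z‖) / √(1 - 2 * (c / ‖z‖) * t + (c / ‖z‖) ^ 2))) (by fun_prop)]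
  exact mul_le_mul_right (lintegral_cosine_le (by positivity) β hβ0) _

lemma sphereMeasure_univ : sphereMeasure univ = ENNReal.ofReal (4 * Real.pi) := by
  have h := lintegral_sphere_inner (e := EuclideanSpace.single 0 1) (by simp) (fun _ => 1)
    measurable_const
  simp only [lintegral_const, one_mul, Measure.restrict_apply_univ, Real.volume_Icc] at h
  rw [h, ← ENNReal.ofReal_mul (by positivity)]
  congr 1; ring

/-- `N` bounds the mean over `σ` of the angular weight `β` along all the families of directions
`z - cσ` that arise from a collision when the post-collisional velocity is held fixed. -/
def AngBound (β : ℝ → ℝ≥0∞) (N : ℝ≥0∞) : Prop :=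
  ∀ z : Vel, z ≠ 0 → ∀ c : ℝ, 0 ≤ c → ∫⁻ σ : Metric.sphere (0 : Vel) 1,
    β (inner ℝ (unitDir (z - c • (σ : Vel))) (σ : Vel)) ∂sphereMeasure ≤ N

lemma AngBound.of_acute {β : ℝ → ℝ≥0∞} (hβ : Measurable β) (hβ0 : ∀ s ≤ 0, β s = 0) :
    AngBound β (ENNReal.ofReal (2 * Real.pi) * ∫⁻ s in Icc (-1 : ℝ) 1, β s) :=
  fun _ hz _ hc => lintegral_sphere_unitDir_sub_le β hβ hβ0 hz hc

lemma AngBound.of_le_const {β : ℝ → ℝ≥0∞} {C : ℝ≥0∞} (hβ : ∀ s, β s ≤ C) :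
    AngBound β (ENNReal.ofReal (4 * Real.pi) * C) := by
  intro z _ c _
  refine (lintegral_mono fun σ => hβ _).trans ?_
  rw [lintegral_const, sphereMeasure_univ, mul_comm]

lemma AngBound.mono {β : ℝ → ℝ≥0∞} {N N' : ℝ≥0∞} (h : AngBound β N) (hN : N ≤ N') :
    AngBound β N' := fun z hz c hc => (h z hz c hc).trans hN

lemma AngBound.unitDir_le {β : ℝ → ℝ≥0∞} {N : ℝ≥0∞} (h : AngBound β N) {u : Vel} (hu : u ≠ 0) :
    ∫⁻ σ : Metric.sphere (0 : Vel) 1, β (inner ℝ (unitDir u) (σ : Vel)) ∂sphereMeasure ≤ N := by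
  simpa using h u hu 0 le_rfl

lemma lintegral_comp_smul_Vel (H : Vel → ℝ≥0∞) (hH : Measurable H) {c : ℝ} (hc : 0 < c) :
    ∫⁻ v, H (c • v) = ENNReal.ofReal ((c ^ 3)⁻¹) * ∫⁻ v, H v := by
  have h := Measure.map_addHaar_smul (volume : Measure Vel) hc.ne'
  rw [← lintegral_map hH (by fun_prop), h, lintegral_smul_measure]
  simp only [finrank_euclideanSpace, Fintype.card_fin, smul_eq_mul]
  rw [abs_of_pos (by positivity)]

lemma lintegral_Ioi_comp_mul (H : ℝ → ℝ≥0∞) {c : ℝ} (hc : 0 < c) :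
    ∫⁻ t in Ioi (0 : ℝ), H (c * t) = ENNReal.ofReal c⁻¹ * ∫⁻ t in Ioi (0 : ℝ), H t := by
  have himg : (fun r => c * r) '' Ioi 0 = Ioi 0 := by
    rw [image_mul_left_Ioi hc]; simp
  conv_rhs => rw [← himg]
  rw [lintegral_image_eq_lintegral_abs_deriv_mul measurableSet_Ioi
    (f' := fun _ => c) (fun r _ => by
      simpa using ((hasDerivAt_id r).const_mul c).hasDerivWithinAt)
    (fun r _ r' _ hrr => by simpa [hc.ne'] using hrr), abs_of_pos hc,
    lintegral_const_mul' _ _ ENNReal.ofReal_ne_top, ← mul_assoc, ← ENNReal.ofReal_mul (by positivity),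
    inv_mul_cancel₀ hc.ne', ENNReal.ofReal_one, one_mul]

/-! ### Centre-of-mass coordinates for a pair of molecules -/

lemma lintegral_stateMeasure (F : MolState → ℝ≥0∞) (hF : Measurable F) :
    ∫⁻ x, F x ∂stateMeasure = ∫⁻ v : Vel, ∫⁻ I in Ioi (0 : ℝ), F (v, I) := by
  rw [stateMeasure_eq, lintegral_prod _ hF.aemeasurable]

lemma lintegral_collisionMeasure (F : Metric.sphere (0 : Vel) 1 × (ℝ × ℝ) → ℝ≥0∞)
    (hF : Measurable F) :
    ∫⁻ w, F w ∂collisionMeasure =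
      ∫⁻ σ, (∫⁻ r in Ioo (0 : ℝ) 1, ∫⁻ R in Ioo (0 : ℝ) 1, F (σ, r, R)) ∂sphereMeasure := by
  rw [collisionMeasure, lintegral_prod _ hF.aemeasurable, exchangeMeasure_eq]
  refine lintegral_congr fun σ => ?_
  exact lintegral_prod _ (hF.comp measurable_prodMk_left).aemeasurable

/-- Change of variables from the pre-collisional state of one molecule to its post-collisional
state `(v', I')`, the collision partner `(v₀, I₀)` and the parameters `r, R` being fixed: for each
`σ` the Jacobian is the constant `a³ r (1 - R)`, and the angular weight is then averaged over
`σ` with `(v', I')` held fixed. -/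
lemma lintegral_post_le {μ a t I₀ r R : ℝ} (hμ : 0 < μ) (ha : 0 < a) (ht : 0 ≤ t) (hI₀ : 0 ≤ I₀)
    (hr : 0 < r) (hR : R < 1) (v₀ : Vel) {β : ℝ → ℝ≥0∞} {N : ℝ≥0∞} (hβ : Measurable β)
    (hN : AngBound β N) (H : MolState → ℝ≥0∞) (hH : Measurable H) :
    ∫⁻ x : MolState, (∫⁻ σ : Metric.sphere (0 : Vel) 1,
        β (inner ℝ (unitDir (x.1 - v₀)) (σ : Vel)) *
        H (v₀ + (a • (x.1 - v₀) +
            (t * √(2 * R * (μ / 2 * ‖x.1 - v₀‖ ^ 2 + x.2 + I₀) / μ)) • (σ : Vel)),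
          r * (1 - R) * (μ / 2 * ‖x.1 - v₀‖ ^ 2 + x.2 + I₀)) ∂sphereMeasure) ∂stateMeasure ≤
      N * ENNReal.ofReal ((a ^ 3 * (r * (1 - R)))⁻¹) * ∫⁻ x, H x ∂stateMeasure := by
  have hrR : 0 < r * (1 - R) := mul_pos hr (sub_pos.2 hR)
  have hu := measurable_unitDir
  -- With `E` in place of the internal energy, the velocity integral at fixed `E` and `σ` is a
  -- dilation and a translation, and the energy integral a dilation.
  let Ψ : Metric.sphere (0 : Vel) 1 → Vel → ℝ → ℝ≥0∞ := fun σ w E =>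
    β (inner ℝ (unitDir w) (σ : Vel)) *
      H (v₀ + (a • w + (t * √(2 * R * E / μ)) • (σ : Vel)), r * (1 - R) * E)
  have hΨ : Measurable fun z : Metric.sphere (0 : Vel) 1 × Vel × ℝ => Ψ z.1 z.2.1 z.2.2 := by
    simp only [Ψ]; fun_prop
  let Φ : Vel → ℝ → ℝ≥0∞ := fun w E => ∫⁻ σ, Ψ σ w E ∂sphereMeasure
  have hΦ : Measurable fun z : Vel × ℝ => Φ z.1 z.2 :=
    Measurable.lintegral_prod_left' (f := fun z : Metric.sphere (0 : Vel) 1 × (Vel × ℝ) =>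
      Ψ z.1 z.2.1 z.2.2) hΨ
  have hinner : ∀ E : ℝ, ∫⁻ w, Φ w E ≤
      N * ENNReal.ofReal ((a ^ 3)⁻¹) * ∫⁻ z, H (z, r * (1 - R) * E) := by
    intro E
    set τ := t * √(2 * R * E / μ) with hτ
    have hτ0 : 0 ≤ τ := by positivity
    have e1 : ∫⁻ w, Φ w E = ∫⁻ σ, (∫⁻ w, Ψ σ w E) ∂sphereMeasure :=
      lintegral_lintegral_swap (by
        apply Measurable.aemeasurable
        exact hΨ.comp (f := fun z : Vel × Metric.sphere (0 : Vel) 1 => (z.2, z.1, E))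
          (by fun_prop))
    have e2 : ∀ σ : Metric.sphere (0 : Vel) 1, ∫⁻ w, Ψ σ w E = ENNReal.ofReal ((a ^ 3)⁻¹) *
        ∫⁻ z, β (inner ℝ (unitDir (z - τ • (σ : Vel))) (σ : Vel)) *
          H (v₀ + z, r * (1 - R) * E) := by
      intro σ
      rw [← lintegral_add_right_eq_self (fun z => β (inner ℝ (unitDir (z - τ • (σ : Vel))) (σ : Vel)) *
          H (v₀ + z, r * (1 - R) * E)) (τ • (σ : Vel))]
      simp only [add_sub_cancel_right]
      rw [← lintegral_comp_smul_Vel (fun z => β (inner ℝ (unitDir z) (σ : Vel)) *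
          H (v₀ + (z + τ • (σ : Vel)), r * (1 - R) * E)) (by fun_prop) ha]
      simp only [unitDir_smul ha]
      rfl
    rw [e1, lintegral_congr e2, lintegral_const_mul' _ _ ENNReal.ofReal_ne_top,
      lintegral_lintegral_swap (by
        apply Measurable.aemeasurable
        fun_prop), mul_comm N, mul_assoc (ENNReal.ofReal _)]
    refine mul_le_mul_right ?_ _
    calc ∫⁻ z, ∫⁻ σ : Metric.sphere (0 : Vel) 1,
          β (inner ℝ (unitDir (z - τ • (σ : Vel))) (σ : Vel)) *
          H (v₀ + z, r * (1 - R) * E) ∂sphereMeasure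
        ≤ ∫⁻ z, N * H (v₀ + z, r * (1 - R) * E) := by
          have hz0 : ∀ᵐ z : Vel, z ≠ 0 := by
            rw [ae_iff]; simp
          refine lintegral_mono_ae (hz0.mono fun z hz => ?_)
          rw [lintegral_mul_const _ (by fun_prop)]
          exact mul_le_mul_left (hN z hz τ hτ0) _
      _ = N * ∫⁻ z, H (z, r * (1 - R) * E) := by
          rw [lintegral_const_mul _ (by fun_prop),
            lintegral_add_left_eq_self (fun z => H (z, r * (1 - R) * E)) v₀]
  have hmeas : Measurable fun x : MolState =>
      Φ (x.1 - v₀) (μ / 2 * ‖x.1 - v₀‖ ^ 2 + x.2 + I₀) :=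
    hΦ.comp (f := fun x : MolState => (x.1 - v₀, μ / 2 * ‖x.1 - v₀‖ ^ 2 + x.2 + I₀)) (by fun_prop)
  calc _ = ∫⁻ x : MolState, Φ (x.1 - v₀) (μ / 2 * ‖x.1 - v₀‖ ^ 2 + x.2 + I₀) ∂stateMeasure := rfl
    _ = ∫⁻ v : Vel, ∫⁻ I in Ioi (0 : ℝ), Φ (v - v₀) (μ / 2 * ‖v - v₀‖ ^ 2 + I + I₀) :=
        lintegral_stateMeasure _ hmeas
    _ ≤ ∫⁻ v : Vel, ∫⁻ E in Ioi (0 : ℝ), Φ (v - v₀) E := by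
        refine lintegral_mono fun v => ?_
        have hc : 0 ≤ μ / 2 * ‖v - v₀‖ ^ 2 + I₀ := by positivity
        set c := μ / 2 * ‖v - v₀‖ ^ 2 + I₀ with hc'
        have h1 : ∀ I, μ / 2 * ‖v - v₀‖ ^ 2 + I + I₀ = I + c := fun I => by rw [hc']; ring
        simp only [h1]
        rw [← lintegral_indicator measurableSet_Ioi, ← lintegral_indicator measurableSet_Ioi,
          ← lintegral_add_right_eq_self ((Ioi (0 : ℝ)).indicator fun E => Φ (v - v₀) E) c]
        refine lintegral_mono fun I => ?_
        by_cases hI : 0 < I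
        · rw [indicator_of_mem (by exact hI), indicator_of_mem (by exact add_pos_of_pos_of_nonneg hI hc)]
        · rw [indicator_of_notMem (by exact hI)]; exact zero_le
    _ = ∫⁻ w : Vel, ∫⁻ E in Ioi (0 : ℝ), Φ w E :=
        lintegral_sub_right_eq_self (fun w => ∫⁻ E in Ioi (0 : ℝ), Φ w E) v₀
    _ = ∫⁻ E in Ioi (0 : ℝ), ∫⁻ w : Vel, Φ w E := lintegral_lintegral_swap hΦ.aemeasurable
    _ ≤ ∫⁻ E in Ioi (0 : ℝ), N * ENNReal.ofReal ((a ^ 3)⁻¹) * ∫⁻ z, H (z, r * (1 - R) * E) :=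
        lintegral_mono fun E => hinner E
    _ = N * ENNReal.ofReal ((a ^ 3)⁻¹) *
          ∫⁻ E in Ioi (0 : ℝ), ∫⁻ z, H (z, r * (1 - R) * E) := by
        rw [lintegral_const_mul]
        exact Measurable.lintegral_prod_left' (f := fun z : Vel × ℝ => H (z.1, r * (1 - R) * z.2))
          (by fun_prop)
    _ = N * ENNReal.ofReal ((a ^ 3)⁻¹) *
          (ENNReal.ofReal (r * (1 - R))⁻¹ * ∫⁻ x, H x ∂stateMeasure) := by
        rw [lintegral_Ioi_comp_mul (fun E => ∫⁻ z, H (z, E)) hrR, lintegral_stateMeasure _ hH,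
          lintegral_lintegral_swap (f := fun v E => H (v, E))]
        exact hH.aemeasurable
    _ = _ := by
        rw [mul_inv (a ^ 3), ENNReal.ofReal_mul (by positivity), mul_assoc, mul_assoc, mul_assoc]

namespace GasMixture

variable {P : ℕ} (M : GasMixture P)

/-- The pair of states with centre-of-mass velocity `V` and relative energy `E` in the
Borgnakke-Larsen parametrization. -/
noncomputable def cmState (i j : Fin P) (V : Vel) (E : ℝ) (σ : Vel) (r R : ℝ) : MolState × MolState :=
  ((V + (M.m j / (M.m i + M.m j) * √(2 * R * E / M.redMass i j)) • σ, r * (1 - R) * E),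
    (V - (M.m i / (M.m i + M.m j) * √(2 * R * E / M.redMass i j)) • σ, (1 - r) * (1 - R) * E))

lemma redMass_pos (i j : Fin P) : 0 < M.redMass i j :=
  div_pos (mul_pos (M.m_pos i) (M.m_pos j)) (add_pos (M.m_pos i) (M.m_pos j))

lemma cmState_energyCM (i j : Fin P) (x y : MolState) (σ : Vel) (r R : ℝ) :
    M.cmState i j (M.velCM i j x y) (M.energy i j x y) σ r R =
      (M.post i j x y σ r R, M.postStar i j x y σ r R) := rfl

lemma cmState_sub (i j : Fin P) (V : Vel) (E : ℝ) (σ : Vel) (r R : ℝ) :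
    (M.cmState i j V E σ r R).1.1 - (M.cmState i j V E σ r R).2.1 =
      √(2 * R * E / M.redMass i j) • σ := by
  have h := (add_pos (M.m_pos i) (M.m_pos j)).ne'
  simp only [cmState]
  rw [add_sub_sub_cancel, ← add_smul]
  congr 1
  field_simp
  ring

lemma velCM_cmState (i j : Fin P) (V : Vel) (E : ℝ) (σ : Vel) (r R : ℝ) :
    M.velCM i j (M.cmState i j V E σ r R).1 (M.cmState i j V E σ r R).2 = V := by
  have h := (add_pos (M.m_pos i) (M.m_pos j)).ne'
  simp only [velCM, cmState, smul_add, smul_sub, smul_smul]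
  set s := √(2 * R * E / M.redMass i j)
  have e1 : (M.m i + M.m j)⁻¹ * (M.m i * (M.m j / (M.m i + M.m j) * s)) =
    (M.m i + M.m j)⁻¹ * (M.m j * (M.m i / (M.m i + M.m j) * s)) := by ring
  rw [e1, add_add_sub_cancel, ← add_smul, ← mul_add, inv_mul_cancel₀ h, one_smul]

lemma energy_cmState (i j : Fin P) (V : Vel) {E : ℝ} (hE : 0 ≤ E) {σ : Vel} (hσ : ‖σ‖ = 1)
    (r : ℝ) {R : ℝ} (hR : 0 ≤ R) :
    M.energy i j (M.cmState i j V E σ r R).1 (M.cmState i j V E σ r R).2 = E := by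
  have h := M.redMass_pos i j
  rw [energy, cmState_sub, norm_smul, hσ, mul_one, Real.norm_eq_abs, sq_abs,
    Real.sq_sqrt (by positivity)]
  simp only [cmState]
  field_simp
  ring

/-- The Jacobian constant of the energy coordinates. -/
noncomputable def cmJac (i j : Fin P) (E : ℝ) : ℝ := 2 / M.redMass i j * √(2 / M.redMass i j) * E ^ 2 * √E / 2

/-- The kinetic part of the relative motion and the two internal energies in terms of the total
energy `E` and its fractions `r, R`. -/
lemma lintegral_energy_split (i j : Fin P) (G : ℝ → ℝ → ℝ → ℝ≥0∞)
    (hG : Measurable fun z : ℝ × ℝ × ℝ => G z.1 z.2.1 z.2.2) :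
    ∫⁻ ρ in Ioi (0 : ℝ), ENNReal.ofReal (ρ ^ 2) *
        ∫⁻ I in Ioi (0 : ℝ), ∫⁻ J in Ioi (0 : ℝ), G ρ I J =
      ∫⁻ E in Ioi (0 : ℝ), ENNReal.ofReal (M.cmJac i j E) *
        ∫⁻ r in Ioo (0 : ℝ) 1, ∫⁻ R in Ioo (0 : ℝ) 1, ENNReal.ofReal ((1 - R) * √R) *
          G (√(2 * R * E / M.redMass i j)) (r * (1 - R) * E) ((1 - r) * (1 - R) * E) := by
  have hμ := M.redMass_pos i j
  set μ := M.redMass i j with hμ'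
  set c : ℝ := 2 / μ * √(2 / μ) / 2 with hc
  have hc0 : 0 ≤ c := by positivity
  let L : ℝ → ℝ → ℝ≥0∞ := fun ρ S => ∫⁻ r in Ioo (0 : ℝ) 1, G ρ (r * S) ((1 - r) * S)
  have hL : Measurable fun z : ℝ × ℝ => L z.1 z.2 :=
    Measurable.lintegral_prod_left' (f := fun z : ℝ × (ℝ × ℝ) =>
      G z.2.1 (z.1 * z.2.2) ((1 - z.1) * z.2.2))
      (hG.comp (f := fun z : ℝ × (ℝ × ℝ) => (z.2.1, z.1 * z.2.2, (1 - z.1) * z.2.2)) (by fun_prop))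
  have himg : (fun A : ℝ => √(2 * A / μ)) '' Ioi 0 = Ioi 0 := by
    ext ρ
    constructor
    · rintro ⟨A, hA, rfl⟩
      exact Real.sqrt_pos.2 (div_pos (mul_pos two_pos hA) hμ)
    · intro hρ
      have hρ' : 0 < ρ := hρ
      refine ⟨μ * ρ ^ 2 / 2, by simp only [mem_Ioi]; positivity, ?_⟩
      simp only
      rw [show 2 * (μ * ρ ^ 2 / 2) / μ = ρ ^ 2 by field_simp, Real.sqrt_sq hρ'.le]
  calc ∫⁻ ρ in Ioi (0 : ℝ), ENNReal.ofReal (ρ ^ 2) *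
        ∫⁻ I in Ioi (0 : ℝ), ∫⁻ J in Ioi (0 : ℝ), G ρ I J
      = ∫⁻ ρ in Ioi (0 : ℝ), ENNReal.ofReal (ρ ^ 2) *
          ∫⁻ S in Ioi (0 : ℝ), ENNReal.ofReal S * L ρ S := by
        refine lintegral_congr fun ρ => ?_
        rw [lintegral_Ioi_Ioi_eq (fun I J => G ρ I J) (hG.comp measurable_prodMk_left)]
    _ = ∫⁻ A in Ioi (0 : ℝ), ∫⁻ S in Ioi (0 : ℝ),
          ENNReal.ofReal (c * √A * S) * L (√(2 * A / μ)) S := by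
        have hderiv : ∀ A ∈ Ioi (0 : ℝ), HasDerivWithinAt (fun A : ℝ => √(2 * A / μ))
            ((2 / μ) / (2 * √(2 * A / μ))) (Ioi 0) A := by
          intro A hA
          have hA' : 0 < A := hA
          have h1 : HasDerivAt (fun A : ℝ => 2 * A / μ) (2 / μ) A := by
            simpa using ((hasDerivAt_id A).const_mul 2).div_const μ
          exact (h1.sqrt (by positivity)).hasDerivWithinAt
        have hinj : InjOn (fun A : ℝ => √(2 * A / μ)) (Ioi 0) := by
          intro A hA B hB hAB
          have hA' : 0 < A := hA
          have hB' : 0 < B := hB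
          have h1 := (Real.sqrt_inj (by positivity) (by positivity)).1 hAB
          field_simp at h1
          linarith
        have hcv := lintegral_image_eq_lintegral_abs_deriv_mul measurableSet_Ioi hderiv hinj
          (fun ρ => ENNReal.ofReal (ρ ^ 2) * ∫⁻ S in Ioi (0 : ℝ), ENNReal.ofReal S * L ρ S)
        rw [himg] at hcv
        rw [hcv]
        refine setLIntegral_congr_fun measurableSet_Ioi fun A hA => ?_
        have hA' : 0 < A := hA
        rw [← mul_assoc, ← ENNReal.ofReal_mul (abs_nonneg _),
          ← lintegral_const_mul' _ _ ENNReal.ofReal_ne_top]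
        refine setLIntegral_congr_fun (measurableSet_Ioi (a := (0 : ℝ))) fun S hS => ?_
        rw [← mul_assoc, ← ENNReal.ofReal_mul (by positivity)]
        congr 3
        rw [abs_of_nonneg (by positivity), Real.sq_sqrt (by positivity), hc,
          show 2 * A / μ = 2 / μ * A by ring, Real.sqrt_mul (by positivity)]
        have h1 := Real.sq_sqrt hA'.le
        have h2 := Real.sq_sqrt (show 0 ≤ 2 / μ by positivity)
        have h3 : 0 < √A := Real.sqrt_pos.2 hA'
        have h4 : 0 < √(2 / μ) := Real.sqrt_pos.2 (by positivity)
        rw [div_mul_eq_mul_div, div_eq_iff (by positivity)]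
        linear_combination (-(2 / μ) * √A ^ 2) * h2 - (2 / μ) ^ 2 * h1
    _ = ∫⁻ E in Ioi (0 : ℝ), ENNReal.ofReal E * ∫⁻ R in Ioo (0 : ℝ) 1,
          ENNReal.ofReal (c * √(R * E) * ((1 - R) * E)) *
            L (√(2 * (R * E) / μ)) ((1 - R) * E) := by
        rw [lintegral_Ioi_Ioi_eq (fun A S => ENNReal.ofReal (c * √A * S) * L (√(2 * A / μ)) S)]
        refine Measurable.mul (by fun_prop) ?_
        exact hL.comp (f := fun z : ℝ × ℝ => (√(2 * z.1 / μ), z.2)) (by fun_prop)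
    _ = ∫⁻ E in Ioi (0 : ℝ), ENNReal.ofReal (M.cmJac i j E) *
        ∫⁻ R in Ioo (0 : ℝ) 1, ∫⁻ r in Ioo (0 : ℝ) 1, ENNReal.ofReal ((1 - R) * √R) *
          G (√(2 * R * E / μ)) (r * (1 - R) * E) ((1 - r) * (1 - R) * E) := by
        refine setLIntegral_congr_fun measurableSet_Ioi fun E hE => ?_
        have hE' : 0 < E := hE
        rw [← lintegral_const_mul' _ _ ENNReal.ofReal_ne_top,
          ← lintegral_const_mul' _ _ ENNReal.ofReal_ne_top]
        refine setLIntegral_congr_fun measurableSet_Ioo fun R hR => ?_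
        have hR1 : 0 < 1 - R := sub_pos.2 hR.2
        have hR0 : 0 < R := hR.1
        rw [lintegral_const_mul' _ _ ENNReal.ofReal_ne_top, ← mul_assoc,
          ← ENNReal.ofReal_mul hE'.le, ← mul_assoc (ENNReal.ofReal (M.cmJac i j E)),
          ← ENNReal.ofReal_mul (by rw [cmJac]; positivity)]
        congr 2
        · rw [Real.sqrt_mul hR0.le, cmJac, hc]; ring
        · simp only [mul_assoc, L]
    _ = _ := by
        refine lintegral_congr fun E => ?_
        rw [lintegral_lintegral_swap]
        apply Measurable.aemeasurable
        refine Measurable.mul (by fun_prop) ?_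
        exact hG.comp (f := fun z : ℝ × ℝ => (√(2 * z.1 * E / μ), z.2 * (1 - z.1) * E,
          (1 - z.2) * (1 - z.1) * E)) (by fun_prop)

/-- Pairs of states in terms of the centre-of-mass velocity, the relative energy and the
Borgnakke-Larsen parameters. -/
lemma lintegral_pair_eq (i j : Fin P) (F : MolState → MolState → ℝ≥0∞)
    (hF : Measurable fun z : MolState × MolState => F z.1 z.2) :
    ∫⁻ x, ∫⁻ y, F x y ∂stateMeasure ∂stateMeasure =
      ∫⁻ V : Vel, ∫⁻ E in Ioi (0 : ℝ), ENNReal.ofReal (M.cmJac i j E) *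
        ∫⁻ w, ENNReal.ofReal ((1 - w.2.2) * √w.2.2) *
          F (M.cmState i j V E w.1 w.2.1 w.2.2).1 (M.cmState i j V E w.1 w.2.1 w.2.2).2
          ∂collisionMeasure := by
  have hM := (add_pos (M.m_pos i) (M.m_pos j)).ne'
  set a := M.m i / (M.m i + M.m j) with ha
  set b := M.m j / (M.m i + M.m j) with hb
  have hab : a + b = 1 := by rw [ha, hb]; field_simp
  let K : Vel → Vel → ℝ≥0∞ := fun v v' =>
    ∫⁻ I in Ioi (0 : ℝ), ∫⁻ J in Ioi (0 : ℝ), F (v, I) (v', J)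
  have hK : Measurable fun z : Vel × Vel => K z.1 z.2 := by
    refine Measurable.lintegral_prod_right' (f := fun z : (Vel × Vel) × ℝ =>
      ∫⁻ J in Ioi (0 : ℝ), F (z.1.1, z.2) (z.1.2, J)) ?_
    refine Measurable.lintegral_prod_right' (f := fun z : ((Vel × Vel) × ℝ) × ℝ =>
      F (z.1.1.1, z.1.2) (z.1.1.2, z.2)) ?_
    exact hF.comp (f := fun z : ((Vel × Vel) × ℝ) × ℝ =>
      ((z.1.1.1, z.1.2), (z.1.1.2, z.2))) (by fun_prop)
  have hFw : Measurable fun z : (Vel × ℝ) × Metric.sphere (0 : Vel) 1 × (ℝ × ℝ) =>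
      ENNReal.ofReal ((1 - z.2.2.2) * √z.2.2.2) *
        F (M.cmState i j z.1.1 z.1.2 z.2.1 z.2.2.1 z.2.2.2).1
          (M.cmState i j z.1.1 z.1.2 z.2.1 z.2.2.1 z.2.2.2).2 := by
    refine Measurable.mul (by fun_prop) ?_
    exact hF.comp (f := fun z : (Vel × ℝ) × Metric.sphere (0 : Vel) 1 × (ℝ × ℝ) =>
      M.cmState i j z.1.1 z.1.2 z.2.1 z.2.2.1 z.2.2.2) (by unfold cmState; fun_prop)
  calc ∫⁻ x, ∫⁻ y, F x y ∂stateMeasure ∂stateMeasure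
      = ∫⁻ v : Vel, ∫⁻ I in Ioi (0 : ℝ), ∫⁻ v' : Vel, ∫⁻ J in Ioi (0 : ℝ), F (v, I) (v', J) := by
        rw [lintegral_stateMeasure _ (Measurable.lintegral_prod_right'
          (f := fun z : MolState × MolState => F z.1 z.2) hF)]
        refine lintegral_congr fun v => lintegral_congr fun I => ?_
        exact lintegral_stateMeasure (fun y => F (v, I) y) (hF.comp measurable_prodMk_left)
    _ = ∫⁻ v : Vel, ∫⁻ v' : Vel, K v v' := by
        refine lintegral_congr fun v => ?_
        rw [lintegral_lintegral_swap]
        apply Measurable.aemeasurable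
        refine Measurable.lintegral_prod_right' (f := fun z : (ℝ × Vel) × ℝ =>
          F (v, z.1.1) (z.1.2, z.2)) ?_
        exact hF.comp (f := fun z : (ℝ × Vel) × ℝ => ((v, z.1.1), (z.1.2, z.2))) (by fun_prop)
    _ = ∫⁻ v' : Vel, ∫⁻ u : Vel, K (u + v') v' := by
        rw [lintegral_lintegral_swap hK.aemeasurable]
        refine lintegral_congr fun v' => ?_
        exact (lintegral_add_right_eq_self (fun v => K v v') v').symm
    _ = ∫⁻ u : Vel, ∫⁻ v' : Vel, K (u + v') v' := by
        refine lintegral_lintegral_swap (Measurable.aemeasurable ?_)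
        exact hK.comp (f := fun z : Vel × Vel => (z.2 + z.1, z.1)) (by fun_prop)
    _ = ∫⁻ u : Vel, ∫⁻ V : Vel, K (V + b • u) (V - a • u) := by
        refine lintegral_congr fun u => ?_
        rw [← lintegral_sub_right_eq_self _ (a • u)]
        refine lintegral_congr fun V => ?_
        congr 1
        have : u = a • u + b • u := by rw [← add_smul, hab, one_smul]
        nth_rewrite 1 [this]
        abel
    _ = ∫⁻ V : Vel, ∫⁻ u : Vel, K (V + b • u) (V - a • u) := by
        refine lintegral_lintegral_swap (Measurable.aemeasurable ?_)
        exact hK.comp (f := fun z : Vel × Vel => (z.2 + b • z.1, z.2 - a • z.1)) (by fun_prop)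
    _ = _ := by
        refine lintegral_congr fun V => ?_
        rw [lintegral_Vel_polar (fun u => K (V + b • u) (V - a • u)) (hK.comp (f := fun u : Vel => (V + b • u, V - a • u))
          (by fun_prop))]
        have h1 : ∀ σ : Metric.sphere (0 : Vel) 1, ∫⁻ ρ in Ioi (0 : ℝ), ENNReal.ofReal (ρ ^ 2) *
            K (V + b • ρ • (σ : Vel)) (V - a • ρ • (σ : Vel)) =
            ∫⁻ E in Ioi (0 : ℝ), ENNReal.ofReal (M.cmJac i j E) *
              ∫⁻ r in Ioo (0 : ℝ) 1, ∫⁻ R in Ioo (0 : ℝ) 1, ENNReal.ofReal ((1 - R) * √R) *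
                F (M.cmState i j V E σ r R).1 (M.cmState i j V E σ r R).2 := by
          intro σ
          have := M.lintegral_energy_split i j (fun ρ I J =>
            F (V + b • ρ • (σ : Vel), I) (V - a • ρ • (σ : Vel), J)) (hF.comp
              (f := fun z : ℝ × ℝ × ℝ => ((V + b • z.1 • (σ : Vel), z.2.1),
                (V - a • z.1 • (σ : Vel), z.2.2))) (by fun_prop))
          simp only [smul_smul] at this ⊢
          exact this
        rw [lintegral_congr h1, lintegral_lintegral_swap]
        · refine lintegral_congr fun E => ?_
          rw [lintegral_const_mul' _ _ ENNReal.ofReal_ne_top, lintegral_collisionMeasure]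
          exact hFw.comp (f := fun z : Metric.sphere (0 : Vel) 1 × (ℝ × ℝ) => ((V, E), z))
            (by fun_prop)
        · apply Measurable.aemeasurable
          refine Measurable.mul (by unfold cmJac; fun_prop) ?_
          refine Measurable.lintegral_prod_right' (f := fun z :
            (Metric.sphere (0 : Vel) 1 × ℝ) × ℝ => ∫⁻ R in Ioo (0 : ℝ) 1,
              ENNReal.ofReal ((1 - R) * √R) * F (M.cmState i j V z.1.2 z.1.1 z.2 R).1
                (M.cmState i j V z.1.2 z.1.1 z.2 R).2) ?_
          refine Measurable.lintegral_prod_right' (f := fun z :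
            ((Metric.sphere (0 : Vel) 1 × ℝ) × ℝ) × ℝ =>
              ENNReal.ofReal ((1 - z.2) * √z.2) * F (M.cmState i j V z.1.1.2 z.1.1.1 z.1.2 z.2).1
                (M.cmState i j V z.1.1.2 z.1.1.1 z.1.2 z.2).2) ?_
          exact hFw.comp (f := fun z : ((Metric.sphere (0 : Vel) 1 × ℝ) × ℝ) × ℝ =>
            ((V, z.1.1.2), (z.1.1.1, z.1.2, z.2))) (by fun_prop)

end GasMixture

/-! ### Pre-post transformation and the weak form of the gain operator -/

namespace GasMixture

variable {P : ℕ} (M : GasMixture P)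

lemma measurable_dWeight (i j : Fin P) : Measurable fun z : ℝ × ℝ => M.dWeight i j z.1 z.2 := by
  unfold dWeight; fun_prop

lemma dWeight_nonneg (i j : Fin P) {r R : ℝ} (hr : r ∈ Icc (0 : ℝ) 1) (hR : R ∈ Icc (0 : ℝ) 1) :
    0 ≤ M.dWeight i j r R := by
  have h1 := sub_nonneg.2 hr.2
  have h2 := sub_nonneg.2 hR.2
  have h3 := hr.1
  unfold dWeight
  positivity

lemma measurable_energy (i j : Fin P) :
    Measurable fun z : MolState × MolState => M.energy i j z.1 z.2 := by
  unfold energy; fun_prop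

lemma measurable_velCM (i j : Fin P) :
    Measurable fun z : MolState × MolState => M.velCM i j z.1 z.2 := by
  unfold velCM; fun_prop

lemma measurable_post (i j : Fin P) :
    Measurable fun z : MolState × MolState × Vel × ℝ × ℝ =>
      M.post i j z.1 z.2.1 z.2.2.1 z.2.2.2.1 z.2.2.2.2 := by
  have h1 := (M.measurable_energy i j).comp
    (f := fun z : MolState × MolState × Vel × ℝ × ℝ => (z.1, z.2.1)) (by fun_prop)
  have h2 := (M.measurable_velCM i j).comp
    (f := fun z : MolState × MolState × Vel × ℝ × ℝ => (z.1, z.2.1)) (by fun_prop)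
  simp only [Function.comp_def] at h1 h2
  unfold post
  fun_prop

lemma measurable_postStar (i j : Fin P) :
    Measurable fun z : MolState × MolState × Vel × ℝ × ℝ =>
      M.postStar i j z.1 z.2.1 z.2.2.1 z.2.2.2.1 z.2.2.2.2 := by
  have h1 := (M.measurable_energy i j).comp
    (f := fun z : MolState × MolState × Vel × ℝ × ℝ => (z.1, z.2.1)) (by fun_prop)
  have h2 := (M.measurable_velCM i j).comp
    (f := fun z : MolState × MolState × Vel × ℝ × ℝ => (z.1, z.2.1)) (by fun_prop)
  simp only [Function.comp_def] at h1 h2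
  unfold postStar
  fun_prop

lemma unitDir_cmState (i j : Fin P) (V : Vel) {E : ℝ} (hE : 0 < E) {σ : Vel} (hσ : ‖σ‖ = 1) {r R : ℝ}
    (hR : R ∈ Ioo (0 : ℝ) 1) :
    unitDir ((M.cmState i j V E σ r R).1.1 - (M.cmState i j V E σ r R).2.1) =
    σ := by
  have h := M.redMass_pos i j
  have hR0 := hR.1
  rw [cmState_sub, unitDir_smul (by positivity), unitDir, hσ, inv_one, one_smul]

lemma rPrime_cmState (i j : Fin P) (V : Vel) {E : ℝ} (hE : 0 < E) {σ : Vel} {r R : ℝ}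
    (hR : R ∈ Ioo (0 : ℝ) 1) :
    rPrime (M.cmState i j V E σ r R).1 (M.cmState i j V E σ r R).2 = r := by
  have hR1 : 1 - R ≠ 0 := (sub_pos.2 hR.2).ne'
  simp only [rPrime, cmState]
  have hE' := hE.ne'
  rw [show r * (1 - R) * E + (1 - r) * (1 - R) * E = (1 - R) * E by ring, mul_assoc,
    mul_div_cancel_right₀ _ (mul_ne_zero hR1 hE')]

lemma RPrime_cmState (i j : Fin P) (V : Vel) {E : ℝ} (hE : 0 < E) {σ : Vel} (hσ : ‖σ‖ = 1) {r R : ℝ}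
    (hR : R ∈ Ioo (0 : ℝ) 1) :
    M.RPrime i j (M.cmState i j V E σ r R).1 (M.cmState i j V E σ r R).2 = R := by
  have h := M.redMass_pos i j
  have hR0 := hR.1
  rw [RPrime, M.energy_cmState i j V hE.le hσ r hR0.le, cmState_sub, norm_smul, hσ, mul_one,
    Real.norm_eq_abs, sq_abs, Real.sq_sqrt (by positivity)]
  field_simp

lemma admissible_cmState (i j : Fin P) (V : Vel) {E : ℝ} (hE : 0 < E) {σ : Vel} (hσ : ‖σ‖ = 1) {r R : ℝ}
    (hr : r ∈ Ioo (0 : ℝ) 1) (hR : R ∈ Ioo (0 : ℝ) 1)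
    {σ' : Vel} (hσ' : ‖σ'‖ = 1) {r' R' : ℝ} (hr' : r' ∈ Ioo (0 : ℝ) 1)
    (hR' : R' ∈ Ioo (0 : ℝ) 1) :
    Admissible (M.cmState i j V E σ r R).1 (M.cmState i j V E σ r R).2 σ' r' R' := by
  have h := M.redMass_pos i j
  have hR0 := hR.1
  have hR1 : 0 < 1 - R := sub_pos.2 hR.2
  have hr0 := hr.1
  have hr1 : 0 < 1 - r := sub_pos.2 hr.2
  refine ⟨?_, by simp only [cmState]; positivity, by simp only [cmState]; positivity, hσ', hr', hR'⟩
  rw [← sub_ne_zero, cmState_sub]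
  have hσ0 : σ ≠ 0 := by rintro rfl; simp at hσ
  have : √(2 * R * E / M.redMass i j) ≠ 0 := (Real.sqrt_pos.2 (by positivity)).ne'
  exact smul_ne_zero this hσ0

lemma post_cmState (i j : Fin P) (V : Vel) {E : ℝ} (hE : 0 < E) {σ : Vel} (hσ : ‖σ‖ = 1) {r R : ℝ}
    (hR : R ∈ Ioo (0 : ℝ) 1)
    (σ' : Vel) (r' R' : ℝ) :
    (M.post i j (M.cmState i j V E σ r R).1 (M.cmState i j V E σ r R).2 σ' r' R',
      M.postStar i j (M.cmState i j V E σ r R).1 (M.cmState i j V E σ r R).2 σ' r' R') =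
      M.cmState i j V E σ' r' R' := by
  rw [← cmState_energyCM, velCM_cmState, M.energy_cmState i j V hE.le hσ r hR.1.le]

/-- The gain weight `(I/I')^α (I_*/I'_*)^α` compensates for the non-invariance of `d_ij dσ dr dR`
under the exchange of pre- and post-collisional parameters. -/
lemma dWeight_exchange (i j : Fin P) {r R r' R' E : ℝ} (hE : 0 < E)
    (hr : r ∈ Ioo (0 : ℝ) 1) (hR : R ∈ Ioo (0 : ℝ) 1)
    (hr' : r' ∈ Ioo (0 : ℝ) 1) (hR' : R' ∈ Ioo (0 : ℝ) 1) :
    ((1 - R') * √R') * ((r' * (1 - R') * E / (r * (1 - R) * E)) ^ M.α i *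
      ((1 - r') * (1 - R') * E / ((1 - r) * (1 - R) * E)) ^ M.α j * M.dWeight i j r R) =
    ((1 - R) * √R) * M.dWeight i j r' R' := by
  have h1 : 0 < 1 - R := sub_pos.2 hR.2
  have h2 : 0 < 1 - r := sub_pos.2 hr.2
  have h3 : 0 < 1 - R' := sub_pos.2 hR'.2
  have h4 : 0 < 1 - r' := sub_pos.2 hr'.2
  have h5 := hr.1
  have h6 := hr'.1
  have h7 := hR.1
  have h8 := hR'.1
  unfold dWeight
  rw [mul_div_mul_right _ _ hE.ne', mul_div_mul_right _ _ hE.ne', Real.div_rpow, Real.div_rpow,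
    Real.mul_rpow, Real.mul_rpow, Real.mul_rpow, Real.mul_rpow, Real.rpow_add h1,
    Real.rpow_add h1, Real.rpow_add h3, Real.rpow_add h3, Real.rpow_one, Real.rpow_one]
  · have p1 := (Real.rpow_pos_of_pos h1 (M.α i)).ne'
    have p2 := (Real.rpow_pos_of_pos h1 (M.α j)).ne'
    have p3 := (Real.rpow_pos_of_pos h5 (M.α i)).ne'
    have p4 := (Real.rpow_pos_of_pos h2 (M.α j)).ne'
    field_simp
  all_goals positivity

end GasMixture

/-- The collision parameters `(σ, r, R)`. -/
abbrev CollParam : Type := Metric.sphere (0 : Vel) 1 × (ℝ × ℝ)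

lemma ae_collisionMeasure : ∀ᵐ w ∂collisionMeasure,
    w.2.1 ∈ Ioo (0 : ℝ) 1 ∧ w.2.2 ∈ Ioo (0 : ℝ) 1 := by
  have h : ∀ᵐ z ∂exchangeMeasure, z.1 ∈ Ioo (0 : ℝ) 1 ∧ z.2 ∈ Ioo (0 : ℝ) 1 := by
    rw [exchangeMeasure_eq, Measure.prod_restrict]
    exact ae_restrict_mem (measurableSet_Ioo.prod measurableSet_Ioo)
  exact Measure.quasiMeasurePreserving_snd.ae h

lemma norm_sphere_coe (σ : Metric.sphere (0 : Vel) 1) : ‖(σ : Vel)‖ = 1 := by simp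

namespace CollisionKernel

variable {P : ℕ} {M : GasMixture P} (Q : CollisionKernel M)

lemma measurable_collision_flat : Measurable fun z : (MolState × MolState) × CollParam =>
    ((z.1.1, z.1.2, (z.2.1 : Vel), z.2.2.1, z.2.2.2) : MolState × MolState × Vel × ℝ × ℝ) := by
  fun_prop

lemma measurable_dWeight_collision (i j : Fin P) :
    Measurable fun z : (MolState × MolState) × CollParam => M.dWeight i j z.2.2.1 z.2.2.2 :=
  (M.measurable_dWeight i j).comp
    (f := fun z : (MolState × MolState) × CollParam => z.2.2) (by fun_prop)

lemma measurable_gain_integrand (i j : Fin P) {f g : MolState → ℝ} (hf : Measurable f)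
    (hg : Measurable g) : Measurable fun z : (MolState × MolState) × CollParam => ENNReal.ofReal
      (f (M.post i j z.1.1 z.1.2 z.2.1 z.2.2.1 z.2.2.2) *
        g (M.postStar i j z.1.1 z.1.2 z.2.1 z.2.2.1 z.2.2.2) *
        (z.1.1.2 / (M.post i j z.1.1 z.1.2 z.2.1 z.2.2.1 z.2.2.2).2) ^ M.α i *
        (z.1.2.2 / (M.postStar i j z.1.1 z.1.2 z.2.1 z.2.2.1 z.2.2.2).2) ^ M.α j *
        Q.B i j z.1.1 z.1.2 z.2.1 z.2.2.1 z.2.2.2 * M.dWeight i j z.2.2.1 z.2.2.2) := by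
  have hB' := (Q.measurable_B i j).comp measurable_collision_flat
  have hp' := (M.measurable_post i j).comp measurable_collision_flat
  have hq' := (M.measurable_postStar i j).comp measurable_collision_flat
  have hd' := measurable_dWeight_collision (M := M) i j
  simp only [Function.comp_def] at hB' hp' hq'
  exact (((((hf.comp hp').mul (hg.comp hq')).mul
    ((Measurable.div (by fun_prop) (measurable_snd.comp hp')).pow_const _)).mul
    ((Measurable.div (by fun_prop) (measurable_snd.comp hq')).pow_const _)).mul hB').mul hd'
      |>.ennreal_ofReal

lemma measurable_gain (i j : Fin P) {f g : MolState → ℝ} (hf : Measurable f)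
    (hg : Measurable g) : Measurable (Q.gain i j f g) :=
  (Q.measurable_gain_integrand i j hf hg).lintegral_prod_right'.lintegral_prod_right'

lemma measurable_freq (i j : Fin P) {g : MolState → ℝ} (hg : Measurable g) :
    Measurable (Q.freq i j g) := by
  have hB' := (Q.measurable_B i j).comp measurable_collision_flat
  have hd' := measurable_dWeight_collision (M := M) i j
  have h : Measurable fun z : (MolState × MolState) × CollParam => ENNReal.ofReal
      (g z.1.2 * Q.B i j z.1.1 z.1.2 z.2.1 z.2.2.1 z.2.2.2 * M.dWeight i j z.2.2.1 z.2.2.2) :=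
    (((hg.comp (by fun_prop)).mul hB').mul hd').ennreal_ofReal
  exact h.lintegral_prod_right'.lintegral_prod_right'

/-- The gain operator in weak form. In the coordinates of `lintegral_pair_eq` the pre-post
transformation exchanges the parameters `w'` of the incoming pair with the collision parameters `w`,
which amounts to Fubini's theorem. -/
lemma lintegral_gain_mul (i j : Fin P) {f g φ : MolState → ℝ} (hf : Measurable f)
    (hg : Measurable g) (hφ : Measurable φ) :
    ∫⁻ x, Q.gain i j f g x * ENNReal.ofReal (φ x) ∂stateMeasure =
      ∫⁻ x, ∫⁻ y, ∫⁻ w, ENNReal.ofReal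
          (f x * g y * Q.B i j x y w.1 w.2.1 w.2.2 * M.dWeight i j w.2.1 w.2.2) *
        ENNReal.ofReal (φ (M.post i j x y w.1 w.2.1 w.2.2))
        ∂collisionMeasure ∂stateMeasure ∂stateMeasure := by
  have hB' := (Q.measurable_B i j).comp measurable_collision_flat
  have hp' := (M.measurable_post i j).comp measurable_collision_flat
  have hd' := measurable_dWeight_collision (M := M) i j
  simp only [Function.comp_def] at hB' hp'
  let U : MolState → MolState → CollParam → ℝ≥0∞ := fun x y w => ENNReal.ofReal
      (f (M.post i j x y w.1 w.2.1 w.2.2) * g (M.postStar i j x y w.1 w.2.1 w.2.2) *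
        (x.2 / (M.post i j x y w.1 w.2.1 w.2.2).2) ^ M.α i *
        (y.2 / (M.postStar i j x y w.1 w.2.1 w.2.2).2) ^ M.α j *
        Q.B i j x y w.1 w.2.1 w.2.2 * M.dWeight i j w.2.1 w.2.2)
  have hU : Measurable fun z : (MolState × MolState) × CollParam => U z.1.1 z.1.2 z.2 :=
    Q.measurable_gain_integrand i j hf hg
  let U₁ : MolState → MolState → CollParam → ℝ≥0∞ := fun x y w => U x y w * ENNReal.ofReal (φ x)
  have hU₁ : Measurable fun z : (MolState × MolState) × CollParam => U₁ z.1.1 z.1.2 z.2 := by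
    exact hU.mul (hφ.comp (by fun_prop)).ennreal_ofReal
  let U₂ : MolState → MolState → CollParam → ℝ≥0∞ := fun x y w => ENNReal.ofReal
      (f x * g y * Q.B i j x y w.1 w.2.1 w.2.2 * M.dWeight i j w.2.1 w.2.2) *
        ENNReal.ofReal (φ (M.post i j x y w.1 w.2.1 w.2.2))
  have hU₂ : Measurable fun z : (MolState × MolState) × CollParam => U₂ z.1.1 z.1.2 z.2 := by
    exact ((((hf.comp (by fun_prop)).mul (hg.comp (by fun_prop))).mul hB').mul hd').ennreal_ofReal.mul
      (hφ.comp hp').ennreal_ofReal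
  have hleft : ∫⁻ x, Q.gain i j f g x * ENNReal.ofReal (φ x) ∂stateMeasure =
      ∫⁻ x, ∫⁻ y, ∫⁻ w, U₁ x y w ∂collisionMeasure ∂stateMeasure ∂stateMeasure := by
    refine lintegral_congr fun x => ?_
    rw [gain, ← lintegral_mul_const' _ _ ENNReal.ofReal_ne_top]
    refine lintegral_congr fun y => ?_
    rw [← lintegral_mul_const' _ _ ENNReal.ofReal_ne_top]
  rw [hleft]
  change _ = ∫⁻ x, ∫⁻ y, ∫⁻ w, U₂ x y w ∂collisionMeasure ∂stateMeasure ∂stateMeasure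
  rw [M.lintegral_pair_eq i j _ (hU₁.lintegral_prod_right'),
    M.lintegral_pair_eq i j _ (hU₂.lintegral_prod_right')]
  refine lintegral_congr fun V => setLIntegral_congr_fun measurableSet_Ioi fun E hE => ?_
  have hE' : 0 < E := hE
  have hcm : Measurable fun w : CollParam => M.cmState i j V E w.1 w.2.1 w.2.2 := by
    unfold GasMixture.cmState; fun_prop
  congr 1
  simp_rw [← lintegral_const_mul' _ _ ENNReal.ofReal_ne_top]
  rw [lintegral_lintegral_swap]
  · refine lintegral_congr_ae (ae_collisionMeasure.mono fun w hw => ?_)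
    refine lintegral_congr_ae (ae_collisionMeasure.mono fun w' hw' => ?_)
    have e1 := M.post_cmState i j V hE' (norm_sphere_coe w'.1) (r := w'.2.1) hw'.2 w.1 w.2.1 w.2.2
    have e2 := M.post_cmState i j V hE' (norm_sphere_coe w.1) (r := w.2.1) hw.2 w'.1 w'.2.1 w'.2.2
    have hmic := Q.micro_prePost i j _ _ _ _ _ (M.admissible_cmState i j V hE'
      (norm_sphere_coe w'.1) hw'.1 hw'.2 (norm_sphere_coe w.1) hw.1 hw.2)
    rw [M.unitDir_cmState i j V hE' (norm_sphere_coe w'.1) hw'.2,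
      M.rPrime_cmState i j V hE' hw'.2, M.RPrime_cmState i j V hE' (norm_sphere_coe w'.1) hw'.2]
      at hmic
    have hk' : 0 ≤ (1 - w'.2.2) * √w'.2.2 :=
      mul_nonneg (sub_nonneg.2 hw'.2.2.le) (Real.sqrt_nonneg _)
    have hk : 0 ≤ (1 - w.2.2) * √w.2.2 :=
      mul_nonneg (sub_nonneg.2 hw.2.2.le) (Real.sqrt_nonneg _)
    have e1a := congrArg Prod.fst e1
    have e1b := congrArg Prod.snd e1
    have e2a := congrArg Prod.fst e2
    simp only at e1a e1b e2a
    simp only [U₁, U₂, U]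
    rw [e1a, e1b] at hmic ⊢
    rw [e2a, ← hmic, ← mul_assoc, ← mul_assoc, ← ENNReal.ofReal_mul hk',
      ← ENNReal.ofReal_mul hk]
    congr 2
    have hx := M.dWeight_exchange i j hE' hw.1 hw.2 hw'.1 hw'.2
    generalize Q.B i j _ _ _ _ _ = b
    simp only [GasMixture.cmState] at hx ⊢
    linear_combination (f (V + (M.m j / (M.m i + M.m j) *
      √(2 * w.2.2 * E / M.redMass i j)) • (w.1 : Vel), w.2.1 * (1 - w.2.2) * E) *
      g (V - (M.m i / (M.m i + M.m j) * √(2 * w.2.2 * E / M.redMass i j)) • (w.1 : Vel),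
      (1 - w.2.1) * (1 - w.2.2) * E) * b) * hx
  · apply Measurable.aemeasurable
    refine Measurable.mul (f := fun z : CollParam × CollParam =>
      ENNReal.ofReal ((1 - z.1.2.2) * √z.1.2.2)) (by fun_prop) ?_
    exact hU₁.comp (f := fun z : CollParam × CollParam => (M.cmState i j V E z.1.1 z.1.2.1 z.1.2.2, z.2))
      (Measurable.prodMk (hcm.comp measurable_fst) measurable_snd)

end CollisionKernel

/-! ### Energy inequalities -/

namespace GasMixture

variable {P : ℕ} (M : GasMixture P)

lemma totalMass_pos (i : Fin P) : 0 < M.totalMass :=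
  Finset.sum_pos (fun l _ => M.m_pos l) ⟨i, Finset.mem_univ i⟩

/-- Kinetic plus internal energy of a molecule of species `i`. -/
noncomputable def molEnergy (i : Fin P) (x : MolState) : ℝ := M.m i / 2 * ‖x.1‖ ^ 2 + x.2

lemma molEnergy_nonneg (i : Fin P) {x : MolState} (hx : 0 ≤ x.2) : 0 ≤ M.molEnergy i x := by
  have := M.m_pos i
  unfold molEnergy; positivity

lemma bracket_eq (i : Fin P) (x : MolState) :
    M.bracket i x = √(1 + M.molEnergy i x / M.totalMass) := by
  have := (M.totalMass_pos i).ne'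
  unfold bracket molEnergy
  congr 1
  field_simp
  ring

lemma sq_bracket (i : Fin P) {x : MolState} (hx : 0 ≤ x.2) :
    M.bracket i x ^ 2 = 1 + M.molEnergy i x / M.totalMass := by
  have := M.totalMass_pos i
  have := M.molEnergy_nonneg i hx
  rw [bracket_eq, Real.sq_sqrt (by positivity)]

lemma one_le_bracket (i : Fin P) {x : MolState} (hx : 0 ≤ x.2) : 1 ≤ M.bracket i x := by
  have := M.totalMass_pos i
  have := M.molEnergy_nonneg i hx
  rw [bracket_eq, Real.one_le_sqrt]
  have : 0 ≤ M.molEnergy i x / M.totalMass := by positivity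
  linarith

lemma bracket_nonneg (i : Fin P) (x : MolState) : 0 ≤ M.bracket i x := Real.sqrt_nonneg _

lemma measurable_bracket (i : Fin P) : Measurable (M.bracket i) := by
  unfold bracket; fun_prop

lemma redMass_comm (i j : Fin P) : M.redMass i j = M.redMass j i := by
  unfold redMass; rw [mul_comm, add_comm]

lemma redMass_le_left (i j : Fin P) : M.redMass i j ≤ M.m i := by
  have := M.m_pos i; have := M.m_pos j
  rw [redMass, div_le_iff₀ (by positivity)]
  nlinarith

lemma redMass_le_right (i j : Fin P) : M.redMass i j ≤ M.m j :=
  M.redMass_comm i j ▸ M.redMass_le_left j i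

lemma minRatio_pos (i j : Fin P) : 0 < M.minRatio i j := by
  have := M.m_pos i; have := M.m_pos j
  exact lt_min (by positivity) (by positivity)

lemma minRatio_le_half (i j : Fin P) : M.minRatio i j ≤ 1 / 2 := by
  have h1 := M.m_pos i; have h2 := M.m_pos j
  rcases le_total (M.m i) (M.m j) with h | h
  · refine (min_le_left _ _).trans ?_
    rw [div_le_div_iff₀ (by positivity) two_pos]; linarith
  · refine (min_le_right _ _).trans ?_
    rw [div_le_div_iff₀ (by positivity) two_pos]; linarith

/-- Total energy as the energy of the centre of mass plus the relative energy. -/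
lemma molEnergy_add (i j : Fin P) (x y : MolState) :
    M.molEnergy i x + M.molEnergy j y =
      (M.m i + M.m j) / 2 * ‖M.velCM i j x y‖ ^ 2 + M.energy i j x y := by
  have h1 := M.m_pos i; have h2 := M.m_pos j
  have h3 : 0 < M.m i + M.m j := by positivity
  unfold molEnergy energy velCM redMass
  rw [norm_smul, mul_pow, Real.norm_of_nonneg (by positivity), norm_add_sq_real, norm_sub_sq_real,
    norm_smul, norm_smul, Real.norm_of_nonneg h1.le, Real.norm_of_nonneg h2.le,
    real_inner_smul_left, real_inner_smul_right]
  field_simp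
  ring

lemma energy_le_molEnergy (i j : Fin P) (x y : MolState) :
    M.energy i j x y ≤ M.molEnergy i x + M.molEnergy j y := by
  have h1 := M.m_pos i; have h2 := M.m_pos j
  rw [molEnergy_add]
  have : 0 ≤ (M.m i + M.m j) / 2 * ‖M.velCM i j x y‖ ^ 2 := by positivity
  linarith

lemma energy_nonneg (i j : Fin P) {x y : MolState} (hx : 0 ≤ x.2) (hy : 0 ≤ y.2) :
    0 ≤ M.energy i j x y := by
  have := M.redMass_pos i j
  unfold energy; positivity

lemma energy_pos (i j : Fin P) {x y : MolState} (hx : 0 < x.2) (hy : 0 < y.2) :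
    0 < M.energy i j x y := by
  have := M.redMass_pos i j
  unfold energy; positivity

/-- Conservation of energy bounds the energy of one outgoing molecule. -/
lemma molEnergy_post_le (i j : Fin P) {x y : MolState} (hx : 0 ≤ x.2) (hy : 0 ≤ y.2) {σ : Vel}
    (hσ : ‖σ‖ = 1) {r R : ℝ} (hr : r ∈ Ioo (0 : ℝ) 1) (hR : R ∈ Ioo (0 : ℝ) 1) :
    M.molEnergy i (M.post i j x y σ r R) ≤ M.molEnergy i x + M.molEnergy j y := by
  have hE := M.energy_nonneg i j hx hy
  have h1 : M.velCM i j (M.post i j x y σ r R) (M.postStar i j x y σ r R) = M.velCM i j x y :=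
    M.velCM_cmState i j _ _ σ r R
  have h2 : M.energy i j (M.post i j x y σ r R) (M.postStar i j x y σ r R) = M.energy i j x y :=
    M.energy_cmState i j _ hE hσ r hR.1.le
  have h3 := M.molEnergy_add i j (M.post i j x y σ r R) (M.postStar i j x y σ r R)
  rw [h1, h2, ← molEnergy_add] at h3
  have h4 : 0 ≤ M.molEnergy j (M.postStar i j x y σ r R) := by
    refine M.molEnergy_nonneg j ?_
    exact mul_nonneg (mul_nonneg (sub_nonneg.2 hr.2.le) (sub_nonneg.2 hR.2.le)) hE
  linarith

lemma post_fst_sub_right (i j : Fin P) (x y : MolState) (σ : Vel) (r R : ℝ) :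
    (M.post i j x y σ r R).1 = y.1 + ((M.m i / (M.m i + M.m j)) • (x.1 - y.1) +
      (M.m j / (M.m i + M.m j) * √(2 * R * M.energy i j x y / M.redMass i j)) • σ) := by
  have h3 := (add_pos (M.m_pos i) (M.m_pos j)).ne'
  simp only [post, velCM]
  rw [← add_assoc]
  congr 1
  have : y.1 = (M.m i / (M.m i + M.m j)) • y.1 + (M.m j / (M.m i + M.m j)) • y.1 := by
    rw [← add_smul, ← add_div, div_self h3, one_smul]
  nth_rewrite 2 [this]
  rw [smul_sub, smul_add, smul_smul, smul_smul, inv_mul_eq_div, inv_mul_eq_div]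
  abel

lemma post_fst_sub_left (i j : Fin P) (x y : MolState) (σ : Vel) (r R : ℝ) :
    (M.post i j x y σ r R).1 = x.1 + ((M.m j / (M.m i + M.m j)) • (y.1 - x.1) +
      (M.m j / (M.m i + M.m j) * √(2 * R * M.energy i j x y / M.redMass i j)) • σ) := by
  have h3 := (add_pos (M.m_pos i) (M.m_pos j)).ne'
  simp only [post, velCM]
  rw [← add_assoc]
  congr 1
  have : x.1 = (M.m i / (M.m i + M.m j)) • x.1 + (M.m j / (M.m i + M.m j)) • x.1 := by
    rw [← add_smul, ← add_div, div_self h3, one_smul]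
  nth_rewrite 2 [this]
  rw [smul_sub, smul_add, smul_smul, smul_smul, inv_mul_eq_div, inv_mul_eq_div]
  abel

/-- Two vectors at an acute angle do not cancel: `|a d + b s σ|` is bounded below if `d · σ ≥ 0` and
`a, b` are bounded below. -/
lemma sq_norm_add_ge {c a b s : ℝ} (hc : 0 ≤ c) (ha : c ≤ a) (hb : c ≤ b) (hs : 0 ≤ s) {d σ : Vel}
    (hσ : ‖σ‖ = 1) (hcos : 0 ≤ inner ℝ d σ) :
    c ^ 2 * (‖d‖ ^ 2 + s ^ 2) ≤ ‖a • d + (b * s) • σ‖ ^ 2 := by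
  have ha0 := hc.trans ha
  have hb0 := hc.trans hb
  rw [norm_add_sq_real, norm_smul, norm_smul, hσ, real_inner_smul_left, real_inner_smul_right,
    Real.norm_of_nonneg ha0, Real.norm_of_nonneg (by positivity), mul_one, mul_pow, mul_pow]
  have h1 : c ^ 2 * ‖d‖ ^ 2 ≤ a ^ 2 * ‖d‖ ^ 2 := by gcongr
  have h2 : c ^ 2 * s ^ 2 ≤ b ^ 2 * s ^ 2 := by gcongr
  have h3 : 0 ≤ 2 * (a * (b * s * inner ℝ d σ)) := by positivity
  linarith

/-- If `û · σ ≥ 0`, the relative energy is controlled by the state `(v', I')` and the partner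
`(v_*, I_*)`. -/
lemma energy_le_of_acute (i j : Fin P) {x y : MolState} (hx : 0 ≤ x.2) (hy : 0 ≤ y.2) {σ : Vel}
    (hσ : ‖σ‖ = 1) {r R : ℝ} (hr : r ∈ Ioo (0 : ℝ) 1) (hR : R ∈ Ioo (0 : ℝ) 1)
    (hcos : 0 ≤ inner ℝ (x.1 - y.1) σ) :
    M.minRatio i j ^ 2 * r * M.energy i j x y ≤
      M.molEnergy i (M.post i j x y σ r R) + M.molEnergy j y := by
  have hμ := M.redMass_pos i j
  have hE := M.energy_nonneg i j hx hy
  have hR0 := hR.1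
  have h1 := sq_norm_add_ge (M.minRatio_pos i j).le (min_le_left _ _) (min_le_right _ _)
    (Real.sqrt_nonneg (2 * R * M.energy i j x y / M.redMass i j)) hσ hcos
  rw [Real.sq_sqrt (by positivity)] at h1
  refine le_trans ?_ (M.energy_le_molEnergy i j (M.post i j x y σ r R) y)
  rw [energy.eq_def M i j (M.post i j x y σ r R) y, post_fst_sub_right, add_sub_cancel_left]
  change _ ≤ _ + r * (1 - R) * M.energy i j x y + y.2
  set s := M.minRatio i j
  set E := M.energy i j x y
  have hs : s ^ 2 ≤ 1 := by
    have := M.minRatio_le_half i j; have := (M.minRatio_pos i j).le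
    exact pow_le_one₀ (by assumption) (by linarith)
  have h2 : M.redMass i j / 2 * (s ^ 2 * (‖x.1 - y.1‖ ^ 2 + 2 * R * E / M.redMass i j)) ≤
    M.redMass i j / 2 * _ := mul_le_mul_of_nonneg_left h1 (by positivity)
  have h3 : M.redMass i j / 2 * (s ^ 2 * (‖x.1 - y.1‖ ^ 2 + 2 * R * E / M.redMass i j)) =
    s ^ 2 * (M.redMass i j / 2 * ‖x.1 - y.1‖ ^ 2) + s ^ 2 * (R * E) := by field_simp
  have h4 : 0 ≤ s ^ 2 * (M.redMass i j / 2 * ‖x.1 - y.1‖ ^ 2) := by positivity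
  have hr0 := hr.1
  have h5 : s ^ 2 * (r * (R * E)) ≤ s ^ 2 * (R * E) := by
    have : r * (R * E) ≤ R * E := mul_le_of_le_one_left (by positivity) hr.2.le
    gcongr
  have hR1 : 0 ≤ 1 - R := sub_nonneg.2 hR.2.le
  have h6 : s ^ 2 * (r * (1 - R) * E) ≤ r * (1 - R) * E :=
    mul_le_of_le_one_left (by positivity) hs
  nlinarith

/-- If `û · σ ≤ 0`, the relative energy is controlled by the states `(v', I')` and `(v, I)`. -/
lemma energy_le_of_obtuse (i j : Fin P) {x y : MolState} (hx : 0 ≤ x.2) (hy : 0 ≤ y.2) {σ : Vel}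
    (hσ : ‖σ‖ = 1) {r R : ℝ} (hr : r ∈ Ioo (0 : ℝ) 1) (hR : R ∈ Ioo (0 : ℝ) 1)
    (hcos : 0 ≤ inner ℝ (y.1 - x.1) σ) :
    M.minRatio i j ^ 2 * r * M.energy i j x y ≤
      2 * (M.molEnergy i (M.post i j x y σ r R) + M.molEnergy i x) := by
  have hμ := M.redMass_pos i j
  have hE := M.energy_nonneg i j hx hy
  have hR0 := hR.1
  have hR1 : 0 ≤ 1 - R := sub_nonneg.2 hR.2.le
  have hr0 := hr.1
  have h1 := sq_norm_add_ge (M.minRatio_pos i j).le (min_le_right _ _) (min_le_right _ _)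
    (Real.sqrt_nonneg (2 * R * M.energy i j x y / M.redMass i j)) hσ hcos
  rw [Real.sq_sqrt (by positivity)] at h1
  have h0 : ‖(M.post i j x y σ r R).1 - x.1‖ ^ 2 ≤
      2 * (‖(M.post i j x y σ r R).1‖ ^ 2 + ‖x.1‖ ^ 2) := by
    have := norm_sub_le (M.post i j x y σ r R).1 x.1
    have h' := norm_nonneg ((M.post i j x y σ r R).1 - x.1)
    nlinarith [sq_nonneg (‖(M.post i j x y σ r R).1‖ - ‖x.1‖)]
  have hi : (M.post i j x y σ r R).2 = r * (1 - R) * M.energy i j x y := rfl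
  have h00 := h0
  nth_rewrite 1 [post_fst_sub_left] at h0
  rw [add_sub_cancel_left] at h0
  replace h1 := h1.trans h0
  unfold molEnergy
  rw [hi]
  set s := M.minRatio i j
  set E := M.energy i j x y
  set A := ‖(M.post i j x y σ r R).1‖ ^ 2
  have hA : 0 ≤ A := sq_nonneg _
  have hs : s ^ 2 ≤ 1 := by
    have := M.minRatio_le_half i j; have := (M.minRatio_pos i j).le
    exact pow_le_one₀ (by assumption) (by linarith)
  rw [norm_sub_rev] at h1
  have h2 := mul_le_mul_of_nonneg_left h1 (show 0 ≤ M.redMass i j / 2 by positivity)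
  have h3 : M.redMass i j / 2 * (s ^ 2 * (‖x.1 - y.1‖ ^ 2 + 2 * R * E / M.redMass i j)) =
    s ^ 2 * (M.redMass i j / 2 * ‖x.1 - y.1‖ ^ 2) + s ^ 2 * (R * E) := by field_simp
  have h4 : 0 ≤ s ^ 2 * (M.redMass i j / 2 * ‖x.1 - y.1‖ ^ 2) := by positivity
  have h5 : s ^ 2 * (r * (R * E)) ≤ s ^ 2 * (R * E) := by
    have : r * (R * E) ≤ R * E := mul_le_of_le_one_left (by positivity) hr.2.le
    gcongr
  have h6 : s ^ 2 * (r * (1 - R) * E) ≤ r * (1 - R) * E :=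
    mul_le_of_le_one_left (by positivity) hs
  have h7 : M.redMass i j * (A + ‖x.1‖ ^ 2) ≤ M.m i * (A + ‖x.1‖ ^ 2) := by
    have := M.redMass_le_left i j
    gcongr
  have h8 : 0 ≤ r * (1 - R) * E := by positivity
  nlinarith

lemma sq_bracket_mul_ge (i j : Fin P) {x y : MolState} (hx : 0 ≤ x.2) (hy : 0 ≤ y.2) :
    1 + (M.molEnergy i x + M.molEnergy j y) / M.totalMass ≤
      M.bracket i x ^ 2 * M.bracket j y ^ 2 := by
  have := M.totalMass_pos i
  have h1 := M.molEnergy_nonneg i hx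
  have h2 := M.molEnergy_nonneg j hy
  rw [sq_bracket M i hx, sq_bracket M j hy, add_div]
  have : 0 ≤ M.molEnergy i x / M.totalMass * (M.molEnergy j y / M.totalMass) := by positivity
  nlinarith

lemma energy_div_le (i j : Fin P) {x y : MolState} (hx : 0 ≤ x.2) (hy : 0 ≤ y.2) :
    M.energy i j x y / M.totalMass ≤ M.bracket i x ^ 2 * M.bracket j y ^ 2 := by
  have h := M.totalMass_pos i
  have h2 : M.energy i j x y / M.totalMass ≤
      (M.molEnergy i x + M.molEnergy j y) / M.totalMass := by
    gcongr; exact M.energy_le_molEnergy i j x y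
  have := M.sq_bracket_mul_ge i j hx hy
  linarith

lemma post_snd_nonneg (i j : Fin P) {x y : MolState} (hx : 0 ≤ x.2) (hy : 0 ≤ y.2) (σ : Vel)
    {r R : ℝ} (hr : r ∈ Ioo (0 : ℝ) 1) (hR : R ∈ Ioo (0 : ℝ) 1) :
    0 ≤ (M.post i j x y σ r R).2 :=
  mul_nonneg (mul_nonneg hr.1.le (sub_nonneg.2 hR.2.le)) (M.energy_nonneg i j hx hy)

lemma bracket_post_le (i j : Fin P) {x y : MolState} (hx : 0 ≤ x.2) (hy : 0 ≤ y.2) {σ : Vel}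
    (hσ : ‖σ‖ = 1) {r R : ℝ} (hr : r ∈ Ioo (0 : ℝ) 1) (hR : R ∈ Ioo (0 : ℝ) 1) :
    M.bracket i (M.post i j x y σ r R) ≤ M.bracket i x * M.bracket j y := by
  have h := M.totalMass_pos i
  refine le_of_sq_le_sq ?_ (mul_nonneg (M.bracket_nonneg i x) (M.bracket_nonneg j y))
  rw [mul_pow, M.sq_bracket i (M.post_snd_nonneg i j hx hy σ hr hR)]
  refine le_trans ?_ (M.sq_bracket_mul_ge i j hx hy)
  gcongr
  exact M.molEnergy_post_le i j hx hy hσ hr hR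

lemma energy_div_le_of_acute (i j : Fin P) {x y : MolState} (hx : 0 ≤ x.2) (hy : 0 ≤ y.2) {σ : Vel}
    (hσ : ‖σ‖ = 1) {r R : ℝ} (hr : r ∈ Ioo (0 : ℝ) 1) (hR : R ∈ Ioo (0 : ℝ) 1)
    (hcos : 0 ≤ inner ℝ (x.1 - y.1) σ) :
    M.energy i j x y / M.totalMass ≤ 2 / (M.minRatio i j ^ 2 * r) *
      (M.bracket i (M.post i j x y σ r R) ^ 2 * M.bracket j y ^ 2) := by
  have h := M.totalMass_pos i
  have hs := M.minRatio_pos i j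
  have hr0 := hr.1
  have h1 := M.sq_bracket_mul_ge i j (M.post_snd_nonneg i j hx hy σ hr hR) hy
  have h2 := M.energy_le_of_acute i j hx hy hσ hr hR hcos
  rw [div_mul_eq_mul_div, le_div_iff₀ (by positivity)]
  have h3 : M.energy i j x y / M.totalMass * (M.minRatio i j ^ 2 * r) ≤
      (M.molEnergy i (M.post i j x y σ r R) + M.molEnergy j y) / M.totalMass := by
    rw [div_mul_eq_mul_div]; gcongr; linarith
  have h4 : 0 ≤ (M.molEnergy i (M.post i j x y σ r R) + M.molEnergy j y) / M.totalMass :=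
    div_nonneg (add_nonneg (M.molEnergy_nonneg i (M.post_snd_nonneg i j hx hy σ hr hR))
      (M.molEnergy_nonneg j hy)) h.le
  linarith

lemma energy_div_le_of_obtuse (i j : Fin P) {x y : MolState} (hx : 0 ≤ x.2) (hy : 0 ≤ y.2)
    {σ : Vel} (hσ : ‖σ‖ = 1) {r R : ℝ} (hr : r ∈ Ioo (0 : ℝ) 1) (hR : R ∈ Ioo (0 : ℝ) 1)
    (hcos : 0 ≤ inner ℝ (y.1 - x.1) σ) :
    M.energy i j x y / M.totalMass ≤ 2 / (M.minRatio i j ^ 2 * r) *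
      (M.bracket i (M.post i j x y σ r R) ^ 2 * M.bracket i x ^ 2) := by
  have h := M.totalMass_pos i
  have hs := M.minRatio_pos i j
  have hr0 := hr.1
  have h1 := M.sq_bracket_mul_ge i i (M.post_snd_nonneg i j hx hy σ hr hR) hx
  have h2 := M.energy_le_of_obtuse i j hx hy hσ hr hR hcos
  rw [div_mul_eq_mul_div, le_div_iff₀ (by positivity)]
  have h3 : M.energy i j x y / M.totalMass * (M.minRatio i j ^ 2 * r) ≤
      2 * (M.molEnergy i (M.post i j x y σ r R) + M.molEnergy i x) / M.totalMass := by
    rw [div_mul_eq_mul_div]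
    exact div_le_div_of_nonneg_right (by linarith) h.le
  rw [mul_div_assoc] at h3
  linarith

end GasMixture

/-- Distribution of the powers of the relative energy `e` and of the outgoing bracket `c` over the
brackets `a`, `b` of the incoming molecules, `b` being the one that controls `e` together
with `c`. -/
lemma weight_le {p k γ a b c e C : ℝ} (hp : 1 ≤ p) (hk : 0 ≤ k) (hγ : 0 ≤ γ) (ha : 1 ≤ a)
    (hb : 1 ≤ b) (hc : 1 ≤ c) (he : 0 ≤ e) (hC : 0 ≤ C) (h1 : e ≤ a ^ 2 * b ^ 2) (h2 : c ≤ a * b)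
    (h3 : e ≤ C * (c ^ 2 * b ^ 2)) :
    e ^ (γ / 2) * c ^ (k * p) ≤ C ^ (γ / 2 * (1 - 1 / p)) *
      (a ^ (γ / p + k) * b ^ (k + γ)) * (c ^ (γ + k * p)) ^ (1 - 1 / p) := by
  have hp0 : 0 < p := by linarith
  have ha0 : 0 < a := by linarith
  have hb0 : 0 < b := by linarith
  have hc0 : 0 < c := by linarith
  have hθ : 0 ≤ 1 - 1 / p := by rw [sub_nonneg, div_le_one hp0]; exact hp
  have e1 : e ^ (γ / 2) = e ^ (γ / (2 * p)) * e ^ (γ / 2 * (1 - 1 / p)) := by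
    rw [← Real.rpow_add_of_nonneg he (by positivity) (by positivity)]
    congr 1; field_simp; ring
  have e2 : c ^ (k * p) = c ^ k * c ^ (k * p * (1 - 1 / p)) := by
    rw [← Real.rpow_add hc0]; congr 1; field_simp; ring
  have i1 : e ^ (γ / (2 * p)) ≤ a ^ (γ / p) * b ^ (γ / p) := by
    refine (Real.rpow_le_rpow he h1 (by positivity)).trans_eq ?_
    rw [Real.mul_rpow (by positivity) (by positivity), ← Real.rpow_natCast, ← Real.rpow_natCast,
      ← Real.rpow_mul ha0.le, ← Real.rpow_mul hb0.le]
    have : ((2 : ℕ) : ℝ) * (γ / (2 * p)) = γ / p := by push_cast; field_simp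
    rw [this]
  have i2 : e ^ (γ / 2 * (1 - 1 / p)) ≤ C ^ (γ / 2 * (1 - 1 / p)) *
      (c ^ (γ * (1 - 1 / p)) * b ^ (γ * (1 - 1 / p))) := by
    refine (Real.rpow_le_rpow he h3 (by positivity)).trans_eq ?_
    rw [Real.mul_rpow hC (by positivity), Real.mul_rpow (by positivity) (by positivity),
      ← Real.rpow_natCast, ← Real.rpow_natCast,
      ← Real.rpow_mul hc0.le, ← Real.rpow_mul hb0.le]
    have : ((2 : ℕ) : ℝ) * (γ / 2 * (1 - 1 / p)) = γ * (1 - 1 / p) := by push_cast; ring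
    rw [this]
  have i3 : c ^ k ≤ a ^ k * b ^ k := by
    rw [← Real.mul_rpow ha0.le hb0.le]
    exact Real.rpow_le_rpow hc0.le h2 hk
  have e3 : b ^ (k + γ) = b ^ (γ / p) * b ^ (γ * (1 - 1 / p)) * b ^ k := by
    rw [← Real.rpow_add hb0, ← Real.rpow_add hb0]; congr 1; field_simp; ring
  have e4 : (c ^ (γ + k * p)) ^ (1 - 1 / p) =
      c ^ (γ * (1 - 1 / p)) * c ^ (k * p * (1 - 1 / p)) := by
    rw [← Real.rpow_add hc0, ← Real.rpow_mul hc0.le]; congr 1; ring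
  calc e ^ (γ / 2) * c ^ (k * p) = e ^ (γ / (2 * p)) * e ^ (γ / 2 * (1 - 1 / p)) *
        (c ^ k * c ^ (k * p * (1 - 1 / p))) := by rw [e1, e2]
    _ ≤ (a ^ (γ / p) * b ^ (γ / p)) * (C ^ (γ / 2 * (1 - 1 / p)) *
      (c ^ (γ * (1 - 1 / p)) * b ^ (γ * (1 - 1 / p)))) *
        ((a ^ k * b ^ k) * c ^ (k * p * (1 - 1 / p))) := by gcongr
    _ = _ := by rw [e3, e4, Real.rpow_add ha0]; ring

/-! ### Trilinear estimates -/

/-- Hölder's inequality for an angular weight `β(c(x, σ))` and a collision map `T`. -/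
lemma lintegral_holder_angular {p : ℝ} (hp : 1 ≤ p) {β : MolState × Metric.sphere (0 : Vel) 1 → ℝ≥0∞}
    {T : MolState × Metric.sphere (0 : Vel) 1 → MolState} (hβ : Measurable β) (hT : Measurable T)
    {N S : ℝ≥0∞} {F H : MolState → ℝ≥0∞} (hF : Measurable F) (hH : Measurable H)
    (h1 : ∀ᵐ x ∂stateMeasure, ∫⁻ σ, β (x, σ) ∂sphereMeasure ≤ N)
    (h2 : ∫⁻ x, ∫⁻ σ, β (x, σ) * H (T (x, σ)) ∂sphereMeasure ∂stateMeasure ≤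
      N * S * ∫⁻ x, H x ∂stateMeasure) :
    ∫⁻ x, ∫⁻ σ, β (x, σ) * (F x * H (T (x, σ)) ^ (1 - 1 / p)) ∂sphereMeasure ∂stateMeasure ≤
      N * S ^ (1 - 1 / p) * ((∫⁻ x, F x ^ p ∂stateMeasure) ^ (1 / p) *
        (∫⁻ x, H x ∂stateMeasure) ^ (1 - 1 / p)) := by
  have hp0 : 0 < p := by linarith
  have hp1 : 0 ≤ 1 / p := by positivity
  have hθ : 0 ≤ 1 - 1 / p := by rw [sub_nonneg, div_le_one hp0]; exact hp
  have hsum : 1 / p + (1 - 1 / p) = 1 := by ring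
  have hpow : ∀ a : ℝ≥0∞, a = a ^ (1 / p) * a ^ (1 - 1 / p) := fun a => by
    rw [← ENNReal.rpow_add_of_nonneg _ _ hp1 hθ, hsum, ENNReal.rpow_one]
  have m1 : Measurable fun z : MolState × Metric.sphere (0 : Vel) 1 => β z * F z.1 ^ p := by fun_prop
  have m2 : Measurable fun z : MolState × Metric.sphere (0 : Vel) 1 => β z * H (T z) := by fun_prop
  have m3 : Measurable fun z : MolState × Metric.sphere (0 : Vel) 1 =>
      β z * (F z.1 * H (T z) ^ (1 - 1 / p)) := by fun_prop
  have i1 : ∫⁻ z, β z * F z.1 ^ p ∂(stateMeasure.prod sphereMeasure) ≤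
      N * ∫⁻ x, F x ^ p ∂stateMeasure := by
    rw [lintegral_prod _ m1.aemeasurable, ← lintegral_const_mul _ (by fun_prop)]
    refine lintegral_mono_ae (h1.mono fun x hx => ?_)
    refine (lintegral_mul_const (F x ^ p) (by fun_prop)).trans_le ?_
    exact mul_le_mul_left hx _
  have i2 : ∫⁻ z, β z * H (T z) ∂(stateMeasure.prod sphereMeasure) ≤
      N * S * ∫⁻ x, H x ∂stateMeasure := by
    rw [lintegral_prod _ m2.aemeasurable]; exact h2
  calc ∫⁻ x, ∫⁻ σ, β (x, σ) * (F x * H (T (x, σ)) ^ (1 - 1 / p)) ∂sphereMeasure ∂stateMeasure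
      = ∫⁻ z, (β z * F z.1 ^ p) ^ (1 / p) * (β z * H (T z)) ^ (1 - 1 / p)
          ∂(stateMeasure.prod sphereMeasure) := by
        rw [← lintegral_prod (fun z => β z * (F z.1 * H (T z) ^ (1 - 1 / p))) m3.aemeasurable]
        refine lintegral_congr fun z => ?_
        rw [ENNReal.mul_rpow_of_nonneg _ _ hp1, ENNReal.mul_rpow_of_nonneg _ _ hθ,
          ← ENNReal.rpow_mul, mul_one_div_cancel hp0.ne', ENNReal.rpow_one]
        nth_rewrite 1 [hpow (β z)]
        ring
    _ ≤ (N * ∫⁻ x, F x ^ p ∂stateMeasure) ^ (1 / p) *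
          (N * S * ∫⁻ x, H x ∂stateMeasure) ^ (1 - 1 / p) := by
        refine (ENNReal.lintegral_mul_norm_pow_le m1.aemeasurable m2.aemeasurable hp1 hθ
          hsum).trans ?_
        gcongr
    _ = _ := by
        rw [ENNReal.mul_rpow_of_nonneg _ _ hp1, ENNReal.mul_rpow_of_nonneg _ _ hθ,
          ENNReal.mul_rpow_of_nonneg _ _ hθ]
        conv_rhs => rw [hpow N]
        ring

lemma lintegral_lintegral_const_mul {α β : Type*} [MeasurableSpace α] [MeasurableSpace β]
    {μ : Measure α} {ν : Measure β} [SFinite ν] (c : ℝ≥0∞) {f : α → β → ℝ≥0∞}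
    (hf : Measurable (Function.uncurry f)) :
    ∫⁻ x, ∫⁻ y, c * f x y ∂ν ∂μ = c * ∫⁻ x, ∫⁻ y, f x y ∂ν ∂μ := by
  refine (lintegral_congr fun x => ?_).trans (lintegral_const_mul c hf.lintegral_prod_right')
  exact lintegral_const_mul _ (hf.comp measurable_prodMk_left)

lemma ae_stateMeasure_pos : ∀ᵐ x ∂stateMeasure, 0 < x.2 := by
  rw [stateMeasure_eq]
  exact Measure.quasiMeasurePreserving_snd.ae (ae_restrict_mem measurableSet_Ioi)

lemma ae_stateMeasure_ne (v : Vel) : ∀ᵐ x ∂stateMeasure, x.1 ≠ v := by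
  rw [stateMeasure_eq]
  refine Measure.quasiMeasurePreserving_fst.ae (p := fun u => u ≠ v) ?_
  rw [ae_iff]; simp

namespace GasMixture

variable {P : ℕ} (M : GasMixture P)

/-- The gain form with the kernel replaced by a product of an angular weight and a weight in
`(r, R)`: an expression in the densities `F`, `G` of the incoming molecules and the power
`1 / q = 1 - 1 / p` of the outgoing factor `H`. -/
noncomputable def tri (i j : Fin P) (p : ℝ) (β : ℝ → ℝ≥0∞) (Λ : ℝ × ℝ → ℝ≥0∞)
    (F G H : MolState → ℝ≥0∞) : ℝ≥0∞ :=
  ∫⁻ x, ∫⁻ y, ∫⁻ w, β (inner ℝ (unitDir (x.1 - y.1)) (w.1 : Vel)) * Λ w.2 * (F x * G y) *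
    H (M.post i j x y w.1 w.2.1 w.2.2) ^ (1 - 1 / p)
    ∂collisionMeasure ∂stateMeasure ∂stateMeasure

/-- The weight `Λ` integrated against the Jacobian factor of the collision maps, to the power
`1 / q = 1 - 1 / p` with which it enters through Hölder's inequality. -/
noncomputable def jacMass (i j : Fin P) (p : ℝ) (Λ : ℝ × ℝ → ℝ≥0∞) : ℝ≥0∞ :=
  ∫⁻ z, Λ z * ENNReal.ofReal ((M.minRatio i j ^ 3 * (z.1 * (1 - z.2)))⁻¹) ^ (1 - 1 / p)
    ∂exchangeMeasure

lemma ae_exchangeMeasure : ∀ᵐ z ∂exchangeMeasure,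
    z.1 ∈ Ioo (0 : ℝ) 1 ∧ z.2 ∈ Ioo (0 : ℝ) 1 := by
  rw [exchangeMeasure_eq, Measure.prod_restrict]
  exact ae_restrict_mem (measurableSet_Ioo.prod measurableSet_Ioo)

variable {M}

lemma measurable_tri_integrand (i j : Fin P) (p : ℝ) {β : ℝ → ℝ≥0∞} {Λ : ℝ × ℝ → ℝ≥0∞}
    {F G H : MolState → ℝ≥0∞} (hβ : Measurable β) (hΛ : Measurable Λ) (hF : Measurable F)
    (hG : Measurable G) (hH : Measurable H) :
    Measurable fun z : (MolState × MolState) × CollParam =>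
      β (inner ℝ (unitDir (z.1.1.1 - z.1.2.1)) (z.2.1 : Vel)) * Λ z.2.2 * (F z.1.1 * G z.1.2) *
        H (M.post i j z.1.1 z.1.2 z.2.1 z.2.2.1 z.2.2.2) ^ (1 - 1 / p) := by
  have hp := (M.measurable_post i j).comp (f := fun z : (MolState × MolState) × CollParam =>
      ((z.1.1, z.1.2, (z.2.1 : Vel), z.2.2.1, z.2.2.2) : MolState × MolState × Vel × ℝ × ℝ))
      (by fun_prop)
  have hu := measurable_unitDir
  refine Measurable.mul ?_ ((hH.comp hp).pow_const _)
  fun_prop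

/-- The trilinear estimate with the second molecule held fixed: Hölder's inequality in `(x, σ)` and
the change of variables `lintegral_post_le` from `x` to the outgoing state. -/
lemma tri_le_right (i j : Fin P) {p : ℝ} (hp : 1 ≤ p) {β : ℝ → ℝ≥0∞} {Λ : ℝ × ℝ → ℝ≥0∞}
    {F G H : MolState → ℝ≥0∞} (hβ : Measurable β) (hΛ : Measurable Λ) (hF : Measurable F)
    (hG : Measurable G) (hH : Measurable H) {N : ℝ≥0∞} (hN : AngBound β N) :
    M.tri i j p β Λ F G H ≤ N * M.jacMass i j p Λ *
      ((∫⁻ x, F x ^ p ∂stateMeasure) ^ (1 / p) * (∫⁻ x, H x ∂stateMeasure) ^ (1 - 1 / p)) *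
        ∫⁻ y, G y ∂stateMeasure := by
  have hm := measurable_tri_integrand (M := M) i j p hβ hΛ hF hG hH
  have hu := measurable_unitDir
  have hpost := M.measurable_post i j
  have h0 : 0 ≤ 1 - 1 / p := by rw [sub_nonneg, div_le_one (by linarith)]; exact hp
  set X := (∫⁻ x, F x ^ p ∂stateMeasure) ^ (1 / p) * (∫⁻ x, H x ∂stateMeasure) ^ (1 - 1 / p)
  -- For fixed `y` and `(r, R)` the integral over `(x, σ)` is estimated by Hölder's inequality.
  have hfix : ∀ᵐ y ∂stateMeasure, ∀ᵐ z ∂exchangeMeasure,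
      ∫⁻ x, ∫⁻ σ, β (inner ℝ (unitDir (x.1 - y.1)) (σ : Vel)) * Λ z * (F x * G y) *
        H (M.post i j x y σ z.1 z.2) ^ (1 - 1 / p) ∂sphereMeasure ∂stateMeasure ≤
      (N * X * G y) * (Λ z *
        ENNReal.ofReal ((M.minRatio i j ^ 3 * (z.1 * (1 - z.2)))⁻¹) ^ (1 - 1 / p)) := by
    refine ae_stateMeasure_pos.mono fun y hy => ae_exchangeMeasure.mono fun z hz => ?_
    have hr := hz.1.1
    have hR : 0 < 1 - z.2 := sub_pos.2 hz.2.2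
    have hs := M.minRatio_pos i j
    have hT : Measurable fun q : MolState × Metric.sphere (0 : Vel) 1 =>
        M.post i j q.1 y q.2 z.1 z.2 :=
      hpost.comp (f := fun q : MolState × Metric.sphere (0 : Vel) 1 =>
        ((q.1, y, (q.2 : Vel), z.1, z.2) : MolState × MolState × Vel × ℝ × ℝ)) (by fun_prop)
    have hA : ∀ᵐ x ∂stateMeasure, ∫⁻ σ, β (inner ℝ (unitDir (x.1 - y.1)) (σ : Vel))
        ∂sphereMeasure ≤ N := by
      refine (ae_stateMeasure_ne y.1).mono fun x hx => ?_
      have hxy : x.1 - y.1 ≠ 0 := sub_ne_zero.2 hx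
      exact hN.unitDir_le hxy
    have key := lintegral_holder_angular hp
      (β := fun q => β (inner ℝ (unitDir (q.1.1 - y.1)) (q.2 : Vel)))
      (T := fun q => M.post i j q.1 y q.2 z.1 z.2) (by fun_prop) hT (N := N)
      (S := ENNReal.ofReal ((M.minRatio i j ^ 3 * (z.1 * (1 - z.2)))⁻¹)) hF hH
      hA (by
        have ha : 0 < M.m i / (M.m i + M.m j) :=
          div_pos (M.m_pos i) (add_pos (M.m_pos i) (M.m_pos j))
        have hb : 0 < M.m j / (M.m i + M.m j) :=
          div_pos (M.m_pos j) (add_pos (M.m_pos i) (M.m_pos j))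
        have := lintegral_post_le (M.redMass_pos i j) ha hb.le hy.le hr hz.2.2 y.1 hβ hN H hH
        refine le_trans (le_of_eq ?_) (this.trans ?_)
        · refine lintegral_congr fun x => lintegral_congr fun σ => ?_
          simp only
          congr 2
          refine Prod.ext ?_ rfl
          exact M.post_fst_sub_right i j x y σ z.1 z.2
        · refine mul_le_mul_left (mul_le_mul_right (ENNReal.ofReal_le_ofReal ?_) _) _
          refine inv_anti₀ (by positivity) ?_
          refine mul_le_mul_of_nonneg_right ?_ (by positivity)
          exact pow_le_pow_left₀ hs.le (min_le_left _ _) 3)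
    calc _ = ∫⁻ x, ∫⁻ σ, (Λ z * G y) * (β (inner ℝ (unitDir (x.1 - y.1)) (σ : Vel)) *
          (F x * H (M.post i j x y σ z.1 z.2) ^ (1 - 1 / p))) ∂sphereMeasure ∂stateMeasure := by
          refine lintegral_congr fun x => lintegral_congr fun σ => ?_
          ring
      _ = (Λ z * G y) * ∫⁻ x, ∫⁻ σ, β (inner ℝ (unitDir (x.1 - y.1)) (σ : Vel)) *
          (F x * H (M.post i j x y σ z.1 z.2) ^ (1 - 1 / p)) ∂sphereMeasure ∂stateMeasure := by
          have hm' : Measurable fun q : MolState × Metric.sphere (0 : Vel) 1 =>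
              β (inner ℝ (unitDir (q.1.1 - y.1)) (q.2 : Vel)) *
              (F q.1 * H (M.post i j q.1 y q.2 z.1 z.2) ^ (1 - 1 / p)) := by
            refine Measurable.mul (by fun_prop) (Measurable.mul (by fun_prop) ?_)
            exact (hH.comp hT).pow_const _
          exact lintegral_lintegral_const_mul _ hm'
      _ ≤ (Λ z * G y) * (N * ENNReal.ofReal ((M.minRatio i j ^ 3 * (z.1 * (1 - z.2)))⁻¹) ^
            (1 - 1 / p) * X) := mul_le_mul_right key _
      _ = _ := by ring
  have hprod : ∀ x y, ∫⁻ w, β (inner ℝ (unitDir (x.1 - y.1)) (w.1 : Vel)) * Λ w.2 * (F x * G y) *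
      H (M.post i j x y w.1 w.2.1 w.2.2) ^ (1 - 1 / p) ∂collisionMeasure =
      ∫⁻ z, ∫⁻ σ, β (inner ℝ (unitDir (x.1 - y.1)) (σ : Vel)) * Λ z * (F x * G y) *
      H (M.post i j x y σ z.1 z.2) ^ (1 - 1 / p) ∂sphereMeasure ∂exchangeMeasure := fun x y => by
    exact lintegral_prod_symm _
      ((hm.comp (f := fun w : CollParam => ((x, y), w)) (by fun_prop)).aemeasurable)
  calc M.tri i j p β Λ F G H
      = ∫⁻ y, ∫⁻ x, ∫⁻ w, β (inner ℝ (unitDir (x.1 - y.1)) (w.1 : Vel)) * Λ w.2 * (F x * G y) *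
          H (M.post i j x y w.1 w.2.1 w.2.2) ^ (1 - 1 / p)
          ∂collisionMeasure ∂stateMeasure ∂stateMeasure :=
        lintegral_lintegral_swap hm.lintegral_prod_right'.aemeasurable
    _ = ∫⁻ y, ∫⁻ z, ∫⁻ x, ∫⁻ σ, β (inner ℝ (unitDir (x.1 - y.1)) (σ : Vel)) * Λ z * (F x * G y) *
          H (M.post i j x y σ z.1 z.2) ^ (1 - 1 / p)
          ∂sphereMeasure ∂stateMeasure ∂exchangeMeasure ∂stateMeasure := by
        refine lintegral_congr fun y => ?_
        simp_rw [hprod]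
        refine lintegral_lintegral_swap (Measurable.aemeasurable ?_)
        refine Measurable.lintegral_prod_right' (f := fun q :
          (MolState × (ℝ × ℝ)) × Metric.sphere (0 : Vel) 1 =>
          β (inner ℝ (unitDir (q.1.1.1 - y.1)) (q.2 : Vel)) * Λ q.1.2 * (F q.1.1 * G y) *
          H (M.post i j q.1.1 y q.2 q.1.2.1 q.1.2.2) ^ (1 - 1 / p)) ?_
        exact hm.comp (f := fun q : (MolState × (ℝ × ℝ)) × Metric.sphere (0 : Vel) 1 =>
          ((q.1.1, y), (q.2, q.1.2))) (by fun_prop)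
    _ ≤ ∫⁻ y, ∫⁻ z, (N * X * G y) * (Λ z *
          ENNReal.ofReal ((M.minRatio i j ^ 3 * (z.1 * (1 - z.2)))⁻¹) ^ (1 - 1 / p))
          ∂exchangeMeasure ∂stateMeasure :=
        lintegral_mono_ae (hfix.mono fun y hy => lintegral_mono_ae hy)
    _ = ∫⁻ y, (N * X * M.jacMass i j p Λ) * G y ∂stateMeasure := by
        refine lintegral_congr fun y => ?_
        rw [lintegral_const_mul _ (by fun_prop), jacMass]
        ring
    _ = _ := by
        rw [lintegral_const_mul _ hG]
        ring

/-- The trilinear estimate with the first molecule held fixed. Now `y` moves, and `v_* - v` is at the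
opposite angle, whence the bound on `β(-·)`. -/
lemma tri_le_left (i j : Fin P) {p : ℝ} (hp : 1 ≤ p) {β : ℝ → ℝ≥0∞} {Λ : ℝ × ℝ → ℝ≥0∞}
    {F G H : MolState → ℝ≥0∞} (hβ : Measurable β) (hΛ : Measurable Λ) (hF : Measurable F)
    (hG : Measurable G) (hH : Measurable H) {N : ℝ≥0∞} (hN : AngBound (fun s => β (-s)) N) :
    M.tri i j p β Λ F G H ≤ N * M.jacMass i j p Λ *
      ((∫⁻ x, G x ^ p ∂stateMeasure) ^ (1 / p) * (∫⁻ x, H x ∂stateMeasure) ^ (1 - 1 / p)) *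
        ∫⁻ y, F y ∂stateMeasure := by
  have hm := measurable_tri_integrand (M := M) i j p hβ hΛ hF hG hH
  have hu := measurable_unitDir
  have hpost := M.measurable_post i j
  have h0 : 0 ≤ 1 - 1 / p := by rw [sub_nonneg, div_le_one (by linarith)]; exact hp
  have hβn : Measurable fun s => β (-s) := by fun_prop
  have hneg : ∀ (x y : MolState) (σ : Metric.sphere (0 : Vel) 1),
      β (inner ℝ (unitDir (x.1 - y.1)) (σ : Vel)) =
        β (-inner ℝ (unitDir (y.1 - x.1)) (σ : Vel)) := fun x y σ => by
    rw [← neg_sub, unitDir_neg, inner_neg_left]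
  set X := (∫⁻ x, G x ^ p ∂stateMeasure) ^ (1 / p) * (∫⁻ x, H x ∂stateMeasure) ^ (1 - 1 / p)
  have hfix : ∀ᵐ x ∂stateMeasure, ∀ᵐ z ∂exchangeMeasure,
      ∫⁻ y, ∫⁻ σ, β (inner ℝ (unitDir (x.1 - y.1)) (σ : Vel)) * Λ z * (F x * G y) *
        H (M.post i j x y σ z.1 z.2) ^ (1 - 1 / p) ∂sphereMeasure ∂stateMeasure ≤
      (N * X * F x) * (Λ z *
        ENNReal.ofReal ((M.minRatio i j ^ 3 * (z.1 * (1 - z.2)))⁻¹) ^ (1 - 1 / p)) := by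
    refine ae_stateMeasure_pos.mono fun x hx => ae_exchangeMeasure.mono fun z hz => ?_
    have hr := hz.1.1
    have hR : 0 < 1 - z.2 := sub_pos.2 hz.2.2
    have hs := M.minRatio_pos i j
    have hT : Measurable fun q : MolState × Metric.sphere (0 : Vel) 1 =>
        M.post i j x q.1 q.2 z.1 z.2 :=
      hpost.comp (f := fun q : MolState × Metric.sphere (0 : Vel) 1 =>
        ((x, q.1, (q.2 : Vel), z.1, z.2) : MolState × MolState × Vel × ℝ × ℝ)) (by fun_prop)
    have hA : ∀ᵐ y ∂stateMeasure, ∫⁻ σ, β (-inner ℝ (unitDir (y.1 - x.1)) (σ : Vel))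
        ∂sphereMeasure ≤ N := by
      refine (ae_stateMeasure_ne x.1).mono fun y hy => ?_
      have hxy : y.1 - x.1 ≠ 0 := sub_ne_zero.2 hy
      exact hN.unitDir_le hxy
    have key := lintegral_holder_angular hp
      (β := fun q => β (-inner ℝ (unitDir (q.1.1 - x.1)) (q.2 : Vel)))
      (T := fun q => M.post i j x q.1 q.2 z.1 z.2) (by fun_prop) hT (N := N)
      (S := ENNReal.ofReal ((M.minRatio i j ^ 3 * (z.1 * (1 - z.2)))⁻¹)) hG hH
      hA (by
        have hb : 0 < M.m j / (M.m i + M.m j) :=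
          div_pos (M.m_pos j) (add_pos (M.m_pos i) (M.m_pos j))
        have := lintegral_post_le (M.redMass_pos i j) hb hb.le hx.le hr hz.2.2 x.1 hβn hN H hH
        refine le_trans (le_of_eq ?_) (this.trans ?_)
        · refine lintegral_congr fun y => lintegral_congr fun σ => ?_
          have hE : M.energy i j x y =
              M.redMass i j / 2 * ‖y.1 - x.1‖ ^ 2 + y.2 + x.2 := by
            rw [energy, norm_sub_rev]; ring
          simp only
          congr 2
          refine Prod.ext ?_ ?_
          · simp only [← hE]
            exact M.post_fst_sub_left i j x y σ z.1 z.2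
          · simp only [← hE]; rfl
        · refine mul_le_mul_left (mul_le_mul_right (ENNReal.ofReal_le_ofReal ?_) _) _
          refine inv_anti₀ (by positivity) ?_
          refine mul_le_mul_of_nonneg_right ?_ (by positivity)
          exact pow_le_pow_left₀ hs.le (min_le_right _ _) 3)
    calc _ = ∫⁻ y, ∫⁻ σ, (Λ z * F x) * (β (-inner ℝ (unitDir (y.1 - x.1)) (σ : Vel)) *
          (G y * H (M.post i j x y σ z.1 z.2) ^ (1 - 1 / p))) ∂sphereMeasure ∂stateMeasure := by
          refine lintegral_congr fun y => lintegral_congr fun σ => ?_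
          rw [hneg]
          ring
      _ = (Λ z * F x) * ∫⁻ y, ∫⁻ σ, β (-inner ℝ (unitDir (y.1 - x.1)) (σ : Vel)) *
          (G y * H (M.post i j x y σ z.1 z.2) ^ (1 - 1 / p)) ∂sphereMeasure ∂stateMeasure := by
          have hm' : Measurable fun q : MolState × Metric.sphere (0 : Vel) 1 =>
              β (-inner ℝ (unitDir (q.1.1 - x.1)) (q.2 : Vel)) *
              (G q.1 * H (M.post i j x q.1 q.2 z.1 z.2) ^ (1 - 1 / p)) := by
            refine Measurable.mul (by fun_prop) (Measurable.mul (by fun_prop) ?_)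
            exact (hH.comp hT).pow_const _
          exact lintegral_lintegral_const_mul _ hm'
      _ ≤ (Λ z * F x) * (N * ENNReal.ofReal ((M.minRatio i j ^ 3 * (z.1 * (1 - z.2)))⁻¹) ^
            (1 - 1 / p) * X) := mul_le_mul_right key _
      _ = _ := by ring
  have hprod : ∀ x y, ∫⁻ w, β (inner ℝ (unitDir (x.1 - y.1)) (w.1 : Vel)) * Λ w.2 * (F x * G y) *
      H (M.post i j x y w.1 w.2.1 w.2.2) ^ (1 - 1 / p) ∂collisionMeasure =
      ∫⁻ z, ∫⁻ σ, β (inner ℝ (unitDir (x.1 - y.1)) (σ : Vel)) * Λ z * (F x * G y) *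
      H (M.post i j x y σ z.1 z.2) ^ (1 - 1 / p) ∂sphereMeasure ∂exchangeMeasure := fun x y => by
    exact lintegral_prod_symm _
      ((hm.comp (f := fun w : CollParam => ((x, y), w)) (by fun_prop)).aemeasurable)
  calc M.tri i j p β Λ F G H
      = ∫⁻ x, ∫⁻ z, ∫⁻ y, ∫⁻ σ, β (inner ℝ (unitDir (x.1 - y.1)) (σ : Vel)) * Λ z * (F x * G y) *
          H (M.post i j x y σ z.1 z.2) ^ (1 - 1 / p)
          ∂sphereMeasure ∂stateMeasure ∂exchangeMeasure ∂stateMeasure := by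
        refine lintegral_congr fun x => ?_
        simp_rw [hprod]
        refine lintegral_lintegral_swap (Measurable.aemeasurable ?_)
        refine Measurable.lintegral_prod_right' (f := fun q :
          (MolState × (ℝ × ℝ)) × Metric.sphere (0 : Vel) 1 =>
          β (inner ℝ (unitDir (x.1 - q.1.1.1)) (q.2 : Vel)) * Λ q.1.2 * (F x * G q.1.1) *
          H (M.post i j x q.1.1 q.2 q.1.2.1 q.1.2.2) ^ (1 - 1 / p)) ?_
        exact hm.comp (f := fun q : (MolState × (ℝ × ℝ)) × Metric.sphere (0 : Vel) 1 =>
          ((x, q.1.1), (q.2, q.1.2))) (by fun_prop)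
    _ ≤ ∫⁻ x, ∫⁻ z, (N * X * F x) * (Λ z *
          ENNReal.ofReal ((M.minRatio i j ^ 3 * (z.1 * (1 - z.2)))⁻¹) ^ (1 - 1 / p))
          ∂exchangeMeasure ∂stateMeasure :=
        lintegral_mono_ae (hfix.mono fun y hy => lintegral_mono_ae hy)
    _ = ∫⁻ x, (N * X * M.jacMass i j p Λ) * F x ∂stateMeasure := by
        refine lintegral_congr fun x => ?_
        rw [lintegral_const_mul _ (by fun_prop), jacMass]
        ring
    _ = _ := by
        rw [lintegral_const_mul _ hF]
        ring

end GasMixture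

/-! ### Reduction of the gain form to trilinear forms -/

lemma ae_sphere_inner {e : Vel} (he : ‖e‖ = 1) {q : ℝ → Prop}
    (hq : ∀ᵐ s ∂(volume.restrict (Icc (-1 : ℝ) 1)), q s) :
    ∀ᵐ σ : Metric.sphere (0 : Vel) 1 ∂sphereMeasure, q (inner ℝ e (σ : Vel)) := by
  set S := toMeasurable (volume.restrict (Icc (-1 : ℝ) 1)) {s | ¬ q s} with hS
  have hSm : MeasurableSet S := measurableSet_toMeasurable _ _
  have hS0 : volume.restrict (Icc (-1 : ℝ) 1) S = 0 := by
    rw [hS, measure_toMeasurable]; exact hq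
  have h := lintegral_sphere_inner he (S.indicator 1) (measurable_one.indicator hSm)
  rw [lintegral_indicator_one hSm, hS0, mul_zero] at h
  have hme : Measurable fun σ : Metric.sphere (0 : Vel) 1 => inner ℝ e (σ : Vel) := by fun_prop
  have h := (lintegral_eq_zero_iff ((measurable_one.indicator hSm).comp hme)).1 h
  refine h.mono fun σ hσ => ?_
  by_contra hn
  have : inner ℝ e (σ : Vel) ∈ S := subset_toMeasurable _ _ hn
  simp [this] at hσ

lemma lintegral_triple_add {f g : MolState → MolState → CollParam → ℝ≥0∞}
    (hf : Measurable fun z : (MolState × MolState) × CollParam => f z.1.1 z.1.2 z.2) :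
    ∫⁻ x, ∫⁻ y, ∫⁻ w, (f x y w + g x y w) ∂collisionMeasure ∂stateMeasure ∂stateMeasure =
      (∫⁻ x, ∫⁻ y, ∫⁻ w, f x y w ∂collisionMeasure ∂stateMeasure ∂stateMeasure) +
        ∫⁻ x, ∫⁻ y, ∫⁻ w, g x y w ∂collisionMeasure ∂stateMeasure ∂stateMeasure := by
  refine (lintegral_congr fun x => ?_).trans
    (lintegral_add_left hf.lintegral_prod_right'.lintegral_prod_right' _)
  refine (lintegral_congr fun y => ?_).trans
    (lintegral_add_left (hf.lintegral_prod_right'.comp measurable_prodMk_left) _)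
  exact lintegral_add_left (f := f x y) (hf.comp (measurable_prodMk_left (x := (x, y)))) (g x y)

/-- Distribution of the integrand of the weak gain term over the factors of a trilinear form. -/
lemma ofReal_integrand_le {p k γ f g f' B d b bub e c C A A' : ℝ} (hp : 1 ≤ p) (hf : 0 ≤ f)
    (hg : 0 ≤ g) (hf' : 0 ≤ f') (hd : 0 ≤ d) (hb : 0 ≤ b) (hbub : 0 ≤ bub) (hc : 0 ≤ c)
    (hC : 0 ≤ C) (hA : 0 ≤ A) (hA' : 0 ≤ A') (hB : B ≤ b * bub * e ^ (γ / 2))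
    (hw : e ^ (γ / 2) * c ^ (k * p) ≤ C * (A * A') * (c ^ (γ + k * p)) ^ (1 - 1 / p)) :
    ENNReal.ofReal (f * g * B * d) * ENNReal.ofReal (f' ^ (p - 1) * c ^ (k * p)) ≤
      ENNReal.ofReal b * ENNReal.ofReal (C * (bub * d)) *
        (ENNReal.ofReal (f * A) * ENNReal.ofReal (g * A')) *
        (ENNReal.ofReal (f' * c ^ (γ / p + k)) ^ p) ^ (1 - 1 / p) := by
  have hp0 : 0 < p := by linarith
  have hθ : 0 ≤ 1 - 1 / p := by rw [sub_nonneg, div_le_one hp0]; exact hp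
  have e1 : ((f' * c ^ (γ / p + k)) ^ p) ^ (1 - 1 / p) =
      f' ^ (p - 1) * (c ^ (γ + k * p)) ^ (1 - 1 / p) := by
    rw [Real.mul_rpow hf' (by positivity), ← Real.rpow_mul hc, Real.mul_rpow (by positivity)
      (by positivity), ← Real.rpow_mul hf']
    congr 2
    · field_simp
    · congr 1; field_simp
  rw [ENNReal.ofReal_rpow_of_nonneg (by positivity) hp0.le,
    ENNReal.ofReal_rpow_of_nonneg (by positivity) hθ, e1, ← ENNReal.ofReal_mul hb,
    ← ENNReal.ofReal_mul (mul_nonneg hf hA),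
    ← ENNReal.ofReal_mul (mul_nonneg hb (mul_nonneg hC (mul_nonneg hbub hd))),
    ← ENNReal.ofReal_mul (p := b * (C * (bub * d)) * (f * A * (g * A'))) (by positivity),
    ← ENNReal.ofReal_mul' (by positivity)]
  refine ENNReal.ofReal_le_ofReal ?_
  calc f * g * B * d * (f' ^ (p - 1) * c ^ (k * p))
      ≤ f * g * (b * bub * e ^ (γ / 2)) * d * (f' ^ (p - 1) * c ^ (k * p)) := by gcongr
    _ = (f * g * b * bub * d * f' ^ (p - 1)) * (e ^ (γ / 2) * c ^ (k * p)) := by ring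
    _ ≤ (f * g * b * bub * d * f' ^ (p - 1)) *
        (C * (A * A') * (c ^ (γ + k * p)) ^ (1 - 1 / p)) := by gcongr
    _ = _ := by ring

/-- A density times a power of the bracket, as an extended nonnegative function. -/
noncomputable def GasMixture.wdens {P : ℕ} (M : GasMixture P) (i : Fin P) (s : ℝ)
    (f : MolState → ℝ) (x : MolState) : ℝ≥0∞ := ENNReal.ofReal (f x * M.bracket i x ^ s)

lemma GasMixture.measurable_wdens {P : ℕ} (M : GasMixture P) (i : Fin P) (s : ℝ)
    {f : MolState → ℝ} (hf : Measurable f) : Measurable (M.wdens i s f) := by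
  have := M.measurable_bracket i
  unfold GasMixture.wdens; fun_prop

/-- The restriction of an angular weight to acute angles. -/
noncomputable def acutePart (β : ℝ → ℝ≥0∞) : ℝ → ℝ≥0∞ := (Ioi (0 : ℝ)).indicator β

/-- The restriction of an angular weight to obtuse angles. -/
noncomputable def obtusePart (β : ℝ → ℝ≥0∞) : ℝ → ℝ≥0∞ := (Iio (0 : ℝ)).indicator β

lemma measurable_acutePart {β : ℝ → ℝ≥0∞} (hβ : Measurable β) : Measurable (acutePart β) :=
  hβ.indicator measurableSet_Ioi

lemma measurable_obtusePart {β : ℝ → ℝ≥0∞} (hβ : Measurable β) : Measurable (obtusePart β) :=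
  hβ.indicator measurableSet_Iio

namespace CollisionKernel

variable {P : ℕ} {M : GasMixture P} (Q : CollisionKernel M)

/-- The `(r, R)` weight of the gain estimate: upper profile times the factor lost in controlling
the relative energy by `⟨v', I'⟩`. -/
noncomputable def gainProfile (i j : Fin P) (p : ℝ) (z : ℝ × ℝ) : ℝ :=
  (2 / (M.minRatio i j ^ 2 * z.1)) ^ (Q.γ i j / 2 * (1 - 1 / p)) *
    (Q.bub i j z.1 z.2 * M.dWeight i j z.1 z.2)

/-- The gain form is dominated by two trilinear forms, one for each sign of `û · σ`. -/
lemma lintegral_gain_le_tri (i j : Fin P) {p k : ℝ} (hp : 1 ≤ p) (hk : 0 ≤ k)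
    {f g : MolState → ℝ} (hf : Measurable f) (hg : Measurable g) (hf0 : ∀ x, 0 ≤ f x)
    (hg0 : ∀ x, 0 ≤ g x) {β : ℝ → ℝ≥0∞} (hβ : Measurable β)
    (hbβ : ∀ᵐ s ∂(volume.restrict (Icc (-1 : ℝ) 1)), ENNReal.ofReal (Q.b i j s) ≤ β s)
    {Λ : ℝ × ℝ → ℝ≥0∞} (hΛ : Measurable Λ)
    (hΛ' : ∀ᵐ z ∂exchangeMeasure, ENNReal.ofReal (Q.gainProfile i j p z) ≤ Λ z) :
    ∫⁻ x, Q.gain i j f g x * ENNReal.ofReal (f x ^ (p - 1) * M.bracket i x ^ (k * p))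
        ∂stateMeasure ≤
      M.tri i j p (acutePart β) Λ (M.wdens i (Q.γ i j / p + k) f) (M.wdens j (k + Q.γ i j) g)
        (fun x => M.wdens i (Q.γ i j / p + k) f x ^ p) +
      M.tri i j p (obtusePart β) Λ (M.wdens i (k + Q.γ i j) f) (M.wdens j (Q.γ i j / p + k) g)
        (fun x => M.wdens i (Q.γ i j / p + k) f x ^ p) := by
  have hbr := M.measurable_bracket i
  have hγ := (Q.γ_mem i j).1
  set γ := Q.γ i j
  have hm1 := GasMixture.measurable_tri_integrand (M := M) i j p (measurable_acutePart hβ) hΛ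
    (M.measurable_wdens i (γ / p + k) hf) (M.measurable_wdens j (k + γ) hg)
    ((M.measurable_wdens i (γ / p + k) hf).pow_const p)
  have hsplit : M.tri i j p (acutePart β) Λ (M.wdens i (γ / p + k) f) (M.wdens j (k + γ) g)
        (fun x => M.wdens i (γ / p + k) f x ^ p) +
      M.tri i j p (obtusePart β) Λ (M.wdens i (k + γ) f) (M.wdens j (γ / p + k) g)
        (fun x => M.wdens i (γ / p + k) f x ^ p) = ∫⁻ x, ∫⁻ y, ∫⁻ w,
      ((acutePart β (inner ℝ (unitDir (x.1 - y.1)) (w.1 : Vel)) * Λ w.2 *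
        (M.wdens i (γ / p + k) f x * M.wdens j (k + γ) g y) *
        (M.wdens i (γ / p + k) f (M.post i j x y w.1 w.2.1 w.2.2) ^ p) ^ (1 - 1 / p)) +
      (obtusePart β (inner ℝ (unitDir (x.1 - y.1)) (w.1 : Vel)) * Λ w.2 *
        (M.wdens i (k + γ) f x * M.wdens j (γ / p + k) g y) *
        (M.wdens i (γ / p + k) f (M.post i j x y w.1 w.2.1 w.2.2) ^ p) ^ (1 - 1 / p)))
      ∂collisionMeasure ∂stateMeasure ∂stateMeasure := by
    exact (lintegral_triple_add hm1).symm
  rw [Q.lintegral_gain_mul i j hf hg (φ := fun x => f x ^ (p - 1) * M.bracket i x ^ (k * p))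
    (by fun_prop), hsplit]
  refine lintegral_mono_ae (ae_stateMeasure_pos.mono fun x hx => ?_)
  refine lintegral_mono_ae ((ae_stateMeasure_pos.and (ae_stateMeasure_ne x.1)).mono
    fun y hy => ?_)
  obtain ⟨hy, hxy⟩ := hy
  have hu : x.1 - y.1 ≠ 0 := sub_ne_zero.2 (Ne.symm hxy)
  have hnu : 0 < ‖x.1 - y.1‖ := norm_pos_iff.2 hu
  have hne0 : ∀ᵐ s ∂(volume.restrict (Icc (-1 : ℝ) 1)), s ≠ 0 := by
    refine ae_restrict_of_ae ?_
    rw [ae_iff]; simp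
  have hσ := Measure.quasiMeasurePreserving_fst (ν := exchangeMeasure)|>.ae
    (ae_sphere_inner (norm_unitDir hu) (hbβ.and hne0))
  have hz := Measure.quasiMeasurePreserving_snd (μ := sphereMeasure)|>.ae hΛ'
  refine lintegral_mono_ae ?_
  filter_upwards [ae_collisionMeasure, hσ, hz] with w hw hσw hzw
  obtain ⟨hr, hR⟩ := hw
  obtain ⟨hbw, hcos⟩ := hσw
  have hw1 := norm_sphere_coe w.1
  have hadm : GasMixture.Admissible x y w.1 w.2.1 w.2.2 := ⟨Ne.symm hxy, hx, hy, hw1, hr, hR⟩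
  have hub := Q.upper_bound i j x y w.1 w.2.1 w.2.2 hadm
  have hcosmem : inner ℝ (unitDir (x.1 - y.1)) (w.1 : Vel) ∈ Icc (-1 : ℝ) 1 := by
    have := abs_real_inner_le_norm (unitDir (x.1 - y.1)) (w.1 : Vel)
    rw [norm_unitDir hu, hw1, one_mul] at this
    exact abs_le.1 this
  have hb0 := Q.b_nonneg i j _ hcosmem
  have hbub := Q.bub_nonneg i j _ hr _ hR
  have hd := M.dWeight_nonneg i j (Ioo_subset_Icc_self hr) (Ioo_subset_Icc_self hR)
  have hpx := M.post_snd_nonneg i j hx.le hy.le w.1 hr hR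
  have ha := M.one_le_bracket i hx.le
  have hb := M.one_le_bracket j hy.le
  have hc := M.one_le_bracket i hpx
  have he : 0 ≤ M.energy i j x y / M.totalMass :=
    div_nonneg (M.energy_nonneg i j hx.le hy.le) (M.totalMass_pos i).le
  have hC : 0 ≤ 2 / (M.minRatio i j ^ 2 * w.2.1) := by
    have := M.minRatio_pos i j; have := hr.1; positivity
  have h1 := M.energy_div_le i j hx.le hy.le
  have h2 := M.bracket_post_le i j hx.le hy.le hw1 hr hR
  have hinner : inner ℝ (x.1 - y.1) (w.1 : Vel) =
      ‖x.1 - y.1‖ * inner ℝ (unitDir (x.1 - y.1)) (w.1 : Vel) := by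
    rw [unitDir, real_inner_smul_left, ← mul_assoc, mul_inv_cancel₀ hnu.ne', one_mul]
  -- for `û · σ < 0` the roles of the two incoming brackets in `weight_le` are exchanged
  rcases lt_or_gt_of_ne hcos with hneg | hpos
  · have hin : 0 ≤ inner ℝ (y.1 - x.1) (w.1 : Vel) := by
      rw [← neg_sub, inner_neg_left, hinner]
      nlinarith
    have h3 := M.energy_div_le_of_obtuse i j hx.le hy.le hw1 hr hR hin
    have hwt := weight_le hp hk hγ hb ha hc he hC (by linarith) (by linarith) h3
    rw [mul_comm (M.bracket j y ^ (γ / p + k))] at hwt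
    refine le_trans (ofReal_integrand_le hp (hf0 x) (hg0 y) (hf0 _) hd hb0 hbub
      (zero_le_one.trans hc) (by positivity) (by positivity) (by positivity) hub hwt) ?_
    refine le_add_left ?_
    unfold obtusePart
    rw [indicator_of_mem (by exact hneg)]
    exact mul_le_mul_left (mul_le_mul_left (mul_le_mul' hbw hzw) _) _
  · have hin : 0 ≤ inner ℝ (x.1 - y.1) (w.1 : Vel) := by
      rw [hinner]; positivity
    have h3 := M.energy_div_le_of_acute i j hx.le hy.le hw1 hr hR hin
    have hwt := weight_le hp hk hγ ha hb hc he hC h1 h2 h3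
    refine le_trans (ofReal_integrand_le hp (hf0 x) (hg0 y) (hf0 _) hd hb0 hbub
      (zero_le_one.trans hc) (by positivity) (by positivity) (by positivity) hub hwt) ?_
    refine le_add_right ?_
    unfold acutePart
    rw [indicator_of_mem (by exact hpos)]
    exact mul_le_mul_left (mul_le_mul_left (mul_le_mul' hbw hzw) _) _

end CollisionKernel

/-! ### Weighted norms, truncation of densities and the constant of the gain estimate -/

namespace GasMixture

variable {P : ℕ} (M : GasMixture P)

lemma bracket_rpow_nonneg (i : Fin P) (s : ℝ) (x : MolState) : 0 ≤ M.bracket i x ^ s :=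
  Real.rpow_nonneg (M.bracket_nonneg i x) s

variable {M}

lemma lintegral_wdens_rpow {i : Fin P} {p s : ℝ} (hp : 1 ≤ p) {f : MolState → ℝ}
    (hf0 : ∀ x, 0 ≤ f x) (hf : M.InLp i p s f) :
    ∫⁻ x, M.wdens i s f x ^ p ∂stateMeasure = ENNReal.ofReal (M.norm i p s f ^ p) := by
  have hp0 : 0 < p := by linarith
  have h1 : (ENNReal.ofReal p).toReal = p := ENNReal.toReal_ofReal hp0.le
  have h2 := eLpNorm_eq_lintegral_rpow_enorm_toReal (μ := stateMeasure)
    (f := fun x => f x * M.bracket i x ^ s) (p := ENNReal.ofReal p) (by simpa using hp0)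
    ENNReal.ofReal_ne_top
  have h3 : ∀ x, ‖f x * M.bracket i x ^ s‖ₑ = M.wdens i s f x := fun x => by
    rw [Real.enorm_eq_ofReal (mul_nonneg (hf0 x) (M.bracket_rpow_nonneg i s x)), wdens]
  simp_rw [h3, h1] at h2
  have hfin := hf.eLpNorm_ne_top
  rw [GasMixture.norm, ← ENNReal.ofReal_rpow_of_nonneg ENNReal.toReal_nonneg hp0.le,
    ENNReal.ofReal_toReal hfin, h2, ← ENNReal.rpow_mul, one_div_mul_cancel hp0.ne',
    ENNReal.rpow_one]

lemma lintegral_wdens {i : Fin P} {s : ℝ} {f : MolState → ℝ}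
    (hf0 : ∀ x, 0 ≤ f x) (hf : M.InLp i 1 s f) :
    ∫⁻ x, M.wdens i s f x ∂stateMeasure = ENNReal.ofReal (M.norm i 1 s f) := by
  simpa using lintegral_wdens_rpow le_rfl hf0 hf

lemma norm_nonneg (i : Fin P) (p s : ℝ) (f : MolState → ℝ) : 0 ≤ M.norm i p s f :=
  ENNReal.toReal_nonneg

lemma wdens_mono_exp {i : Fin P} {s s' : ℝ} (hs : s ≤ s') {f : MolState → ℝ}
    (hf0 : ∀ x, 0 ≤ f x) {x : MolState} (hx : 0 ≤ x.2) : M.wdens i s f x ≤ M.wdens i s' f x := by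
  refine ENNReal.ofReal_le_ofReal (mul_le_mul_of_nonneg_left ?_ (hf0 x))
  exact Real.rpow_le_rpow_of_exponent_le (M.one_le_bracket i hx) hs

lemma InLp.mono {i : Fin P} {s s' : ℝ} (hs : s ≤ s') {f : MolState → ℝ} (hfm : Measurable f)
    (hf0 : ∀ x, 0 ≤ f x) (hf : M.InLp i 1 s' f) : M.InLp i 1 s f := by
  have hb := M.measurable_bracket i
  refine MemLp.mono hf (by fun_prop) (ae_stateMeasure_pos.mono fun x hx => ?_)
  rw [Real.norm_of_nonneg (mul_nonneg (hf0 x) (M.bracket_rpow_nonneg i s x)),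
    Real.norm_of_nonneg (mul_nonneg (hf0 x) (M.bracket_rpow_nonneg i s' x))]
  exact mul_le_mul_of_nonneg_left
    (Real.rpow_le_rpow_of_exponent_le (M.one_le_bracket i hx.le) hs) (hf0 x)

lemma norm_mono {i : Fin P} {s s' : ℝ} (hs : s ≤ s') {f : MolState → ℝ} (hfm : Measurable f)
    (hf0 : ∀ x, 0 ≤ f x) (hf : M.InLp i 1 s' f) : M.norm i 1 s f ≤ M.norm i 1 s' f := by
  rw [← ENNReal.ofReal_le_ofReal_iff (norm_nonneg i 1 s' f), ← lintegral_wdens hf0 hf,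
    ← lintegral_wdens hf0 (hf.mono hs hfm hf0)]
  exact lintegral_mono_ae (ae_stateMeasure_pos.mono fun x hx => wdens_mono_exp hs hf0 hx.le)

lemma tri_le_right_real (i j : Fin P) {p : ℝ} (hp : 1 ≤ p) {β : ℝ → ℝ≥0∞} {Λ : ℝ × ℝ → ℝ≥0∞}
    {F G H : MolState → ℝ≥0∞} (hβ : Measurable β) (hΛ : Measurable Λ) (hF : Measurable F)
    (hG : Measurable G) (hH : Measurable H) {N c x y l : ℝ} (hN0 : 0 ≤ N) (hc : 0 ≤ c)
    (hx : 0 ≤ x) (hy : 0 ≤ y)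
    (hN : AngBound β (ENNReal.ofReal N)) (hJ : M.jacMass i j p Λ ≤ ENNReal.ofReal c)
    (hFx : ∫⁻ x, F x ^ p ∂stateMeasure ≤ ENNReal.ofReal x)
    (hHy : ∫⁻ x, H x ∂stateMeasure ≤ ENNReal.ofReal y)
    (hGl : ∫⁻ x, G x ∂stateMeasure ≤ ENNReal.ofReal l) :
    M.tri i j p β Λ F G H ≤ ENNReal.ofReal (N * c * (x ^ (1 / p) * y ^ (1 - 1 / p)) * l) := by
  have hp0 : 0 < p := by linarith
  have hθ : 0 ≤ 1 - 1 / p := by rw [sub_nonneg, div_le_one hp0]; exact hp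
  rw [ENNReal.ofReal_mul (by positivity), ENNReal.ofReal_mul (by positivity),
    ENNReal.ofReal_mul hN0, ENNReal.ofReal_mul (by positivity),
    ← ENNReal.ofReal_rpow_of_nonneg hx (by positivity), ← ENNReal.ofReal_rpow_of_nonneg hy hθ]
  refine (tri_le_right i j hp hβ hΛ hF hG hH hN).trans ?_
  gcongr

lemma tri_le_left_real (i j : Fin P) {p : ℝ} (hp : 1 ≤ p) {β : ℝ → ℝ≥0∞} {Λ : ℝ × ℝ → ℝ≥0∞}
    {F G H : MolState → ℝ≥0∞} (hβ : Measurable β) (hΛ : Measurable Λ) (hF : Measurable F)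
    (hG : Measurable G) (hH : Measurable H) {N c x y l : ℝ} (hN0 : 0 ≤ N) (hc : 0 ≤ c)
    (hx : 0 ≤ x) (hy : 0 ≤ y)
    (hN : AngBound (fun s => β (-s)) (ENNReal.ofReal N))
    (hJ : M.jacMass i j p Λ ≤ ENNReal.ofReal c)
    (hGx : ∫⁻ x, G x ^ p ∂stateMeasure ≤ ENNReal.ofReal x)
    (hHy : ∫⁻ x, H x ∂stateMeasure ≤ ENNReal.ofReal y)
    (hFl : ∫⁻ x, F x ∂stateMeasure ≤ ENNReal.ofReal l) :
    M.tri i j p β Λ F G H ≤ ENNReal.ofReal (N * c * (x ^ (1 / p) * y ^ (1 - 1 / p)) * l) := by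
  have hp0 : 0 < p := by linarith
  have hθ : 0 ≤ 1 - 1 / p := by rw [sub_nonneg, div_le_one hp0]; exact hp
  rw [ENNReal.ofReal_mul (by positivity), ENNReal.ofReal_mul (by positivity),
    ENNReal.ofReal_mul hN0, ENNReal.ofReal_mul (by positivity),
    ← ENNReal.ofReal_rpow_of_nonneg hx (by positivity), ← ENNReal.ofReal_rpow_of_nonneg hy hθ]
  refine (tri_le_left i j hp hβ hΛ hF hG hH hN).trans ?_
  gcongr

lemma tri_add_angular (i j : Fin P) (p : ℝ) {β β' : ℝ → ℝ≥0∞} {Λ : ℝ × ℝ → ℝ≥0∞}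
    {F G H : MolState → ℝ≥0∞} (hβ : Measurable β) (hΛ : Measurable Λ) (hF : Measurable F)
    (hG : Measurable G) (hH : Measurable H) :
    M.tri i j p (fun s => β s + β' s) Λ F G H =
      M.tri i j p β Λ F G H + M.tri i j p β' Λ F G H := by
  unfold tri
  rw [← lintegral_triple_add (measurable_tri_integrand i j p hβ hΛ hF hG hH)]
  simp only [add_mul]

lemma tri_add_right (i j : Fin P) (p : ℝ) {β : ℝ → ℝ≥0∞} {Λ : ℝ × ℝ → ℝ≥0∞}
    {F G G' H : MolState → ℝ≥0∞} (hβ : Measurable β) (hΛ : Measurable Λ) (hF : Measurable F)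
    (hG : Measurable G) (hH : Measurable H) :
    M.tri i j p β Λ F (fun x => G x + G' x) H =
      M.tri i j p β Λ F G H + M.tri i j p β Λ F G' H := by
  unfold tri
  rw [← lintegral_triple_add (measurable_tri_integrand i j p hβ hΛ hF hG hH)]
  simp only [add_mul, mul_add]

lemma tri_add_left (i j : Fin P) (p : ℝ) {β : ℝ → ℝ≥0∞} {Λ : ℝ × ℝ → ℝ≥0∞}
    {F F' G H : MolState → ℝ≥0∞} (hβ : Measurable β) (hΛ : Measurable Λ) (hF : Measurable F)
    (hG : Measurable G) (hH : Measurable H) :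
    M.tri i j p β Λ (fun x => F x + F' x) G H =
      M.tri i j p β Λ F G H + M.tri i j p β Λ F' G H := by
  unfold tri
  rw [← lintegral_triple_add (measurable_tri_integrand i j p hβ hΛ hF hG hH)]
  simp only [add_mul, mul_add]

variable (M)

/-- The part of a density above the level `K ⟨·⟩^(-ℓ)`. -/
noncomputable def largePart (i : Fin P) (K ℓ : ℝ) (f : MolState → ℝ) : MolState → ℝ :=
  {x | K * M.bracket i x ^ (-ℓ) < f x}.indicator f

/-- The part of a density below the level `K ⟨·⟩^(-ℓ)`. -/
noncomputable def smallPart (i : Fin P) (K ℓ : ℝ) (f : MolState → ℝ) : MolState → ℝ :=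
  {x | K * M.bracket i x ^ (-ℓ) < f x}ᶜ.indicator f

variable {M}

lemma measurableSet_level (i : Fin P) (K ℓ : ℝ) {f : MolState → ℝ} (hf : Measurable f) :
    MeasurableSet {x | K * M.bracket i x ^ (-ℓ) < f x} := by
  have := M.measurable_bracket i
  exact measurableSet_lt (by fun_prop) hf

lemma measurable_largePart (i : Fin P) (K ℓ : ℝ) {f : MolState → ℝ} (hf : Measurable f) :
    Measurable (M.largePart i K ℓ f) := hf.indicator (measurableSet_level i K ℓ hf)

lemma measurable_smallPart (i : Fin P) (K ℓ : ℝ) {f : MolState → ℝ} (hf : Measurable f) :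
    Measurable (M.smallPart i K ℓ f) := hf.indicator (measurableSet_level i K ℓ hf).compl

lemma wdens_eq_large_add_small (i : Fin P) (K ℓ s : ℝ) (f : MolState → ℝ) :
    M.wdens i s f = fun x => M.wdens i s (M.largePart i K ℓ f) x +
      M.wdens i s (M.smallPart i K ℓ f) x := by
  funext x
  by_cases hx : x ∈ {x | K * M.bracket i x ^ (-ℓ) < f x}
  · simp [wdens, largePart, smallPart, indicator_of_mem hx,
      indicator_of_notMem (notMem_compl_iff.2 hx)]
  · simp [wdens, largePart, smallPart, indicator_of_notMem hx,
      indicator_of_mem (mem_compl hx)]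

/-- Below the level `K ⟨·⟩^(-(s + 6))`, a density with weight `⟨·⟩^s` is at most `K ⟨·⟩^(-6)`,
hence lies in every `L^p`. -/
lemma lintegral_smallPart_le (i : Fin P) {K s p : ℝ} (hK : 0 ≤ K) (hp : 1 ≤ p)
    (f : MolState → ℝ) (hc : M.InLp i 1 (-6) fun _ => 1) :
    ∫⁻ x, M.wdens i s (M.smallPart i K (s + 6) f) x ^ p ∂stateMeasure ≤
      ENNReal.ofReal (K ^ p * M.norm i 1 (-6) fun _ => 1) := by
  have hp0 : 0 ≤ p := by linarith
  rw [ENNReal.ofReal_mul (by positivity), ← lintegral_wdens (fun _ => zero_le_one) hc,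
    ← lintegral_const_mul' _ _ ENNReal.ofReal_ne_top]
  refine lintegral_mono_ae (ae_stateMeasure_pos.mono fun x hx => ?_)
  have hb := M.one_le_bracket i hx.le
  have hb0 : 0 < M.bracket i x := by linarith
  have h1 : M.smallPart i K (s + 6) f x * M.bracket i x ^ s ≤ K * M.bracket i x ^ (-6 : ℝ) := by
    have h2 : M.smallPart i K (s + 6) f x ≤ K * M.bracket i x ^ (-(s + 6)) := by
      by_cases hm : x ∈ {x | K * M.bracket i x ^ (-(s + 6)) < f x}
      · rw [smallPart, indicator_of_notMem (notMem_compl_iff.2 hm)]; positivity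
      · rw [smallPart, indicator_of_mem (mem_compl hm)]
        exact not_lt.1 hm
    refine (mul_le_mul_of_nonneg_right h2 (by positivity)).trans_eq ?_
    rw [mul_assoc, ← Real.rpow_add hb0]
    congr 2; ring
  calc M.wdens i s (M.smallPart i K (s + 6) f) x ^ p
      ≤ ENNReal.ofReal (K * M.bracket i x ^ (-6 : ℝ)) ^ p :=
        ENNReal.rpow_le_rpow (ENNReal.ofReal_le_ofReal h1) hp0
    _ = ENNReal.ofReal (K ^ p * (M.bracket i x ^ (-6 : ℝ)) ^ p) := by
        rw [ENNReal.ofReal_rpow_of_nonneg (by positivity) hp0,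
          Real.mul_rpow hK (by positivity)]
    _ ≤ ENNReal.ofReal (K ^ p * (1 * M.bracket i x ^ (-6 : ℝ))) := by
        refine ENNReal.ofReal_le_ofReal (mul_le_mul_of_nonneg_left ?_ (by positivity))
        rw [one_mul]
        refine Real.rpow_le_self_of_le_one (by positivity) ?_ hp
        exact Real.rpow_le_one_of_one_le_of_nonpos hb (by norm_num)
    _ = _ := ENNReal.ofReal_mul (by positivity)

end GasMixture

/-- If the first molecule moves, an integrable weight on acute angles is averaged with its full mass. -/
lemma angBound_acutePart {β : ℝ → ℝ≥0∞} (hβ : Measurable β) :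
    AngBound (acutePart β) (ENNReal.ofReal (2 * Real.pi) * ∫⁻ s in Icc (-1 : ℝ) 1, β s) := by
  refine (AngBound.of_acute (measurable_acutePart hβ) fun s hs => ?_).mono ?_
  · exact indicator_of_notMem (not_lt.2 hs) _
  · exact mul_le_mul_right (lintegral_mono fun s => indicator_le_self _ _ s) _

/-- If the second molecule moves, the same holds for obtuse angles. -/
lemma angBound_obtusePart {β : ℝ → ℝ≥0∞} (hβ : Measurable β) :
    AngBound (fun s => obtusePart β (-s))
      (ENNReal.ofReal (2 * Real.pi) * ∫⁻ s in Icc (-1 : ℝ) 1, β s) := by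
  have hm : Measurable fun s => obtusePart β (-s) := (measurable_obtusePart hβ).comp measurable_neg
  refine (AngBound.of_acute hm fun s hs => ?_).mono ?_
  · exact indicator_of_notMem (by simpa using hs) _
  · refine mul_le_mul_right ?_ _
    calc ∫⁻ s in Icc (-1 : ℝ) 1, obtusePart β (-s) ≤ ∫⁻ s in Icc (-1 : ℝ) 1, β (-s) :=
          lintegral_mono fun s => indicator_le_self _ _ (-s)
      _ = ∫⁻ s in Icc (-1 : ℝ) 1, β s := by
          rw [← lintegral_indicator measurableSet_Icc, ← lintegral_indicator measurableSet_Icc,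
            ← lintegral_neg_eq_self]
          refine lintegral_congr fun s => ?_
          have : -s ∈ Icc (-1 : ℝ) 1 ↔ s ∈ Icc (-1 : ℝ) 1 := by
            simp only [mem_Icc]; constructor <;> intro h <;> constructor <;> linarith [h.1, h.2]
          by_cases hs : s ∈ Icc (-1 : ℝ) 1
          · rw [indicator_of_mem hs, indicator_of_mem (this.2 hs), neg_neg]
          · rw [indicator_of_notMem hs, indicator_of_notMem (fun h => hs (this.1 h))]

namespace CollisionKernel

variable {P : ℕ} {M : GasMixture P} (Q : CollisionKernel M)

/-- The profile and the Jacobian factor combine to the integrand of `ρ_ij(q)`, with the constants of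
`c_ij(q)`. -/
lemma gainProfile_mul_jac (i j : Fin P) (p : ℝ) {z : ℝ × ℝ} (hz : z.1 ∈ Ioo (0 : ℝ) 1)
    (hz' : z.2 ∈ Ioo (0 : ℝ) 1) :
    Q.gainProfile i j p z * ((M.minRatio i j ^ 3 * (z.1 * (1 - z.2)))⁻¹) ^ (1 - 1 / p) =
      2 ^ (Q.γ i j / 2 * (1 - 1 / p)) * M.minRatio i j ^ (-((3 + Q.γ i j) * (1 - 1 / p))) *
        Q.rhoIntegrand i j p z := by
  have hs := M.minRatio_pos i j
  have hr := hz.1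
  have hR : 0 < 1 - z.2 := sub_pos.2 hz'.2
  unfold gainProfile rhoIntegrand
  set s := M.minRatio i j
  set θ := 1 - 1 / p
  set γ := Q.γ i j
  have e1 : (2 / (s ^ 2 * z.1)) ^ (γ / 2 * θ) =
      2 ^ (γ / 2 * θ) * s ^ (-(γ * θ)) * z.1 ^ (-(γ / 2 * θ)) := by
    rw [Real.div_rpow (by positivity) (by positivity), Real.mul_rpow (by positivity) hr.le,
      ← Real.rpow_natCast, ← Real.rpow_mul hs.le, Real.rpow_neg hs.le, Real.rpow_neg hr.le]
    have : ((2 : ℕ) : ℝ) * (γ / 2 * θ) = γ * θ := by push_cast; ring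
    rw [this]
    field_simp
  have e2 : ((s ^ 3 * (z.1 * (1 - z.2)))⁻¹) ^ θ =
      s ^ (-(3 * θ)) * z.1 ^ (-θ) * (1 - z.2) ^ (-θ) := by
    rw [Real.inv_rpow (by positivity), Real.mul_rpow (by positivity) (by positivity),
      Real.mul_rpow hr.le hR.le, ← Real.rpow_natCast, ← Real.rpow_mul hs.le, Real.rpow_neg hs.le,
      Real.rpow_neg hr.le, Real.rpow_neg hR.le]
    push_cast
    field_simp
  have e3 : s ^ (-((3 + γ) * θ)) = s ^ (-(γ * θ)) * s ^ (-(3 * θ)) := by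
    rw [← Real.rpow_add hs]; congr 1; ring
  have e4 : z.1 ^ (-((1 + γ / 2) * θ)) = z.1 ^ (-(γ / 2 * θ)) * z.1 ^ (-θ) := by
    rw [← Real.rpow_add hr]; congr 1; ring
  rw [e1, e2, e3, e4]
  ring

lemma rhoIntegrand_nonneg (i j : Fin P) (p : ℝ) {z : ℝ × ℝ} (hz : z.1 ∈ Ioo (0 : ℝ) 1)
    (hz' : z.2 ∈ Ioo (0 : ℝ) 1) : 0 ≤ Q.rhoIntegrand i j p z := by
  have hr := hz.1
  have hR : 0 < 1 - z.2 := sub_pos.2 hz'.2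
  have hb := Q.bub_nonneg i j _ hz _ hz'
  have hd := M.dWeight_nonneg i j (Ioo_subset_Icc_self hz) (Ioo_subset_Icc_self hz')
  unfold rhoIntegrand
  positivity

lemma rho_nonneg (i j : Fin P) (p : ℝ) : 0 ≤ Q.rho i j p :=
  integral_nonneg_of_ae (GasMixture.ae_exchangeMeasure.mono fun _ hz =>
    Q.rhoIntegrand_nonneg i j p hz.1 hz.2)

lemma cq_nonneg (i j : Fin P) (p : ℝ) : 0 ≤ Q.cq i j p := by
  have := M.minRatio_pos i j
  have := Q.rho_nonneg i j p
  unfold cq; positivity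

/-- A measurable representative of the `(r, R)` weight, whose mass is the constant `c_ij(q)`. -/
lemma exists_profile (i j : Fin P) {p : ℝ} (hp : 1 ≤ p) (hρ : Q.RhoFinite i j p) :
    ∃ Λ : ℝ × ℝ → ℝ≥0∞, Measurable Λ ∧
      (∀ᵐ z ∂exchangeMeasure, ENNReal.ofReal (Q.gainProfile i j p z) ≤ Λ z) ∧
      M.jacMass i j p Λ ≤ ENNReal.ofReal (Q.cq i j p) := by
  have hθ : 0 ≤ 1 - 1 / p := by rw [sub_nonneg, div_le_one (by linarith)]; exact hp
  have hs := M.minRatio_pos i j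
  have hm : AEMeasurable (fun z => ENNReal.ofReal (Q.gainProfile i j p z)) exchangeMeasure := by
    refine AEMeasurable.ennreal_ofReal ?_
    exact AEMeasurable.mul (by fun_prop) (Q.bub_integrable i j).aemeasurable
  refine ⟨hm.mk _, hm.measurable_mk, hm.ae_eq_mk.mono fun z hz => hz.le, le_of_eq ?_⟩
  have e : M.jacMass i j p (hm.mk _) = ∫⁻ z, ENNReal.ofReal
      (2 ^ (Q.γ i j / 2 * (1 - 1 / p)) * M.minRatio i j ^ (-((3 + Q.γ i j) * (1 - 1 / p))) *
        Q.rhoIntegrand i j p z) ∂exchangeMeasure := by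
    refine lintegral_congr_ae ?_
    filter_upwards [hm.ae_eq_mk, GasMixture.ae_exchangeMeasure] with z hz hzm
    have hr := hzm.1.1
    have hR : 0 < 1 - z.2 := sub_pos.2 hzm.2.2
    have hb := Q.bub_nonneg i j _ hzm.1 _ hzm.2
    have hd := M.dWeight_nonneg i j (Ioo_subset_Icc_self hzm.1) (Ioo_subset_Icc_self hzm.2)
    rw [← hz, ENNReal.ofReal_rpow_of_nonneg (by positivity) hθ, ← ENNReal.ofReal_mul (by
      unfold gainProfile; positivity), Q.gainProfile_mul_jac i j p hzm.1 hzm.2]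
  rw [e, ← ofReal_integral_eq_lintegral_ofReal (hρ.const_mul _), integral_const_mul, cq, rho]
  filter_upwards [GasMixture.ae_exchangeMeasure] with z hz
  have := Q.rhoIntegrand_nonneg i j p hz.1 hz.2
  simp only [Pi.zero_apply]
  positivity

end CollisionKernel

/-! ### The gain estimate for one ordered pair of species -/

/-- Young's inequality with a parameter `η`; both sides reduce to `A` when `p = 1`. -/
lemma rpow_mul_rpow_le_young {p η A x : ℝ} (hp : 1 ≤ p) (hη : 0 < η) (hA : 0 ≤ A) (hx : 0 ≤ x) :
    A ^ (1 / p) * x ^ (1 - 1 / p) ≤ 1 / p * η ^ (1 - p) * A + (1 - 1 / p) * (η * x) := by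
  have hp0 : 0 < p := by linarith
  have hθ : 0 ≤ 1 - 1 / p := by rw [sub_nonneg, div_le_one hp0]; exact hp
  have h := Real.geom_mean_le_arith_mean2_weighted (w₁ := 1 / p) (w₂ := 1 - 1 / p)
    (p₁ := η ^ (1 - p) * A) (p₂ := η * x) (by positivity) hθ (by positivity) (by positivity)
    (by ring)
  rw [Real.mul_rpow (by positivity) hA, Real.mul_rpow hη.le hx, ← Real.rpow_mul hη.le] at h
  have e : η ^ ((1 - p) * (1 / p)) * η ^ (1 - 1 / p) = 1 := by
    rw [← Real.rpow_add hη, show (1 - p) * (1 / p) + (1 - 1 / p) = 0 by field_simp; ring,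
      Real.rpow_zero]
  calc A ^ (1 / p) * x ^ (1 - 1 / p)
      = (η ^ ((1 - p) * (1 / p)) * η ^ (1 - 1 / p)) * (A ^ (1 / p) * x ^ (1 - 1 / p)) := by
        rw [e, one_mul]
    _ = η ^ ((1 - p) * (1 / p)) * A ^ (1 / p) * (η ^ (1 - 1 / p) * x ^ (1 - 1 / p)) := by ring
    _ ≤ _ := by rw [mul_assoc (1 / p)]; exact h

lemma rpow_mul_rpow_le_add {p y x : ℝ} (hp : 1 ≤ p) (hy : 0 ≤ y) (hx : 0 ≤ x) :
    y ^ (1 / p) * x ^ (1 - 1 / p) ≤ (1 - 1 / p) * x + y / p := by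
  have := rpow_mul_rpow_le_young hp zero_lt_one hy hx
  rw [Real.one_rpow, one_mul, mul_one] at this
  linarith [one_div_mul_eq_div p y]

lemma acutePart_add (β β' : ℝ → ℝ≥0∞) :
    acutePart (fun s => β s + β' s) = fun s => acutePart β s + acutePart β' s :=
  indicator_add _ β β'

lemma obtusePart_add (β β' : ℝ → ℝ≥0∞) :
    obtusePart (fun s => β s + β' s) = fun s => obtusePart β s + obtusePart β' s :=
  indicator_add _ β β'

namespace CollisionKernel

variable {P : ℕ} {M : GasMixture P} (Q : CollisionKernel M)

set_option maxHeartbeats 800000 in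
/-- The gain form for an angular part dominated by an `L¹` function `β` plus a constant `C`. The
constant part is treated by splitting, in each of the two trilinear forms, the density which
carries no `L^p` norm at the level `K ⟨·⟩^(-(k + γ + 6))`: the large part has small mass `llf`,
`llg`, and the small part has a finite `L^p` norm. -/
lemma lintegral_gain_le (i j : Fin P) {p k : ℝ} (hp : 1 ≤ p) (hk : 0 ≤ k)
    {f g : MolState → ℝ} (hf : Measurable f) (hg : Measurable g) (hf0 : ∀ x, 0 ≤ f x)
    (hg0 : ∀ x, 0 ≤ g x) (hfp : M.InLp i p (Q.γ i j / p + k) f)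
    (hgp : M.InLp j p (Q.γ i j / p + k) g) (hf1 : M.InLp i 1 (k + Q.γ i j + 1) f)
    (hg1 : M.InLp j 1 (k + Q.γ i j + 1) g) (hρ : Q.RhoFinite i j p)
    (hci : M.InLp i 1 (-6) fun _ => 1) (hcj : M.InLp j 1 (-6) fun _ => 1)
    {β : ℝ → ℝ≥0∞} (hβ : Measurable β) {C n₁ K η llf llg : ℝ} (hC : 0 ≤ C) (hn₁ : 0 ≤ n₁)
    (hbβ : ∀ᵐ s ∂(volume.restrict (Icc (-1 : ℝ) 1)),
      ENNReal.ofReal (Q.b i j s) ≤ β s + ENNReal.ofReal C)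
    (hβn : ENNReal.ofReal (2 * Real.pi) * ∫⁻ s in Icc (-1 : ℝ) 1, β s ≤ ENNReal.ofReal n₁)
    (hK : 0 ≤ K) (hη : 0 < η) (hllf : 0 ≤ llf) (hllg : 0 ≤ llg)
    (hlf : ∫⁻ x, M.wdens i (k + Q.γ i j) (M.largePart i K (k + Q.γ i j + 6) f) x ∂stateMeasure ≤
      ENNReal.ofReal llf)
    (hlg : ∫⁻ x, M.wdens j (k + Q.γ i j) (M.largePart j K (k + Q.γ i j + 6) g) x ∂stateMeasure ≤
      ENNReal.ofReal llg) :
    ∫⁻ x, Q.gain i j f g x * ENNReal.ofReal (f x ^ (p - 1) * M.bracket i x ^ (k * p))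
        ∂stateMeasure ≤
      ENNReal.ofReal (n₁ * Q.cq i j p *
        (M.norm j 1 (k + Q.γ i j) g * M.norm i p (Q.γ i j / p + k) f ^ p +
          M.norm i 1 (k + Q.γ i j) f * ((1 - 1 / p) * M.norm i p (Q.γ i j / p + k) f ^ p +
            M.norm j p (Q.γ i j / p + k) g ^ p / p)) +
        4 * Real.pi * C * Q.cq i j p *
          (llg * M.norm i p (Q.γ i j / p + k) f ^ p +
            llf * ((1 - 1 / p) * M.norm i p (Q.γ i j / p + k) f ^ p +
              M.norm j p (Q.γ i j / p + k) g ^ p / p) +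
            1 / p * η ^ (1 - p) * K ^ p *
              (cHat M j * M.norm i 1 (Q.γ i j / p + k) f ^ p +
                cHat M i * M.norm j 1 (Q.γ i j / p + k) g ^ p) +
            2 * ((1 - 1 / p) * (η * M.norm i p (Q.γ i j / p + k) f ^ p)))) := by
  have hp0 : 0 < p := by linarith
  have hθ : 0 ≤ 1 - 1 / p := by rw [sub_nonneg, div_le_one hp0]; exact hp
  have hγ := (Q.γ_mem i j).1
  have hc := Q.cq_nonneg i j p
  obtain ⟨Λ, hΛ, hΛ', hJ⟩ := Q.exists_profile i j hp hρ
  set γ := Q.γ i j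
  set c := Q.cq i j p
  have hγp : γ / p ≤ γ := div_le_self hγ hp
  have hf1' := hf1.mono (s := k + γ) (by linarith) hf hf0
  have hg1' := hg1.mono (s := k + γ) (by linarith) hg hg0
  have hf1'' := hf1.mono (s := γ / p + k) (by linarith) hf hf0
  have hg1'' := hg1.mono (s := γ / p + k) (by linarith) hg hg0
  have ex := GasMixture.lintegral_wdens_rpow hp hf0 hfp
  have ey := GasMixture.lintegral_wdens_rpow hp hg0 hgp
  have elf := GasMixture.lintegral_wdens hf0 hf1'
  have elg := GasMixture.lintegral_wdens hg0 hg1'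
  have elf' := GasMixture.lintegral_wdens hf0 hf1''
  have elg' := GasMixture.lintegral_wdens hg0 hg1''
  have esf := GasMixture.lintegral_smallPart_le i (s := k + γ) hK hp f hci
  have esg := GasMixture.lintegral_smallPart_le j (s := k + γ) hK hp g hcj
  have hx0 : 0 ≤ M.norm i p (γ / p + k) f ^ p := Real.rpow_nonneg (GasMixture.norm_nonneg ..) p
  have hy0 : 0 ≤ M.norm j p (γ / p + k) g ^ p := Real.rpow_nonneg (GasMixture.norm_nonneg ..) p
  have hlf0 : 0 ≤ M.norm i 1 (k + γ) f := GasMixture.norm_nonneg ..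
  have hlg0 : 0 ≤ M.norm j 1 (k + γ) g := GasMixture.norm_nonneg ..
  have hlf'0 : 0 ≤ M.norm i 1 (γ / p + k) f := GasMixture.norm_nonneg ..
  have hlg'0 : 0 ≤ M.norm j 1 (γ / p + k) g := GasMixture.norm_nonneg ..
  have hci0 : 0 ≤ cHat M i := GasMixture.norm_nonneg ..
  have hcj0 : 0 ≤ cHat M j := GasMixture.norm_nonneg ..
  change _ ≤ ENNReal.ofReal (K ^ p * cHat M i) at esf
  change _ ≤ ENNReal.ofReal (K ^ p * cHat M j) at esg
  have hmx : Measurable fun x => M.wdens i (γ / p + k) f x ^ p :=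
    (M.measurable_wdens i _ hf).pow_const p
  have mf := M.measurable_wdens i (γ / p + k) hf
  have mg := M.measurable_wdens j (γ / p + k) hg
  have mf' := M.measurable_wdens i (k + γ) hf
  have mg' := M.measurable_wdens j (k + γ) hg
  have mLf := M.measurable_wdens i (k + γ)
    (GasMixture.measurable_largePart (M := M) i K (k + γ + 6) hf)
  have mLg := M.measurable_wdens j (k + γ)
    (GasMixture.measurable_largePart (M := M) j K (k + γ + 6) hg)
  have mSf := M.measurable_wdens i (k + γ)
    (GasMixture.measurable_smallPart (M := M) i K (k + γ + 6) hf)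
  have mSg := M.measurable_wdens j (k + γ)
    (GasMixture.measurable_smallPart (M := M) j K (k + γ + 6) hg)
  have mC : Measurable fun _ : ℝ => ENNReal.ofReal C := measurable_const
  have ma := measurable_acutePart hβ
  have mo := measurable_obtusePart hβ
  have maC := measurable_acutePart mC
  have moC := measurable_obtusePart mC
  set Ff := M.wdens i (γ / p + k) f
  set Gg := M.wdens j (γ / p + k) g
  set Lf := M.wdens i (k + γ) (M.largePart i K (k + γ + 6) f)
  set Lg := M.wdens j (k + γ) (M.largePart j K (k + γ + 6) g)
  set Sf := M.wdens i (k + γ) (M.smallPart i K (k + γ + 6) f)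
  set Sg := M.wdens j (k + γ) (M.smallPart j K (k + γ + 6) g)
  set x := M.norm i p (γ / p + k) f ^ p
  set y := M.norm j p (γ / p + k) g ^ p
  set lf := M.norm i 1 (k + γ) f
  set lg := M.norm j 1 (k + γ) g
  set lf' := M.norm i 1 (γ / p + k) f
  set lg' := M.norm j 1 (γ / p + k) g
  have hsplit := Q.lintegral_gain_le_tri i j hp hk hf hg hf0 hg0
    (β := fun s => β s + ENNReal.ofReal C) (hβ.add_const _) hbβ hΛ hΛ'
  rw [acutePart_add, obtusePart_add, GasMixture.tri_add_angular i j p ma hΛ mf mg' hmx,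
    GasMixture.tri_add_angular i j p mo hΛ mf' mg hmx] at hsplit
  have e1 : M.tri i j p (acutePart fun _ => ENNReal.ofReal C) Λ Ff (M.wdens j (k + γ) g)
      (fun x => Ff x ^ p) = M.tri i j p (acutePart fun _ => ENNReal.ofReal C) Λ Ff Lg
        (fun x => Ff x ^ p) + M.tri i j p (acutePart fun _ => ENNReal.ofReal C) Λ Ff Sg
        (fun x => Ff x ^ p) := by
    rw [GasMixture.wdens_eq_large_add_small j K (k + γ + 6) (k + γ) g]
    exact GasMixture.tri_add_right i j p maC hΛ mf mLg hmx
  have e2 : M.tri i j p (obtusePart fun _ => ENNReal.ofReal C) Λ (M.wdens i (k + γ) f) Gg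
      (fun x => Ff x ^ p) = M.tri i j p (obtusePart fun _ => ENNReal.ofReal C) Λ Lf Gg
        (fun x => Ff x ^ p) + M.tri i j p (obtusePart fun _ => ENNReal.ofReal C) Λ Sf Gg
        (fun x => Ff x ^ p) := by
    rw [GasMixture.wdens_eq_large_add_small i K (k + γ + 6) (k + γ) f]
    exact GasMixture.tri_add_left i j p moC hΛ mLf mg hmx
  rw [e1, e2] at hsplit
  have hNC : 0 ≤ 4 * Real.pi * C := by positivity
  have haC : AngBound (acutePart fun _ => ENNReal.ofReal C) (ENNReal.ofReal (4 * Real.pi * C)) := by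
    rw [ENNReal.ofReal_mul (by positivity)]
    exact AngBound.of_le_const fun s => indicator_le_self _ _ s
  have haC' : AngBound (fun s => acutePart (fun _ => ENNReal.ofReal C) (-s))
      (ENNReal.ofReal (4 * Real.pi * C)) := by
    rw [ENNReal.ofReal_mul (by positivity)]
    exact AngBound.of_le_const fun s => indicator_le_self (Ioi 0) (fun _ => ENNReal.ofReal C) (-s)
  have hoC : AngBound (obtusePart fun _ => ENNReal.ofReal C) (ENNReal.ofReal (4 * Real.pi * C)) := by
    rw [ENNReal.ofReal_mul (by positivity)]
    exact AngBound.of_le_const fun s => indicator_le_self _ _ s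
  have hoC' : AngBound (fun s => obtusePart (fun _ => ENNReal.ofReal C) (-s))
      (ENNReal.ofReal (4 * Real.pi * C)) := by
    rw [ENNReal.ofReal_mul (by positivity)]
    exact AngBound.of_le_const fun s => indicator_le_self (Iio 0) (fun _ => ENNReal.ofReal C) (-s)
  -- In `b1`, `b2` the molecule that moves is dictated by the sign of `û · σ`. The constant angular
  -- weight leaves the choice free: `b3`, `b5` keep the density of the large part fixed, while in
  -- `b4`, `b6` the small part takes the `L^p` norm and the other density is kept fixed.
  have b1 := GasMixture.tri_le_right_real i j hp ma hΛ mf mg' hmx hn₁ hc hx0 hx0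
    ((angBound_acutePart hβ).mono hβn) hJ ex.le ex.le elg.le
  have b2 := GasMixture.tri_le_left_real i j hp mo hΛ mf' mg hmx hn₁ hc hy0 hx0
    ((angBound_obtusePart hβ).mono hβn) hJ ey.le ex.le elf.le
  have b3 := GasMixture.tri_le_right_real i j hp maC hΛ mf mLg hmx hNC hc hx0 hx0
    haC hJ ex.le ex.le hlg
  have b4 := GasMixture.tri_le_left_real i j hp maC hΛ mf mSg hmx hNC hc
    (by positivity) hx0 haC' hJ esg ex.le elf'.le
  have b5 := GasMixture.tri_le_left_real i j hp moC hΛ mLf mg hmx hNC hc hy0 hx0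
    hoC' hJ ey.le ex.le hlf
  have b6 := GasMixture.tri_le_right_real i j hp moC hΛ mSf mg hmx hNC hc
    (by positivity) hx0 hoC hJ esf ex.le elg'.le
  clear_value x y lf lg lf' lg' c
  refine hsplit.trans ((add_le_add (add_le_add b1 (add_le_add b3 b4))
    (add_le_add b2 (add_le_add b5 b6))).trans ?_)
  have hxx : x ^ (1 / p) * x ^ (1 - 1 / p) ≤ x := by
    refine (rpow_mul_rpow_le_add hp hx0 hx0).trans_eq ?_
    field_simp; ring
  have hyx := rpow_mul_rpow_le_add hp hy0 hx0
  have key : ∀ d l : ℝ, 0 ≤ d → 0 ≤ l → (K ^ p * d) ^ (1 / p) * x ^ (1 - 1 / p) * l ≤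
      1 / p * η ^ (1 - p) * K ^ p * (d * l ^ p) + (1 - 1 / p) * (η * x) := by
    intro d l hd hl
    have h := rpow_mul_rpow_le_young hp hη (A := K ^ p * d * l ^ p) (by positivity) hx0
    rw [Real.mul_rpow (by positivity) (by positivity), ← Real.rpow_mul hl,
      mul_one_div_cancel hp0.ne', Real.rpow_one] at h
    calc _ = (K ^ p * d) ^ (1 / p) * l * x ^ (1 - 1 / p) := by ring
      _ ≤ _ := h
      _ = _ := by ring
  have k4 := key _ _ hcj0 hlf'0
  have k6 := key _ _ hci0 hlg'0
  have hcC : 0 ≤ 4 * Real.pi * C * c := by positivity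
  have hcn : 0 ≤ n₁ * c := by positivity
  have p1 : 0 ≤ x ^ (1 / p) * x ^ (1 - 1 / p) := by positivity
  have p2 : 0 ≤ y ^ (1 / p) * x ^ (1 - 1 / p) := by positivity
  have p3 : 0 ≤ (K ^ p * cHat M j) ^ (1 / p) * x ^ (1 - 1 / p) := by positivity
  have p4 : 0 ≤ (K ^ p * cHat M i) ^ (1 / p) * x ^ (1 - 1 / p) := by positivity
  rw [← ENNReal.ofReal_add (by positivity) (by positivity),
    ← ENNReal.ofReal_add (by positivity) (by positivity),
    ← ENNReal.ofReal_add (by positivity) (by positivity),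
    ← ENNReal.ofReal_add (by positivity) (by positivity),
    ← ENNReal.ofReal_add (by positivity) (by positivity)]
  refine ENNReal.ofReal_le_ofReal ?_
  have q1 := mul_le_mul_of_nonneg_left (mul_le_mul_of_nonneg_right hxx hlg0) hcn
  have q2 := mul_le_mul_of_nonneg_left (mul_le_mul_of_nonneg_right hyx hlf0) hcn
  have q3 := mul_le_mul_of_nonneg_left (mul_le_mul_of_nonneg_right hxx hllg) hcC
  have q4 := mul_le_mul_of_nonneg_left k4 hcC
  have q5 := mul_le_mul_of_nonneg_left (mul_le_mul_of_nonneg_right hyx hllf) hcC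
  have q6 := mul_le_mul_of_nonneg_left k6 hcC
  refine le_of_eq_of_le ?_ ((add_le_add (add_le_add q1 (add_le_add q3 q4))
    (add_le_add q2 (add_le_add q5 q6))).trans_eq ?_)
  · ring
  · ring

end CollisionKernel

/-! ### Entropy bound for the large part of a density -/

lemma log_le_half_rpow {b m : ℝ} (hb : 1 ≤ b) (hm : 1 ≤ m) : Real.log b ≤ b ^ m / 2 := by
  have h0 : 0 < b := by linarith
  have h1 := Real.log_le_sub_one_of_pos (x := b / 2) (by positivity)
  rw [Real.log_div h0.ne' two_ne_zero] at h1
  have h2 := Real.log_two_lt_d9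
  have h3 := Real.rpow_le_rpow_of_exponent_le hb hm
  rw [Real.rpow_one] at h3
  linarith

lemma entropyH_nonneg {f : MolState → ℝ} (hf0 : ∀ x, 0 ≤ f x) : 0 ≤ entropyH f :=
  integral_nonneg fun x => mul_nonneg (hf0 x) (abs_nonneg _)

lemma lintegral_entropy {f : MolState → ℝ} (hf0 : ∀ x, 0 ≤ f x) (hf : FiniteEntropy f) :
    ∫⁻ x, ENNReal.ofReal (f x * |Real.log (f x)|) ∂stateMeasure = ENNReal.ofReal (entropyH f) :=
  (ofReal_integral_eq_lintegral_ofReal hf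
    (ae_of_all _ fun x => mul_nonneg (hf0 x) (abs_nonneg _))).symm

namespace GasMixture

variable {P : ℕ} {M : GasMixture P}

/-- Above the level `exp(L^n) ⟨·⟩^(-(s + 6))` one has `L^n ≤ |log g| + (s + 6) log ⟨·⟩`. -/
lemma largePart_le (l : Fin P) {s L : ℝ} (hs : 0 ≤ s) (hL : 0 < L) {g : MolState → ℝ}
    (hg0 : ∀ x, 0 ≤ g x) {x : MolState} (hx : 0 ≤ x.2) :
    M.largePart l (Real.exp (L ^ (s + 1))) (s + 6) g x ≤
      (L ^ (s + 1))⁻¹ * (g x * |Real.log (g x)| +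
        (s + 6) / 2 * (g x * M.bracket l x ^ min 2 (s + 1))) := by
  have hb := M.one_le_bracket l hx
  have hb0 : 0 < M.bracket l x := by linarith
  have hL' : 0 < L ^ (s + 1) := by positivity
  have hg := hg0 x
  by_cases hA : x ∈ {x | Real.exp (L ^ (s + 1)) * M.bracket l x ^ (-(s + 6)) < g x}
  · rw [largePart, indicator_of_mem hA]
    have h1 := Real.log_lt_log (by positivity) hA
    rw [Real.log_mul (by positivity) (by positivity), Real.log_exp, Real.log_rpow hb0] at h1
    have h2 := log_le_half_rpow hb (m := min 2 (s + 1)) (le_min (by norm_num) (by linarith))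
    have h3 := le_abs_self (Real.log (g x))
    have h4 : L ^ (s + 1) ≤ |Real.log (g x)| + (s + 6) / 2 * M.bracket l x ^ min 2 (s + 1) := by
      nlinarith
    rw [le_inv_mul_iff₀ hL']
    nlinarith
  · rw [largePart, indicator_of_notMem hA]
    positivity

/-- Entropy bound for the mass of the large part: interpolate between the moment of order `s + 1`
and the mass, which the entropy controls. -/
lemma lintegral_largePart_le (l : Fin P) {k γ L : ℝ} (hk : 0 ≤ k) (hγ : 0 ≤ γ) (hL : 0 < L)
    {g : MolState → ℝ} (hg : Measurable g) (hg0 : ∀ x, 0 ≤ g x)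
    (hg1 : M.InLp l 1 (k + γ + 1) g) (hH : FiniteEntropy g) :
    ∫⁻ x, M.wdens l (k + γ) (M.largePart l (Real.exp (L ^ (k + γ + 1))) (k + γ + 6) g) x
        ∂stateMeasure ≤
      ENNReal.ofReal (CollisionKernel.entropyConst M l k γ g / L) := by
  have hs : 0 ≤ k + γ := by positivity
  unfold CollisionKernel.entropyConst
  set s := k + γ
  set n := s + 1 with hn
  have hn0 : 0 < n := by positivity
  have hL' : 0 < L ^ n := by positivity
  set lp := M.largePart l (Real.exp (L ^ n)) (s + 6) g with hlp
  have hlpm : Measurable lp := measurable_largePart l _ _ hg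
  have hmin := hg1.mono (s := min 2 n) (min_le_right _ _) hg hg0
  have hlp0 : ∀ x, 0 ≤ lp x := fun x => indicator_nonneg (fun x _ => hg0 x) x
  have hH0 := entropyH_nonneg hg0
  have hN0 := norm_nonneg (M := M) l 1 n g
  have hNm0 := norm_nonneg (M := M) l 1 (min 2 n) g
  have hmass : ∫⁻ x, ENNReal.ofReal (lp x) ∂stateMeasure ≤
      ENNReal.ofReal ((L ^ n)⁻¹ * (entropyH g + (s + 6) / 2 * M.norm l 1 (min 2 n) g)) := by
    have hmg : Measurable fun x => ENNReal.ofReal (g x * |Real.log (g x)|) := by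
      have := Real.measurable_log.comp hg
      exact (hg.mul (this.abs)).ennreal_ofReal
    calc ∫⁻ x, ENNReal.ofReal (lp x) ∂stateMeasure
        ≤ ∫⁻ x, ENNReal.ofReal (L ^ n)⁻¹ * (ENNReal.ofReal (g x * |Real.log (g x)|) +
            ENNReal.ofReal ((s + 6) / 2) * M.wdens l (min 2 n) g x) ∂stateMeasure := by
          refine lintegral_mono_ae (ae_stateMeasure_pos.mono fun x hx => ?_)
          have hb := M.bracket_rpow_nonneg l (min 2 n) x
          have hgx := hg0 x
          rw [wdens, ← ENNReal.ofReal_mul (by positivity), ← ENNReal.ofReal_add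
            (mul_nonneg hgx (abs_nonneg _)) (by positivity), ← ENNReal.ofReal_mul (by positivity)]
          exact ENNReal.ofReal_le_ofReal (largePart_le l hs hL hg0 hx.le)
      _ = _ := by
          rw [lintegral_const_mul' _ _ ENNReal.ofReal_ne_top, lintegral_add_left hmg,
            lintegral_const_mul' _ _ ENNReal.ofReal_ne_top, lintegral_entropy hg0 hH,
            lintegral_wdens hg0 hmin, ← ENNReal.ofReal_mul (by positivity),
            ← ENNReal.ofReal_add hH0 (by positivity), ← ENNReal.ofReal_mul (by positivity)]
  have hpt : ∀ᵐ x ∂stateMeasure, M.wdens l s lp x ≤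
      M.wdens l n g x ^ (s / n) * ENNReal.ofReal (lp x) ^ (1 / n) := by
    refine ae_stateMeasure_pos.mono fun x hx => ?_
    have hb0 : 0 < M.bracket l x := by linarith [M.one_le_bracket l hx.le]
    have hgx := hg0 x
    have hle : lp x ≤ g x := indicator_le_self' (fun _ _ => hgx) x
    rw [wdens, wdens, ENNReal.ofReal_rpow_of_nonneg (by positivity) (by positivity),
      ENNReal.ofReal_rpow_of_nonneg (hlp0 x) (by positivity), ← ENNReal.ofReal_mul (by positivity)]
    refine ENNReal.ofReal_le_ofReal ?_
    calc lp x * M.bracket l x ^ s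
        = lp x ^ (s / n) * lp x ^ (1 / n) * M.bracket l x ^ s := by
          rw [← Real.rpow_add' (hlp0 x), ← add_div, div_self hn0.ne', Real.rpow_one]
          rw [← add_div, div_self hn0.ne']; exact one_ne_zero
      _ ≤ g x ^ (s / n) * lp x ^ (1 / n) * M.bracket l x ^ s := by
          have := hlp0 x
          gcongr
      _ = _ := by
          rw [Real.mul_rpow hgx (by positivity), ← Real.rpow_mul hb0.le, mul_div_cancel₀ s hn0.ne']
          ring
  have hhol := ENNReal.lintegral_mul_norm_pow_le (μ := stateMeasure)
    (f := M.wdens l n g) (g := fun x => ENNReal.ofReal (lp x))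
    (M.measurable_wdens l n hg).aemeasurable hlpm.ennreal_ofReal.aemeasurable
    (p := s / n) (q := 1 / n) (by positivity) (by positivity)
    (by rw [← add_div, div_self hn0.ne'])
  refine (lintegral_mono_ae hpt).trans (hhol.trans ?_)
  rw [lintegral_wdens hg0 hg1, ENNReal.ofReal_rpow_of_nonneg hN0 (by positivity), mul_div_assoc,
    ENNReal.ofReal_mul (by positivity)]
  refine mul_le_mul_right ((ENNReal.rpow_le_rpow hmass (by positivity)).trans_eq ?_) _
  rw [ENNReal.ofReal_rpow_of_nonneg (by positivity) (by positivity),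
    Real.mul_rpow (by positivity) (by positivity), Real.inv_rpow (by positivity),
    ← Real.rpow_mul hL.le, mul_one_div_cancel hn0.ne', Real.rpow_one]
  congr 1
  ring

end GasMixture

/-! ### Finiteness of the constants and volumes of energy balls -/

namespace GasMixture

variable {P : ℕ} (M : GasMixture P)

/-- `ĉ_l < ∞`: since `1 + a + b` dominates both `1 + a` and `1 + b`, one has
`⟨v, I⟩^(-6) ≤ (1 + A |v|²)^(-9/5) (1 + B I)^(-6/5)`, and both factors are integrable. -/
lemma inLp_one_neg_six (l : Fin P) : M.InLp l 1 (-6) fun _ => 1 := by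
  have hm := M.m_pos l
  have ht := M.totalMass_pos l
  set A := M.m l / (2 * M.totalMass)
  have hA : 0 < A := by positivity
  have h1 : Integrable (fun v : Vel => (1 + ‖√A • v‖ ^ 2) ^ (-(18 / 5 : ℝ) / 2)) := by
    refine (integrable_rpow_neg_one_add_norm_sq (E := Vel) ?_).comp_smul
      (Real.sqrt_pos.2 hA).ne'
    simp; norm_num
  have h2 : Integrable (fun I : ℝ => (1 + ‖M.totalMass⁻¹ * I‖) ^ (-(6 / 5 : ℝ)))
      (volume.restrict (Ici 0)) := by
    refine Integrable.restrict ?_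
    refine (integrable_one_add_norm (E := ℝ) (r := 6 / 5) ?_).comp_mul_left' (by positivity)
    simp; norm_num
  have h3 := h1.mul_prod h2
  have hb := M.measurable_bracket l
  rw [InLp, ENNReal.ofReal_one, memLp_one_iff_integrable]
  refine Integrable.mono' h3
    (measurable_const.mul (hb.pow_const _)).aestronglyMeasurable (ae_stateMeasure_pos.mono fun x hx => ?_)
  rw [one_mul, Real.norm_of_nonneg (M.bracket_rpow_nonneg l _ x)]
  have e1 : ‖√A • x.1‖ ^ 2 = A * ‖x.1‖ ^ 2 := by
    rw [norm_smul, mul_pow, Real.norm_of_nonneg (Real.sqrt_nonneg _), Real.sq_sqrt hA.le]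
  have e2 : ‖M.totalMass⁻¹ * x.2‖ = x.2 / M.totalMass := by
    rw [Real.norm_of_nonneg (by positivity)]; ring
  rw [e1, e2]
  have hp1 : 0 ≤ A * ‖x.1‖ ^ 2 := by positivity
  have hp2 : 0 ≤ x.2 / M.totalMass := by positivity
  unfold bracket
  change √(1 + A * ‖x.1‖ ^ 2 + x.2 / M.totalMass) ^ (-6 : ℝ) ≤ _
  set S := 1 + A * ‖x.1‖ ^ 2 + x.2 / M.totalMass with hS
  have hS0 : 0 < S := by positivity
  rw [Real.sqrt_eq_rpow, ← Real.rpow_mul hS0.le,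
    show (1 / 2 * (-6) : ℝ) = -(18 / 5 : ℝ) / 2 + -(6 / 5 : ℝ) by norm_num, Real.rpow_add hS0]
  refine mul_le_mul ?_ ?_ (by positivity) (by positivity)
  · exact Real.rpow_le_rpow_of_nonpos (by positivity) (by linarith) (by norm_num)
  · exact Real.rpow_le_rpow_of_nonpos (by positivity) (by linarith) (by norm_num)

/-- The region of relative energy at most `c² 𝗆`. -/
def relBall (i j : Fin P) (c : ℝ) : Set MolState :=
  {y | M.redMass i j / (2 * M.totalMass) * ‖y.1‖ ^ 2 + y.2 / M.totalMass ≤ c ^ 2}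

lemma measurableSet_relBall (i j : Fin P) (c : ℝ) : MeasurableSet (M.relBall i j c) :=
  measurableSet_le (by fun_prop) (by fun_prop)

/-- The dilation `(w, J) ↦ (c w, c² J)` multiplies the volume by `c³ c² = c⁵`. -/
lemma stateMeasure_relBall (i j : Fin P) {c : ℝ} (hc : 0 < c) :
    stateMeasure (M.relBall i j c) = ENNReal.ofReal (c ^ 5) * stateMeasure (M.relBall i j 1) := by
  set h : MolState → ℝ≥0∞ := (M.relBall i j c).indicator 1
  set h' : MolState → ℝ≥0∞ := (M.relBall i j 1).indicator 1
  have hm : Measurable h := measurable_one.indicator (M.measurableSet_relBall i j c)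
  have hm' : Measurable h' := measurable_one.indicator (M.measurableSet_relBall i j 1)
  have hh : ∀ v I, h' (v, I) = h (c • v, c ^ 2 * I) := by
    intro v I
    have : (v, I) ∈ M.relBall i j 1 ↔ (c • v, c ^ 2 * I) ∈ M.relBall i j c := by
      simp only [relBall, mem_ofPred_eq, norm_smul, Real.norm_of_nonneg hc.le, one_pow]
      rw [show M.redMass i j / (2 * M.totalMass) * (c * ‖v‖) ^ 2 + c ^ 2 * I / M.totalMass =
        c ^ 2 * (M.redMass i j / (2 * M.totalMass) * ‖v‖ ^ 2 + I / M.totalMass) by ring]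
      constructor
      · intro h; nlinarith [sq_nonneg c]
      · intro h; exact le_of_mul_le_mul_left (by linarith) (pow_pos hc 2)
    by_cases hx : (v, I) ∈ M.relBall i j 1
    · simp only [h, h', indicator_of_mem hx, indicator_of_mem (this.1 hx), Pi.one_apply]
    · simp only [h, h', indicator_of_notMem hx, indicator_of_notMem (fun hn => hx (this.2 hn))]
  rw [← lintegral_indicator_one (M.measurableSet_relBall i j c),
    ← lintegral_indicator_one (M.measurableSet_relBall i j 1)]
  change ∫⁻ x, h x ∂stateMeasure = _ * ∫⁻ x, h' x ∂stateMeasure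
  rw [lintegral_stateMeasure h hm, lintegral_stateMeasure h' hm']
  have e1 : ∀ v : Vel, ∫⁻ I in Ioi (0 : ℝ), h' (v, I) =
      ENNReal.ofReal (c ^ 2)⁻¹ * ∫⁻ I in Ioi (0 : ℝ), h (c • v, I) := by
    intro v
    simp_rw [hh]
    exact lintegral_Ioi_comp_mul (fun I => h (c • v, I)) (pow_pos hc 2)
  simp_rw [e1]
  rw [lintegral_const_mul' _ _ ENNReal.ofReal_ne_top]
  have hm2 : Measurable fun v : Vel => ∫⁻ I in Ioi (0 : ℝ), h (v, I) :=
    Measurable.lintegral_prod_right' (f := h) hm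
  rw [lintegral_comp_smul_Vel (fun v => ∫⁻ I in Ioi (0 : ℝ), h (v, I)) hm2 hc,
    ← mul_assoc, ← mul_assoc, ← ENNReal.ofReal_mul (by positivity),
    ← ENNReal.ofReal_mul (by positivity),
    show c ^ 5 * (c ^ 2)⁻¹ * (c ^ 3)⁻¹ = 1 by field_simp, ENNReal.ofReal_one, one_mul]

lemma unitBallVol_eq (i j : Fin P) :
    CollisionKernel.unitBallVol M i j = (stateMeasure (M.relBall i j 1)).toReal := by
  simp only [CollisionKernel.unitBallVol, relBall, one_pow]

lemma stateMeasure_relBall_one_lt_top (i j : Fin P) : stateMeasure (M.relBall i j 1) < ⊤ := by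
  have hμ := M.redMass_pos i j
  have ht := M.totalMass_pos i
  set a := M.redMass i j / (2 * M.totalMass)
  have ha : 0 < a := by positivity
  have hsub : M.relBall i j 1 ≤ᵐ[stateMeasure]
      (Metric.closedBall (0 : Vel) √a⁻¹ ×ˢ Iic M.totalMass : Set MolState) := by
    refine ae_stateMeasure_pos.mono fun y hy hyb => ?_
    have hyb : a * ‖y.1‖ ^ 2 + y.2 / M.totalMass ≤ 1 ^ 2 := hyb
    have h1 : 0 ≤ a * ‖y.1‖ ^ 2 := by positivity
    have h2 : 0 ≤ y.2 / M.totalMass := by positivity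
    refine ⟨?_, ?_⟩
    · rw [mem_closedBall_zero_iff]
      refine Real.le_sqrt_of_sq_le ?_
      rw [← one_div, le_div_iff₀ ha]; nlinarith
    · have : y.2 / M.totalMass ≤ 1 := by linarith
      exact (div_le_one ht).1 this
  refine (measure_mono_ae hsub).trans_lt ?_
  rw [stateMeasure, Measure.prod_prod]
  refine ENNReal.mul_lt_top measure_closedBall_lt_top ?_
  rw [Measure.restrict_apply measurableSet_Iic, inter_comm, Ici_inter_Iic, Real.volume_Icc]
  exact ENNReal.ofReal_lt_top

lemma unitBallVol_pos (i j : Fin P) : 0 < CollisionKernel.unitBallVol M i j := by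
  have hμ := M.redMass_pos i j
  have ht := M.totalMass_pos i
  rw [unitBallVol_eq]
  refine ENNReal.toReal_pos (ne_of_gt ?_) (M.stateMeasure_relBall_one_lt_top i j).ne
  set a := M.redMass i j / (2 * M.totalMass)
  have ha : 0 < a := by positivity
  have hsub : (Metric.ball (0 : Vel) √(2 * a)⁻¹ ×ˢ Iic (M.totalMass / 2) : Set MolState) ⊆
      M.relBall i j 1 := by
    rintro y ⟨h1, h2⟩
    rw [mem_ball_zero_iff, Real.lt_sqrt (_root_.norm_nonneg y.1), ← one_div, lt_div_iff₀ (by positivity)]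
      at h1
    have h2 : y.2 ≤ M.totalMass / 2 := h2
    have h3 : y.2 / M.totalMass ≤ 1 / 2 := by rw [div_le_iff₀ ht]; linarith
    change a * ‖y.1‖ ^ 2 + y.2 / M.totalMass ≤ 1 ^ 2
    nlinarith
  refine lt_of_lt_of_le ?_ (measure_mono hsub)
  rw [stateMeasure, Measure.prod_prod]
  refine ENNReal.mul_pos (Metric.measure_ball_pos _ _ (by positivity)).ne' ?_
  rw [Measure.restrict_apply measurableSet_Iic, inter_comm, Ici_inter_Iic, Real.volume_Icc]
  simpa using ht

end GasMixture

/-! ### Concentration of densities at small relative energy -/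

namespace GasMixture

variable {P : ℕ} {M : GasMixture P}

lemma integrable_weighted {i : Fin P} {s : ℝ} {f : MolState → ℝ} (hf : M.InLp i 1 s f) :
    Integrable (fun x => f x * M.bracket i x ^ s) stateMeasure := by
  rwa [InLp, ENNReal.ofReal_one, memLp_one_iff_integrable] at hf

lemma norm_one_eq_integral {i : Fin P} {s : ℝ} {f : MolState → ℝ} (hf0 : ∀ x, 0 ≤ f x)
    (hf : M.InLp i 1 s f) : M.norm i 1 s f = ∫ x, f x * M.bracket i x ^ s ∂stateMeasure := by
  have h := lintegral_wdens hf0 hf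
  have h0 : 0 ≤ ∫ x, f x * M.bracket i x ^ s ∂stateMeasure :=
    integral_nonneg fun x => mul_nonneg (hf0 x) (M.bracket_rpow_nonneg i s x)
  unfold wdens at h
  rw [← ofReal_integral_eq_lintegral_ofReal (integrable_weighted hf)
    (ae_of_all _ fun x => mul_nonneg (hf0 x) (M.bracket_rpow_nonneg i s x))] at h
  exact ((ENNReal.ofReal_eq_ofReal_iff h0 (norm_nonneg _ _ _ _)).1 h).symm

/-- The set of partners at small relative energy is contained in a translate of a `relBall`. -/
lemma stateMeasure_energy_le (i j : Fin P) {c : ℝ} (hc : 0 < c) {x : MolState} (hx : 0 ≤ x.2) :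
    stateMeasure {y | M.energy i j x y / M.totalMass ≤ c ^ 2} ≤
      ENNReal.ofReal (c ^ 5 * CollisionKernel.unitBallVol M i j) := by
  have ht := M.totalMass_pos i
  rw [ENNReal.ofReal_mul (by positivity), unitBallVol_eq,
    ENNReal.ofReal_toReal (M.stateMeasure_relBall_one_lt_top i j).ne, ← stateMeasure_relBall M i j hc]
  set h : MolState → ℝ≥0∞ := (M.relBall i j c).indicator 1
  have hm : Measurable h := measurable_one.indicator (M.measurableSet_relBall i j c)
  have hsub : {y | M.energy i j x y / M.totalMass ≤ c ^ 2} ⊆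
      (fun y : MolState => (x.1 - y.1, y.2)) ⁻¹' M.relBall i j c := by
    intro y hy
    have hy : M.energy i j x y / M.totalMass ≤ c ^ 2 := hy
    refine le_trans ?_ hy
    change M.redMass i j / (2 * M.totalMass) * ‖x.1 - y.1‖ ^ 2 + y.2 / M.totalMass ≤ _
    rw [energy, add_div, add_div]
    have : 0 ≤ x.2 / M.totalMass := by positivity
    have e : M.redMass i j / (2 * M.totalMass) * ‖x.1 - y.1‖ ^ 2 =
      M.redMass i j / 2 * ‖x.1 - y.1‖ ^ 2 / M.totalMass := by field_simp
    linarith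
  refine (measure_mono hsub).trans_eq ?_
  have hmap : Measurable fun y : MolState => ((x.1 - y.1, y.2) : MolState) := by fun_prop
  rw [← lintegral_indicator_one (hmap (M.measurableSet_relBall i j c)),
    ← lintegral_indicator_one (M.measurableSet_relBall i j c)]
  change ∫⁻ y : MolState, h (x.1 - y.1, y.2) ∂stateMeasure = ∫⁻ y, h y ∂stateMeasure
  rw [lintegral_stateMeasure h hm]
  refine (lintegral_stateMeasure _ (hm.comp hmap)).trans ?_
  exact lintegral_sub_left_eq_self (fun v => ∫⁻ I in Ioi (0 : ℝ), h (v, I)) x.1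

/-- A density of finite entropy carries at most half of its mass on a set of volume `δ⁵ ω`:
above the level `Λ = e^(4H/‖g‖)` it has mass at most `‖g‖ / 4`, below it at most `Λ δ⁵ ω`. -/
lemma setIntegral_le_half (i j : Fin P) {g : MolState → ℝ} (hg0 : ∀ x, 0 ≤ g x)
    (hg : M.InLp j 1 0 g) (hpos : 0 < M.norm j 1 0 g) (hH : FiniteEntropy g) {S : Set MolState}
    (hSv : stateMeasure S ≤
      ENNReal.ofReal (CollisionKernel.delta M i j g ^ 5 * CollisionKernel.unitBallVol M i j)) :
    ∫ y in S, g y ∂stateMeasure ≤ M.norm j 1 0 g / 2 := by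
  have hω := M.unitBallVol_pos i j
  have hH0 := entropyH_nonneg hg0
  have hgi : Integrable g stateMeasure := by simpa using integrable_weighted hg
  have hδ5 : CollisionKernel.delta M i j g ^ 5 = M.norm j 1 0 g *
      Real.exp (-(4 * entropyH g / M.norm j 1 0 g)) / (4 * CollisionKernel.unitBallVol M i j) := by
    rw [CollisionKernel.delta, ← Real.rpow_natCast, ← Real.rpow_mul (by positivity)]
    norm_num
  set G := M.norm j 1 0 g
  set H := entropyH g
  set ω := CollisionKernel.unitBallVol M i j
  -- for `H = 0` the coefficient `G / (4 * H)` is `0`, and indeed `g ≤ 1` almost everywhere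
  have hpt : ∀ᵐ x ∂stateMeasure,
      g x ≤ Real.exp (4 * H / G) + G / (4 * H) * (g x * |Real.log (g x)|) := by
    rcases hH0.eq_or_lt with h0 | h0
    · have hz := (integral_eq_zero_iff_of_nonneg
        (fun x => mul_nonneg (hg0 x) (abs_nonneg (Real.log (g x)))) hH).1 h0.symm
      refine hz.mono fun x hx => ?_
      have hx : g x * |Real.log (g x)| = 0 := hx
      rw [hx, mul_zero, add_zero, ← h0, mul_zero, zero_div, Real.exp_zero]
      rcases mul_eq_zero.1 hx with h | h
      · rw [h]; exact zero_le_one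
      · rcases Real.log_eq_zero.1 (abs_eq_zero.1 h) with h | h | h <;> linarith
    · refine ae_of_all _ fun x => ?_
      have hgx := hg0 x
      rcases le_or_gt (g x) (Real.exp (4 * H / G)) with h | h
      · have : 0 ≤ G / (4 * H) * (g x * |Real.log (g x)|) := by positivity
        linarith
      · have h1 := (Real.lt_log_iff_exp_lt ((Real.exp_pos _).trans h)).2 h
        have h2 := le_abs_self (Real.log (g x))
        have h3 : 1 ≤ G / (4 * H) * |Real.log (g x)| := by
          calc 1 = G / (4 * H) * (4 * H / G) := by field_simp
            _ ≤ _ := by gcongr; linarith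
        have h4 := Real.exp_pos (4 * H / G)
        nlinarith
  have hSfin : stateMeasure S < ⊤ := hSv.trans_lt ENNReal.ofReal_lt_top
  have hreal : stateMeasure.real S ≤ G * Real.exp (-(4 * H / G)) / (4 * ω) * ω := by
    rw [← hδ5]
    refine ENNReal.toReal_le_of_le_ofReal ?_ hSv
    rw [hδ5]; positivity
  have hcst : Integrable (fun _ : MolState => Real.exp (4 * H / G)) (stateMeasure.restrict S) :=
    integrableOn_const hSfin.ne
  have hci : Integrable (fun x => G / (4 * H) * (g x * |Real.log (g x)|)) stateMeasure :=
    Integrable.const_mul hH _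
  calc ∫ y in S, g y ∂stateMeasure
      ≤ ∫ y in S, (Real.exp (4 * H / G) + G / (4 * H) * (g y * |Real.log (g y)|))
          ∂stateMeasure :=
        integral_mono_ae hgi.integrableOn
          (hcst.add hci.integrableOn) (ae_restrict_of_ae hpt)
    _ = stateMeasure.real S * Real.exp (4 * H / G) +
          ∫ y in S, G / (4 * H) * (g y * |Real.log (g y)|) ∂stateMeasure := by
        rw [integral_add hcst hci.integrableOn, setIntegral_const,
          smul_eq_mul]
    _ ≤ G * Real.exp (-(4 * H / G)) / (4 * ω) * ω * Real.exp (4 * H / G) + G / 4 := by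
        refine add_le_add (by gcongr) ?_
        refine (setIntegral_le_integral hci (ae_of_all _ fun x => ?_)).trans ?_
        · have := hg0 x; simp only [Pi.zero_apply]; positivity
        · rw [integral_const_mul]
          change G / (4 * H) * H ≤ G / 4
          rcases hH0.eq_or_lt with h0 | h0
          · rw [← h0, mul_zero]; positivity
          · exact le_of_eq (by field_simp)
    _ = G / 2 := by
        rw [Real.exp_neg]
        field_simp; ring

variable (M)

/-- `⟨x⟩²` is controlled by the relative energy and `⟨y⟩²`, as `|v|² ≤ 2|v - v_*|² + 2|v_*|²` and
`s̄ m_i ≤ μ ≤ m_j`. -/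
lemma sq_bracket_le_energy_add (i j : Fin P) {x y : MolState} (hx : 0 ≤ x.2) (hy : 0 ≤ y.2) :
    M.minRatio i j / 2 * M.bracket i x ^ 2 ≤
      M.energy i j x y / M.totalMass + M.bracket j y ^ 2 := by
  have ht := M.totalMass_pos i
  have h1 := M.m_pos i
  have h2 := M.m_pos j
  have hs := M.minRatio_pos i j
  have hs' := M.minRatio_le_half i j
  have hμ : M.minRatio i j * M.m i ≤ M.redMass i j := by
    have : M.minRatio i j ≤ M.m j / (M.m i + M.m j) := min_le_right _ _
    calc M.minRatio i j * M.m i ≤ M.m j / (M.m i + M.m j) * M.m i := by gcongr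
      _ = _ := by rw [redMass]; ring
  have hμ' := M.redMass_le_right i j
  rw [M.sq_bracket i hx, M.sq_bracket j hy]
  have hv : ‖x.1‖ ^ 2 ≤ 2 * ‖x.1 - y.1‖ ^ 2 + 2 * ‖y.1‖ ^ 2 := by
    have := norm_add_le (x.1 - y.1) y.1
    rw [sub_add_cancel] at this
    nlinarith [sq_nonneg (‖x.1 - y.1‖ - ‖y.1‖), _root_.norm_nonneg x.1]
  have key : M.minRatio i j / 2 * M.molEnergy i x ≤ M.energy i j x y + M.molEnergy j y := by
    unfold molEnergy energy
    have e1 : M.minRatio i j * M.m i * ‖x.1‖ ^ 2 ≤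
        M.redMass i j * (2 * ‖x.1 - y.1‖ ^ 2) + M.m j * (2 * ‖y.1‖ ^ 2) := by
      calc M.minRatio i j * M.m i * ‖x.1‖ ^ 2
          ≤ M.redMass i j * (2 * ‖x.1 - y.1‖ ^ 2 + 2 * ‖y.1‖ ^ 2) := by
            have := M.redMass_pos i j
            gcongr
        _ ≤ _ := by nlinarith [sq_nonneg ‖y.1‖]
    nlinarith
  have : (M.minRatio i j / 2 * M.molEnergy i x) / M.totalMass ≤
      (M.energy i j x y + M.molEnergy j y) / M.totalMass := by gcongr
  rw [add_div] at this
  have e : M.minRatio i j / 2 * (1 + M.molEnergy i x / M.totalMass) = M.minRatio i j / 2 +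
    M.minRatio i j / 2 * M.molEnergy i x / M.totalMass := by ring
  rw [e]
  linarith

end GasMixture

/-! ### Moments of the relative energy -/

namespace CollisionKernel

variable {P : ℕ} {M : GasMixture P} (Q : CollisionKernel M)

lemma bracket_sq_rpow (l : Fin P) (s : ℝ) (x : MolState) :
    (M.bracket l x ^ 2) ^ (s / 2) = M.bracket l x ^ s := by
  rw [← Real.rpow_natCast, ← Real.rpow_mul (M.bracket_nonneg l x)]
  congr 1; push_cast; ring

lemma energy_rpow_le (i j : Fin P) {x y : MolState} (hx : 0 ≤ x.2) (hy : 0 ≤ y.2) :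
    (M.energy i j x y / M.totalMass) ^ (Q.γ i j / 2) ≤
      M.bracket i x ^ Q.γ i j * M.bracket j y ^ Q.γ i j := by
  have ht := M.totalMass_pos i
  have hE := M.energy_nonneg i j hx hy
  have hγ := (Q.γ_mem i j).1
  refine (Real.rpow_le_rpow (by positivity) (M.energy_div_le i j hx hy) (by positivity)).trans_eq ?_
  rw [Real.mul_rpow (by positivity) (by positivity), bracket_sq_rpow, bracket_sq_rpow]

/-- Growth of the relative energy. As `γ / 2 ≤ 1`, the power is subadditive and the factor
`min {1, 2^(1 - γ)}` of `L₁` is only used through its bound by `1`. -/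
lemma le_energy_rpow_add (i j : Fin P) {x y : MolState} (hx : 0 ≤ x.2) (hy : 0 ≤ y.2) :
    Q.lowL1 i j * M.bracket i x ^ Q.γ i j ≤
      (M.energy i j x y / M.totalMass) ^ (Q.γ i j / 2) + M.bracket j y ^ Q.γ i j := by
  have ht := M.totalMass_pos i
  have hE := M.energy_nonneg i j hx hy
  have hs := M.minRatio_pos i j
  obtain ⟨hγ, hγ2⟩ := Q.γ_mem i j
  have hb := M.bracket_rpow_nonneg i (Q.γ i j) x
  calc Q.lowL1 i j * M.bracket i x ^ Q.γ i j
      ≤ 1 * (M.minRatio i j / 2) ^ (Q.γ i j / 2) * M.bracket i x ^ Q.γ i j := by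
        unfold lowL1
        gcongr
        exact min_le_left _ _
    _ = (M.minRatio i j / 2 * M.bracket i x ^ 2) ^ (Q.γ i j / 2) := by
        rw [one_mul, Real.mul_rpow (by positivity) (by positivity), bracket_sq_rpow]
    _ ≤ (M.energy i j x y / M.totalMass + M.bracket j y ^ 2) ^ (Q.γ i j / 2) :=
        Real.rpow_le_rpow (by positivity) (M.sq_bracket_le_energy_add i j hx hy) (by positivity)
    _ ≤ _ := by
        refine (Real.rpow_add_le_add_rpow (by positivity) (by positivity) (by positivity)
          (by linarith)).trans_eq ?_
        rw [bracket_sq_rpow]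

lemma lowL1_pos (i j : Fin P) : 0 < Q.lowL1 i j := by
  have hs := M.minRatio_pos i j
  exact mul_pos (lt_min one_pos (by positivity)) (by positivity)

lemma delta_pos (i j : Fin P) {g : MolState → ℝ} (hpos : 0 < M.norm j 1 0 g) :
    0 < delta M i j g := by
  have hω := M.unitBallVol_pos i j
  unfold delta; positivity

lemma lowL2_pos (i j : Fin P) {g : MolState → ℝ} (hpos : 0 < M.norm j 1 0 g) :
    0 < Q.lowL2 i j g := by
  have := delta_pos (M := M) i j hpos
  unfold lowL2; positivity

lemma clb_pos (i j : Fin P) {g : MolState → ℝ} (hpos : 0 < M.norm j 1 0 g)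
    (hlb : 0 < Q.blbNorm i j) : 0 < Q.clb i j g := by
  have h1 := Q.lowL1_pos i j
  have h2 := Q.lowL2_pos i j hpos
  have h3 := GasMixture.norm_nonneg (M := M) j 1 (Q.γ i j) g
  exact mul_pos (mul_pos (by positivity) (lt_min one_pos (by positivity))) hlb

lemma integrable_energy_rpow (i j : Fin P) {g : MolState → ℝ} (hg : Measurable g)
    (hg0 : ∀ x, 0 ≤ g x) (hg1 : M.InLp j 1 (Q.γ i j) g) {x : MolState} (hx : 0 ≤ x.2) :
    Integrable (fun y => g y * (M.energy i j x y / M.totalMass) ^ (Q.γ i j / 2)) stateMeasure := by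
  have hm : Measurable fun y => M.energy i j x y := by unfold GasMixture.energy; fun_prop
  have ht := M.totalMass_pos i
  refine Integrable.mono' ((GasMixture.integrable_weighted hg1).const_mul
    (M.bracket i x ^ Q.γ i j))
    (hg.mul ((hm.div_const _).pow_const _)).aestronglyMeasurable
    (ae_stateMeasure_pos.mono fun y hy => ?_)
  have hE := M.energy_nonneg i j hx hy.le
  have hgy := hg0 y
  rw [Real.norm_of_nonneg (by positivity)]
  calc _ ≤ g y * (M.bracket i x ^ Q.γ i j * M.bracket j y ^ Q.γ i j) := by
        gcongr; exact Q.energy_rpow_le i j hx hy.le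
    _ = _ := by ring

/-- At most half of the mass of `g` lies where the relative energy is at most `δ² 𝗆`. -/
lemma lowL2_le_integral (i j : Fin P) {g : MolState → ℝ} (hg : Measurable g)
    (hg0 : ∀ x, 0 ≤ g x) (hg1 : M.InLp j 1 (Q.γ i j) g) (hpos : 0 < M.norm j 1 0 g)
    (hH : FiniteEntropy g) {x : MolState} (hx : 0 ≤ x.2) :
    Q.lowL2 i j g ≤
      ∫ y, g y * (M.energy i j x y / M.totalMass) ^ (Q.γ i j / 2) ∂stateMeasure := by
  have hγ := (Q.γ_mem i j).1
  have hδ := delta_pos (M := M) i j hpos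
  have ht := M.totalMass_pos i
  have hg10 := hg1.mono hγ hg hg0
  have hgi : Integrable g stateMeasure := by simpa using GasMixture.integrable_weighted hg10
  have hG : M.norm j 1 0 g = ∫ y, g y ∂stateMeasure := by
    simpa using GasMixture.norm_one_eq_integral hg0 hg10
  have hm : Measurable fun y => M.energy i j x y := by unfold GasMixture.energy; fun_prop
  have hS : MeasurableSet {y | M.energy i j x y / M.totalMass ≤ delta M i j g ^ 2} :=
    measurableSet_le (by fun_prop) measurable_const
  have hhalf := GasMixture.setIntegral_le_half i j hg0 hg10 hpos hH
    (GasMixture.stateMeasure_energy_le i j hδ hx)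
  have hsum := integral_add_compl hS hgi
  have hint := Q.integrable_energy_rpow i j hg hg0 hg1 hx
  set S := {y | M.energy i j x y / M.totalMass ≤ delta M i j g ^ 2}
  set δ := delta M i j g
  calc Q.lowL2 i j g = δ ^ Q.γ i j * (M.norm j 1 0 g / 2) := by rw [lowL2]; ring
    _ ≤ δ ^ Q.γ i j * ∫ y in Sᶜ, g y ∂stateMeasure := by gcongr; linarith
    _ = ∫ y in Sᶜ, δ ^ Q.γ i j * g y ∂stateMeasure := (integral_const_mul _ _).symm
    _ ≤ ∫ y in Sᶜ, g y * (M.energy i j x y / M.totalMass) ^ (Q.γ i j / 2) ∂stateMeasure := by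
        refine setIntegral_mono_on (hgi.integrableOn.const_mul _) hint.integrableOn hS.compl
          fun y hy => ?_
        have hy : δ ^ 2 < M.energy i j x y / M.totalMass := not_le.1 hy
        rw [mul_comm]
        refine mul_le_mul_of_nonneg_left ?_ (hg0 y)
        calc δ ^ Q.γ i j = (δ ^ 2) ^ (Q.γ i j / 2) := by
              rw [← Real.rpow_natCast, ← Real.rpow_mul hδ.le]
              congr 1; push_cast; ring
          _ ≤ _ := Real.rpow_le_rpow (by positivity) hy.le (by positivity)
    _ ≤ _ := by
        refine setIntegral_le_integral hint (ae_stateMeasure_pos.mono fun y hy => ?_)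
        have hE := M.energy_nonneg i j hx hy.le
        have := hg0 y
        simp only [Pi.zero_apply]; positivity

/-- Lower bound for the `γ/2`-moment of the relative energy: a convex combination of the entropy
bound `F ≥ L₂` and of the growth bound `F ≥ L₁ ‖g‖ ⟨x⟩^γ - ‖g‖_{L¹_γ}`. -/
lemma le_integral_energy_rpow (i j : Fin P) {g : MolState → ℝ} (hg : Measurable g)
    (hg0 : ∀ x, 0 ≤ g x) (hg1 : M.InLp j 1 (Q.γ i j) g) (hpos : 0 < M.norm j 1 0 g)
    (hH : FiniteEntropy g) {x : MolState} (hx : 0 ≤ x.2) :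
    Q.lowL2 i j g / 2 *
      min 1 (Q.lowL1 i j * M.norm j 1 0 g / (Q.lowL2 i j g + M.norm j 1 (Q.γ i j) g)) *
        M.bracket i x ^ Q.γ i j ≤
      ∫ y, g y * (M.energy i j x y / M.totalMass) ^ (Q.γ i j / 2) ∂stateMeasure := by
  have hγ := (Q.γ_mem i j).1
  have hg10 := hg1.mono hγ hg hg0
  have h1 := Q.lowL1_pos i j
  have h2 := Q.lowL2_pos i j hpos
  have hN := GasMixture.norm_nonneg (M := M) j 1 (Q.γ i j) g
  have hF1 := Q.lowL2_le_integral i j hg hg0 hg1 hpos hH hx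
  have hgi : Integrable g stateMeasure := by simpa using GasMixture.integrable_weighted hg10
  have hG : M.norm j 1 0 g = ∫ y, g y ∂stateMeasure := by
    simpa using GasMixture.norm_one_eq_integral hg0 hg10
  have hint := Q.integrable_energy_rpow i j hg hg0 hg1 hx
  have hF2 : Q.lowL1 i j * M.bracket i x ^ Q.γ i j * M.norm j 1 0 g ≤
      (∫ y, g y * (M.energy i j x y / M.totalMass) ^ (Q.γ i j / 2) ∂stateMeasure) +
        M.norm j 1 (Q.γ i j) g := by
    rw [GasMixture.norm_one_eq_integral hg0 hg1, hG,
      ← integral_add hint (GasMixture.integrable_weighted hg1), ← integral_const_mul]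
    refine integral_mono_ae (hgi.const_mul _)
      (hint.add (GasMixture.integrable_weighted hg1)) (ae_stateMeasure_pos.mono fun y hy => ?_)
    have := mul_le_mul_of_nonneg_left (Q.le_energy_rpow_add i j hx hy.le) (hg0 y)
    linarith
  set F := ∫ y, g y * (M.energy i j x y / M.totalMass) ^ (Q.γ i j / 2) ∂stateMeasure
  set t := M.bracket i x ^ Q.γ i j
  set N := M.norm j 1 (Q.γ i j) g
  set G := M.norm j 1 0 g
  set L1 := Q.lowL1 i j
  set L2 := Q.lowL2 i j g
  have ht : 0 ≤ t := M.bracket_rpow_nonneg i _ x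
  calc L2 / 2 * min 1 (L1 * G / (L2 + N)) * t
      ≤ L2 * (L1 * G / (L2 + N)) * t := by
        have : min 1 (L1 * G / (L2 + N)) ≤ L1 * G / (L2 + N) := min_le_right _ _
        gcongr
        linarith
    _ = L2 * (L1 * t * G) / (L2 + N) := by ring
    _ ≤ F := by
        -- `F (L₂ + N) ≥ L₂ F + L₂ N ≥ L₂ (L₁ t G)`, as `F ≥ L₂` and `F + N ≥ L₁ t G`
        rw [div_le_iff₀ (by positivity)]
        nlinarith

end CollisionKernel

/-! ### The loss operator -/

lemma angularL1_nonneg (b : ℝ → ℝ) : 0 ≤ angularL1 b :=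
  mul_nonneg (by positivity) (integral_nonneg fun _ => abs_nonneg _)

lemma ofReal_angularL1 {b : ℝ → ℝ} (hb : IntegrableOn b (Icc (-1 : ℝ) 1)) :
    ENNReal.ofReal (angularL1 b) =
      ENNReal.ofReal (2 * Real.pi) * ∫⁻ s in Icc (-1 : ℝ) 1, ENNReal.ofReal |b s| := by
  rw [angularL1, ENNReal.ofReal_mul (by positivity),
    ofReal_integral_eq_lintegral_ofReal hb.abs (ae_of_all _ fun _ => abs_nonneg _)]

namespace CollisionKernel

variable {P : ℕ} {M : GasMixture P} (Q : CollisionKernel M)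

/-- The angular part and a profile in `(r, R)` integrate separately over `𝕊² × [0, 1]²`. -/
lemma lintegral_angular_mul (i j : Fin P) {u : Vel} (hu : u ≠ 0) {ψ : ℝ × ℝ → ℝ}
    (hψ : Integrable ψ exchangeMeasure) (hψ0 : ∀ᵐ z ∂exchangeMeasure, 0 ≤ ψ z) :
    ∫⁻ w : CollParam, ENNReal.ofReal (Q.b i j (inner ℝ (unitDir u) (w.1 : Vel))) *
      ENNReal.ofReal (ψ w.2) ∂collisionMeasure =
    ENNReal.ofReal (angularL1 (Q.b i j)) * ENNReal.ofReal (∫ z, ψ z ∂exchangeMeasure) := by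
  have he := norm_unitDir hu
  have hbm : AEMeasurable (fun s => ENNReal.ofReal (Q.b i j s))
      (volume.restrict (Icc (-1 : ℝ) 1)) := (Q.b_integrable i j).aemeasurable.ennreal_ofReal
  have hme : Measurable fun σ : Metric.sphere (0 : Vel) 1 =>
    inner ℝ (unitDir u) (σ : Vel) := by fun_prop
  have hae := ae_sphere_inner he hbm.ae_eq_mk
  rw [collisionMeasure, lintegral_prod_mul (f := fun σ : Metric.sphere (0 : Vel) 1 =>
    ENNReal.ofReal (Q.b i j (inner ℝ (unitDir u) (σ : Vel)))) (g := fun z => ENNReal.ofReal (ψ z))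
    ⟨_, hbm.measurable_mk.comp hme, hae⟩ hψ.aemeasurable.ennreal_ofReal,
    ← ofReal_integral_eq_lintegral_ofReal hψ hψ0]
  congr 1
  rw [lintegral_congr_ae hae, lintegral_sphere_inner he _ hbm.measurable_mk,
    ofReal_angularL1 (Q.b_integrable i j), ← lintegral_congr_ae hbm.ae_eq_mk]
  congr 1
  exact setLIntegral_congr_fun measurableSet_Icc fun s hs => by
    rw [abs_of_nonneg (Q.b_nonneg i j s hs)]

lemma inner_unitDir_mem {u : Vel} (hu : u ≠ 0) (σ : Metric.sphere (0 : Vel) 1) :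
    inner ℝ (unitDir u) (σ : Vel) ∈ Icc (-1 : ℝ) 1 := by
  have := abs_real_inner_le_norm (unitDir u) (σ : Vel)
  rw [norm_unitDir hu, norm_sphere_coe σ, one_mul] at this
  exact abs_le.1 this

lemma blb_mul_nonneg (i j : Fin P) : ∀ᵐ z ∂exchangeMeasure,
    0 ≤ Q.blb i j z.1 z.2 * M.dWeight i j z.1 z.2 :=
  GasMixture.ae_exchangeMeasure.mono fun _ hz => mul_nonneg (Q.blb_nonneg i j _ hz.1 _ hz.2)
    (M.dWeight_nonneg i j (Ioo_subset_Icc_self hz.1) (Ioo_subset_Icc_self hz.2))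

lemma bub_mul_nonneg (i j : Fin P) : ∀ᵐ z ∂exchangeMeasure,
    0 ≤ Q.bub i j z.1 z.2 * M.dWeight i j z.1 z.2 :=
  GasMixture.ae_exchangeMeasure.mono fun _ hz => mul_nonneg (Q.bub_nonneg i j _ hz.1 _ hz.2)
    (M.dWeight_nonneg i j (Ioo_subset_Icc_self hz.1) (Ioo_subset_Icc_self hz.2))

/-- Lower bound for the collision frequency: the lower bound on `B_ij` separates the variables, and
the energy moment is at least a multiple of `⟨x⟩^γ`. -/
lemma le_freq (i j : Fin P) {g : MolState → ℝ} (hg : Measurable g)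
    (hg0 : ∀ x, 0 ≤ g x) (hg1 : M.InLp j 1 (Q.γ i j) g) (hpos : 0 < M.norm j 1 0 g)
    (hH : FiniteEntropy g) {x : MolState} (hx : 0 < x.2) :
    ENNReal.ofReal (angularL1 (Q.b i j) * Q.clb i j g * M.bracket i x ^ Q.γ i j) ≤
      Q.freq i j g x := by
  have hE : ∀ y : MolState, 0 < y.2 → 0 ≤ M.energy i j x y / M.totalMass := fun y hy =>
    div_nonneg (M.energy_nonneg i j hx.le hy.le) (M.totalMass_pos i).le
  have ha := angularL1_nonneg (Q.b i j)
  have hlb : 0 ≤ Q.blbNorm i j := integral_nonneg_of_ae (Q.blb_mul_nonneg i j)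
  have hF := Q.le_integral_energy_rpow i j hg hg0 hg1 hpos hH hx.le
  have hint := Q.integrable_energy_rpow i j hg hg0 hg1 hx.le
  have hF0 : 0 ≤ᵐ[stateMeasure] fun y => g y * (M.energy i j x y / M.totalMass) ^ (Q.γ i j / 2) :=
    ae_stateMeasure_pos.mono fun y hy => mul_nonneg (hg0 y) (Real.rpow_nonneg (hE y hy) _)
  have e1 : ENNReal.ofReal (angularL1 (Q.b i j) * Q.clb i j g * M.bracket i x ^ Q.γ i j) ≤
      (∫⁻ y, ENNReal.ofReal (g y * (M.energy i j x y / M.totalMass) ^ (Q.γ i j / 2))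
        ∂stateMeasure) *
      (ENNReal.ofReal (angularL1 (Q.b i j)) * ENNReal.ofReal (Q.blbNorm i j)) := by
    rw [← ofReal_integral_eq_lintegral_ofReal hint hF0, ← ENNReal.ofReal_mul ha,
      ← ENNReal.ofReal_mul (integral_nonneg_of_ae hF0)]
    refine ENNReal.ofReal_le_ofReal ?_
    have := mul_le_mul_of_nonneg_right hF (mul_nonneg ha hlb)
    unfold clb
    linarith
  refine e1.trans ?_
  unfold freq blbNorm
  rw [← lintegral_mul_const' _ _ (ENNReal.mul_ne_top ENNReal.ofReal_ne_top ENNReal.ofReal_ne_top)]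
  refine lintegral_mono_ae ((ae_stateMeasure_pos.and (ae_stateMeasure_ne x.1)).mono
    fun y hy => ?_)
  obtain ⟨hy, hxy⟩ := hy
  have hu : x.1 - y.1 ≠ 0 := sub_ne_zero.2 (Ne.symm hxy)
  rw [← Q.lintegral_angular_mul i j hu (Q.blb_integrable i j) (Q.blb_mul_nonneg i j),
    ← lintegral_const_mul' _ _ ENNReal.ofReal_ne_top]
  refine lintegral_mono_ae (ae_collisionMeasure.mono fun w hw => ?_)
  obtain ⟨hr, hR⟩ := hw
  have hadm : GasMixture.Admissible x y w.1 w.2.1 w.2.2 :=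
    ⟨Ne.symm hxy, hx, hy, norm_sphere_coe w.1, hr, hR⟩
  have hlow := Q.lower_bound i j x y w.1 w.2.1 w.2.2 hadm
  have hb0 := Q.b_nonneg i j _ (inner_unitDir_mem hu w.1)
  have hd := M.dWeight_nonneg i j (Ioo_subset_Icc_self hr) (Ioo_subset_Icc_self hR)
  rw [← ENNReal.ofReal_mul hb0,
    ← ENNReal.ofReal_mul (mul_nonneg (hg0 y) (Real.rpow_nonneg (hE y hy) _))]
  refine ENNReal.ofReal_le_ofReal ?_
  have := mul_le_mul_of_nonneg_right (mul_le_mul_of_nonneg_left hlow (hg0 y)) hd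
  linarith

lemma freq_le (i j : Fin P) {g : MolState → ℝ}
    (hg0 : ∀ x, 0 ≤ g x) (hg1 : M.InLp j 1 (Q.γ i j) g) {x : MolState} (hx : 0 < x.2) :
    Q.freq i j g x ≤ ENNReal.ofReal (angularL1 (Q.b i j) *
      (∫ z, Q.bub i j z.1 z.2 * M.dWeight i j z.1 z.2 ∂exchangeMeasure) *
        M.norm j 1 (Q.γ i j) g * M.bracket i x ^ Q.γ i j) := by
  have ha := angularL1_nonneg (Q.b i j)
  have hub : 0 ≤ ∫ z, Q.bub i j z.1 z.2 * M.dWeight i j z.1 z.2 ∂exchangeMeasure :=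
    integral_nonneg_of_ae (Q.bub_mul_nonneg i j)
  have hN := GasMixture.norm_nonneg (M := M) j 1 (Q.γ i j) g
  have hbx := M.bracket_rpow_nonneg i (Q.γ i j) x
  have e : ENNReal.ofReal (angularL1 (Q.b i j) *
      (∫ z, Q.bub i j z.1 z.2 * M.dWeight i j z.1 z.2 ∂exchangeMeasure) *
        M.norm j 1 (Q.γ i j) g * M.bracket i x ^ Q.γ i j) =
      (∫⁻ y, M.wdens j (Q.γ i j) g y ∂stateMeasure) * (ENNReal.ofReal (M.bracket i x ^ Q.γ i j) *
        (ENNReal.ofReal (angularL1 (Q.b i j)) * ENNReal.ofReal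
          (∫ z, Q.bub i j z.1 z.2 * M.dWeight i j z.1 z.2 ∂exchangeMeasure))) := by
    rw [GasMixture.lintegral_wdens hg0 hg1, ← ENNReal.ofReal_mul ha, ← ENNReal.ofReal_mul hbx,
      ← ENNReal.ofReal_mul hN]
    congr 1; ring
  rw [e, freq, ← lintegral_mul_const' _ _ (ENNReal.mul_ne_top ENNReal.ofReal_ne_top
    (ENNReal.mul_ne_top ENNReal.ofReal_ne_top ENNReal.ofReal_ne_top))]
  refine lintegral_mono_ae ((ae_stateMeasure_pos.and (ae_stateMeasure_ne x.1)).mono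
    fun y hy => ?_)
  obtain ⟨hy, hxy⟩ := hy
  have hu : x.1 - y.1 ≠ 0 := sub_ne_zero.2 (Ne.symm hxy)
  rw [GasMixture.wdens, ← Q.lintegral_angular_mul i j hu (Q.bub_integrable i j) (Q.bub_mul_nonneg i j),
    ← mul_assoc, ← lintegral_const_mul' _ _
      (ENNReal.mul_ne_top ENNReal.ofReal_ne_top ENNReal.ofReal_ne_top)]
  refine lintegral_mono_ae (ae_collisionMeasure.mono fun w hw => ?_)
  obtain ⟨hr, hR⟩ := hw
  have hadm : GasMixture.Admissible x y w.1 w.2.1 w.2.2 :=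
    ⟨Ne.symm hxy, hx, hy, norm_sphere_coe w.1, hr, hR⟩
  have hup := Q.upper_bound i j x y w.1 w.2.1 w.2.2 hadm
  have hb0 := Q.b_nonneg i j _ (inner_unitDir_mem hu w.1)
  have hbub := Q.bub_nonneg i j _ hr _ hR
  have hd := M.dWeight_nonneg i j (Ioo_subset_Icc_self hr) (Ioo_subset_Icc_self hR)
  have hgy := hg0 y
  have hby := M.bracket_rpow_nonneg j (Q.γ i j) y
  rw [← ENNReal.ofReal_mul hb0, ← ENNReal.ofReal_mul (by positivity),
    ← ENNReal.ofReal_mul (by positivity)]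
  refine ENNReal.ofReal_le_ofReal ?_
  have hE := Q.energy_rpow_le i j hx.le hy.le
  calc _ ≤ g y * (Q.b i j (inner ℝ (unitDir (x.1 - y.1)) (w.1 : Vel)) * Q.bub i j w.2.1 w.2.2 *
        (M.bracket i x ^ Q.γ i j * M.bracket j y ^ Q.γ i j)) * M.dWeight i j w.2.1 w.2.2 := by
        gcongr
        exact hup.trans (by gcongr)
    _ = _ := by ring

/-- `f · f^(p - 1) ⟨·⟩^(kp) · ⟨·⟩^γ` is the density of the `L^p` norm with weight `γ/p + k`. -/
lemma loss_weight_eq (i : Fin P) {p k γ A : ℝ} (hp : 1 ≤ p) (hA : 0 ≤ A) {f : MolState → ℝ}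
    (hf0 : ∀ x, 0 ≤ f x) {x : MolState} (hx : 0 < x.2) :
    ENNReal.ofReal (f x) * ENNReal.ofReal (A * M.bracket i x ^ γ) *
      ENNReal.ofReal (f x ^ (p - 1) * M.bracket i x ^ (k * p)) =
    ENNReal.ofReal A * M.wdens i (γ / p + k) f x ^ p := by
  have hp0 : 0 < p := by linarith
  have hfx := hf0 x
  have hb0 : 0 < M.bracket i x := by linarith [M.one_le_bracket i hx.le]
  have e : f x * f x ^ (p - 1) = f x ^ p := by
    rw [← Real.rpow_one_add' hfx (by linarith)]; congr 1; ring
  rw [GasMixture.wdens, ENNReal.ofReal_rpow_of_nonneg (by positivity) hp0.le,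
    ← ENNReal.ofReal_mul hfx, ← ENNReal.ofReal_mul (by positivity), ← ENNReal.ofReal_mul hA,
    Real.mul_rpow hfx (by positivity), ← Real.rpow_mul hb0.le, ← e,
    show (γ / p + k) * p = γ + k * p by field_simp, Real.rpow_add hb0]
  congr 1; ring

lemma le_lintegral_loss (i j : Fin P) {p k : ℝ} (hp : 1 ≤ p) {f g : MolState → ℝ}
    (hf0 : ∀ x, 0 ≤ f x) (hfp : M.InLp i p (Q.γ i j / p + k) f) (hg : Measurable g)
    (hg0 : ∀ x, 0 ≤ g x) (hg1 : M.InLp j 1 (Q.γ i j) g) (hpos : 0 < M.norm j 1 0 g)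
    (hH : FiniteEntropy g) (hlb : 0 < Q.blbNorm i j) :
    ENNReal.ofReal (angularL1 (Q.b i j) * Q.clb i j g *
        M.norm i p (Q.γ i j / p + k) f ^ p) ≤
      ∫⁻ x, Q.loss i j f g x * ENNReal.ofReal (f x ^ (p - 1) * M.bracket i x ^ (k * p))
        ∂stateMeasure := by
  have hA : 0 ≤ angularL1 (Q.b i j) * Q.clb i j g :=
    mul_nonneg (angularL1_nonneg _) (Q.clb_pos i j hpos hlb).le
  rw [ENNReal.ofReal_mul hA, ← GasMixture.lintegral_wdens_rpow hp hf0 hfp,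
    ← lintegral_const_mul' _ _ ENNReal.ofReal_ne_top]
  refine lintegral_mono_ae (ae_stateMeasure_pos.mono fun x hx => ?_)
  rw [← loss_weight_eq i hp hA hf0 hx, loss]
  gcongr
  exact Q.le_freq i j hg hg0 hg1 hpos hH hx

lemma lintegral_loss_lt_top (i j : Fin P) {p k : ℝ} (hp : 1 ≤ p) {f g : MolState → ℝ}
    (hf0 : ∀ x, 0 ≤ f x) (hfp : M.InLp i p (Q.γ i j / p + k) f)
    (hg0 : ∀ x, 0 ≤ g x) (hg1 : M.InLp j 1 (Q.γ i j) g) :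
    ∫⁻ x, Q.loss i j f g x * ENNReal.ofReal (f x ^ (p - 1) * M.bracket i x ^ (k * p))
        ∂stateMeasure < ⊤ := by
  have hub : 0 ≤ ∫ z, Q.bub i j z.1 z.2 * M.dWeight i j z.1 z.2 ∂exchangeMeasure :=
    integral_nonneg_of_ae (Q.bub_mul_nonneg i j)
  have hA : 0 ≤ angularL1 (Q.b i j) *
      (∫ z, Q.bub i j z.1 z.2 * M.dWeight i j z.1 z.2 ∂exchangeMeasure) *
        M.norm j 1 (Q.γ i j) g :=
    mul_nonneg (mul_nonneg (angularL1_nonneg _) hub) (GasMixture.norm_nonneg ..)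
  refine lt_of_le_of_lt ?_ (ENNReal.mul_lt_top (ENNReal.ofReal_lt_top
    (r := angularL1 (Q.b i j) *
      (∫ z, Q.bub i j z.1 z.2 * M.dWeight i j z.1 z.2 ∂exchangeMeasure) *
        M.norm j 1 (Q.γ i j) g)) (ENNReal.ofReal_lt_top
          (r := M.norm i p (Q.γ i j / p + k) f ^ p)))
  rw [← GasMixture.lintegral_wdens_rpow hp hf0 hfp,
    ← lintegral_const_mul' _ _ ENNReal.ofReal_ne_top]
  refine lintegral_mono_ae (ae_stateMeasure_pos.mono fun x hx => ?_)
  rw [← loss_weight_eq i hp hA hf0 hx, loss]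
  gcongr
  exact Q.freq_le i j hg0 hg1 hx

end CollisionKernel

/-! ### Decomposition of the angular part and the gain form -/

lemma angularL1_congr {b b' : ℝ → ℝ} (h : ∀ s ∈ Icc (-1 : ℝ) 1, b s = b' s) :
    angularL1 b = angularL1 b' := by
  unfold angularL1
  rw [setIntegral_congr_fun measurableSet_Icc fun s hs => by rw [h s hs]]

/-- Simple functions are bounded and dense in `L¹`. -/
lemma exists_isAngularDecomp {b : ℝ → ℝ} (hb : IntegrableOn b (Icc (-1 : ℝ) 1)) {ε : ℝ}
    (hε : 0 < ε) : ∃ b₁ bInf, IsAngularDecomp b ε b₁ bInf := by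
  have hε' : ENNReal.ofReal (ε / (2 * Real.pi)) ≠ 0 := by
    simp only [ne_eq, ENNReal.ofReal_eq_zero, not_le]; positivity
  obtain ⟨s, hs, hs'⟩ := (memLp_one_iff_integrable.2 hb).exists_simpleFunc_eLpNorm_sub_lt
    ENNReal.one_ne_top hε'
  have hi : IntegrableOn (b - ⇑s) (Icc (-1 : ℝ) 1) := hb.sub (memLp_one_iff_integrable.1 hs')
  refine ⟨b - ⇑s, s, ⟨ae_of_all _ fun t => by simp, hi, ?_, SimpleFunc.memLp_top s _⟩⟩
  rw [← ENNReal.ofReal_le_ofReal_iff hε.le, ofReal_angularL1 hi]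
  have e : ∫⁻ t in Icc (-1 : ℝ) 1, ENNReal.ofReal |(b - ⇑s) t| =
      eLpNorm (b - ⇑s) 1 (volume.restrict (Icc (-1 : ℝ) 1)) := by
    rw [eLpNorm_one_eq_lintegral_enorm]
    exact lintegral_congr fun t => by rw [← Real.norm_eq_abs, ofReal_norm]
  rw [e]
  calc _ ≤ ENNReal.ofReal (2 * Real.pi) * ENNReal.ofReal (ε / (2 * Real.pi)) := by gcongr
    _ = ENNReal.ofReal ε := by
      rw [← ENNReal.ofReal_mul (by positivity)]; congr 1; field_simp

lemma IsAngularDecomp.ofReal_le {b b₁ bInf : ℝ → ℝ} {ε : ℝ} (h : IsAngularDecomp b ε b₁ bInf) :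
    ∀ᵐ s ∂(volume.restrict (Icc (-1 : ℝ) 1)),
      ENNReal.ofReal (b s) ≤ ENNReal.ofReal |b₁ s| + ENNReal.ofReal (angularLinf bInf) := by
  have hfin := h.bounded.eLpNorm_ne_top
  have h1 : ∀ᵐ s ∂(volume.restrict (Icc (-1 : ℝ) 1)),
      ‖bInf s‖ₑ ≤ ENNReal.ofReal (angularLinf bInf) := by
    rw [angularLinf, ENNReal.ofReal_toReal hfin, eLpNorm_exponent_top]
    exact enorm_ae_le_eLpNormEssSup _ _
  filter_upwards [h.add_eq, h1] with s hs hs1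
  rw [hs]
  refine ENNReal.ofReal_add_le.trans (add_le_add ?_ ?_)
  · exact ENNReal.ofReal_le_ofReal (le_abs_self _)
  · refine le_trans ?_ hs1
    rw [Real.enorm_eq_ofReal_abs]
    exact ENNReal.ofReal_le_ofReal (le_abs_self _)

namespace CollisionKernel

variable {P : ℕ} {M : GasMixture P} (Q : CollisionKernel M)

lemma angularL1_b_symm (i j : Fin P) : angularL1 (Q.b j i) = angularL1 (Q.b i j) :=
  angularL1_congr (Q.b_symm j i)

/-- A direction at any prescribed angle. -/
lemma exists_inner_eq {s : ℝ} (hs : s ∈ Icc (-1 : ℝ) 1) :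
    ∃ e σ : Vel, ‖e‖ = 1 ∧ ‖σ‖ = 1 ∧ inner ℝ e σ = s := by
  refine ⟨!₂[1, 0, 0], !₂[s, √(1 - s ^ 2), 0], ?_, ?_, ?_⟩
  · simp [EuclideanSpace.norm_eq, Fin.sum_univ_three]
  · have : 0 ≤ 1 - s ^ 2 := by nlinarith [hs.1, hs.2]
    simp [EuclideanSpace.norm_eq, Fin.sum_univ_three, Real.sq_sqrt this]
  · simp [PiLp.inner_apply, Fin.sum_univ_three]

/-- If the angular part does not vanish, the two bounds on `B_ij` at an angle where it is positive
force `b̃^lb ≤ b̃^ub`. -/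
lemma blb_le_bub (i j : Fin P) (ha : 0 < angularL1 (Q.b i j)) {r R : ℝ} (hr : r ∈ Ioo (0 : ℝ) 1)
    (hR : R ∈ Ioo (0 : ℝ) 1) : Q.blb i j r R ≤ Q.bub i j r R := by
  obtain ⟨s, hs, hbs⟩ : ∃ s ∈ Icc (-1 : ℝ) 1, 0 < Q.b i j s := by
    by_contra! hcon
    have h0 : angularL1 (Q.b i j) = angularL1 fun _ => 0 :=
      angularL1_congr fun s hs => le_antisymm (hcon s hs) (Q.b_nonneg i j s hs)
    rw [h0] at ha
    simp [angularL1] at ha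
  obtain ⟨e, σ, he, hσ, hes⟩ := exists_inner_eq hs
  set x : MolState := (e, 1)
  set y : MolState := (0, 1)
  have hxy : x.1 ≠ y.1 := by
    change e ≠ 0
    rintro rfl
    simp at he
  have hadm : GasMixture.Admissible x y σ r R := ⟨hxy, one_pos, one_pos, hσ, hr, hR⟩
  have h := (Q.lower_bound i j x y σ r R hadm).trans (Q.upper_bound i j x y σ r R hadm)
  have hu : unitDir (x.1 - y.1) = e := by
    change unitDir (e - 0) = e
    rw [sub_zero, unitDir, he, inv_one, one_smul]
  rw [hu, hes] at h
  have hE := M.energy_pos i j (x := x) (y := y) one_pos one_pos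
  have ht := M.totalMass_pos i
  exact le_of_mul_le_mul_left (le_of_mul_le_mul_right h (by positivity)) hbs

/-- As `b̃^lb ≤ b̃^ub`, the upper profile cannot vanish almost everywhere. -/
lemma rho_pos (i j : Fin P) {p : ℝ} (ha : 0 < angularL1 (Q.b i j)) (hlb : 0 < Q.blbNorm i j)
    (hρ : Q.RhoFinite i j p) : 0 < Q.rho i j p := by
  refine lt_of_le_of_ne (Q.rho_nonneg i j p) fun h0 => ?_
  have hnn : 0 ≤ᵐ[exchangeMeasure] Q.rhoIntegrand i j p :=
    GasMixture.ae_exchangeMeasure.mono fun _ hz => Q.rhoIntegrand_nonneg i j p hz.1 hz.2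
  have hz := (integral_eq_zero_iff_of_nonneg_ae hnn hρ).1 h0.symm
  refine hlb.not_ge (integral_nonpos_of_ae ?_)
  filter_upwards [hz, GasMixture.ae_exchangeMeasure] with z hz hm
  have hr := hm.1.1
  have hR : 0 < 1 - z.2 := sub_pos.2 hm.2.2
  have hd := M.dWeight_nonneg i j (Ioo_subset_Icc_self hm.1) (Ioo_subset_Icc_self hm.2)
  have h1 : z.1 ^ (-((1 + Q.γ i j / 2) * (1 - 1 / p))) * (1 - z.2) ^ (-(1 - 1 / p)) *
    M.dWeight i j z.1 z.2 * Q.bub i j z.1 z.2 = 0 := hz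
  rw [mul_assoc] at h1
  have h2 : M.dWeight i j z.1 z.2 * Q.bub i j z.1 z.2 = 0 :=
    (mul_eq_zero.1 h1).resolve_left (by positivity)
  change Q.blb i j z.1 z.2 * M.dWeight i j z.1 z.2 ≤ 0
  have := mul_le_mul_of_nonneg_right (Q.blb_le_bub i j ha hm.1 hm.2) hd
  linarith

lemma cq_pos (i j : Fin P) {p : ℝ} (ha : 0 < angularL1 (Q.b i j)) (hlb : 0 < Q.blbNorm i j)
    (hρ : Q.RhoFinite i j p) : 0 < Q.cq i j p := by
  have := Q.rho_pos i j ha hlb hρ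
  have := M.minRatio_pos i j
  unfold cq; positivity

lemma entropyConst_nonneg (l : Fin P) {k γ : ℝ} (hk : 0 ≤ k) (hγ : 0 ≤ γ) {g : MolState → ℝ}
    (hg0 : ∀ x, 0 ≤ g x) : 0 ≤ entropyConst M l k γ g := by
  have := entropyH_nonneg hg0
  have := GasMixture.norm_nonneg (M := M) l 1 (k + γ + 1) g
  have := GasMixture.norm_nonneg (M := M) l 1 (min 2 (k + γ + 1)) g
  unfold entropyConst; positivity

lemma entropyConst_pos (l : Fin P) {k γ : ℝ} (hk : 0 ≤ k) (hγ : 0 ≤ γ) {g : MolState → ℝ}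
    (hg : Measurable g) (hg0 : ∀ x, 0 ≤ g x) (hg1 : M.InLp l 1 (k + γ + 1) g)
    (hpos : 0 < M.norm l 1 0 g) : 0 < entropyConst M l k γ g := by
  have h0 := entropyH_nonneg hg0
  have h1 := hpos.trans_le (GasMixture.norm_mono (by positivity) hg hg0 hg1)
  have h2 := hpos.trans_le (GasMixture.norm_mono (le_min (by norm_num) (by positivity)) hg hg0
    (hg1.mono (min_le_right 2 _) hg hg0))
  unfold entropyConst; positivity

/-- The bound for the gain form with free parameters: `C` bounds the bounded part of `b_ij`,
`exp (L^n)` is the truncation level, `η` the parameter of Young's inequality. -/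
lemma gainForm_le (i j : Fin P) {p k : ℝ} (hp : 1 ≤ p) (hk : 0 ≤ k)
    {f g : MolState → ℝ} (hf : Measurable f) (hg : Measurable g) (hf0 : ∀ x, 0 ≤ f x)
    (hg0 : ∀ x, 0 ≤ g x) (hfp : M.InLp i p (Q.γ i j / p + k) f)
    (hgp : M.InLp j p (Q.γ i j / p + k) g) (hf1 : M.InLp i 1 (k + Q.γ i j + 1) f)
    (hg1 : M.InLp j 1 (k + Q.γ i j + 1) g) (hfH : FiniteEntropy f) (hgH : FiniteEntropy g)
    (hρ : Q.RhoFinite i j p) (hρ' : Q.RhoFinite j i p)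
    {b₁ : ℝ → ℝ} (hb₁ : IntegrableOn b₁ (Icc (-1 : ℝ) 1)) {C L η : ℝ} (hC : 0 ≤ C) (hL : 0 < L)
    (hη : 0 < η) (hb : ∀ᵐ s ∂(volume.restrict (Icc (-1 : ℝ) 1)),
      ENNReal.ofReal (Q.b i j s) ≤ ENNReal.ofReal |b₁ s| + ENNReal.ofReal C) :
    Q.gainForm i j p k f g ≤ ENNReal.ofReal (
      angularL1 b₁ * (Q.C1 i j p k f g * M.norm i p (Q.γ i j / p + k) f ^ p +
        Q.C1 j i p k g f * M.norm j p (Q.γ i j / p + k) g ^ p) +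
      4 * Real.pi * C * (
        (Q.C2 i j p k f g / L + 2 * ((1 - 1 / p) * η) * Q.cq i j p) *
          M.norm i p (Q.γ i j / p + k) f ^ p +
        (Q.C2 j i p k g f / L + 2 * ((1 - 1 / p) * η) * Q.cq j i p) *
          M.norm j p (Q.γ i j / p + k) g ^ p +
        1 / p * η ^ (1 - p) * Real.exp (L ^ (k + Q.γ i j + 1)) ^ p * (Q.cq i j p + Q.cq j i p) *
          (cHat M j * M.norm i 1 (Q.γ i j / p + k) f ^ p +
            cHat M i * M.norm j 1 (Q.γ i j / p + k) g ^ p))) := by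
  have hp0 : 0 < p := by linarith
  have hθ : 0 ≤ 1 - 1 / p := by rw [sub_nonneg, div_le_one hp0]; exact hp
  have hsym : Q.γ j i = Q.γ i j := Q.γ_symm j i
  have hγ := (Q.γ_mem i j).1
  -- a measurable representative of the integrable part
  have hbm : AEMeasurable (fun s => ENNReal.ofReal |b₁ s|) (volume.restrict (Icc (-1 : ℝ) 1)) :=
    hb₁.abs.aemeasurable.ennreal_ofReal
  have hβn : ENNReal.ofReal (2 * Real.pi) * ∫⁻ s in Icc (-1 : ℝ) 1, hbm.mk _ s ≤
      ENNReal.ofReal (angularL1 b₁) := by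
    rw [ofReal_angularL1 hb₁, lintegral_congr_ae hbm.ae_eq_mk]
  have hb' : ∀ᵐ s ∂(volume.restrict (Icc (-1 : ℝ) 1)),
      ENNReal.ofReal (Q.b i j s) ≤ hbm.mk _ s + ENNReal.ofReal C := by
    filter_upwards [hb, hbm.ae_eq_mk] with s hs hs'
    rwa [← hs']
  have hb'' : ∀ᵐ s ∂(volume.restrict (Icc (-1 : ℝ) 1)),
      ENNReal.ofReal (Q.b j i s) ≤ hbm.mk _ s + ENNReal.ofReal C := by
    filter_upwards [hb', ae_restrict_mem measurableSet_Icc] with s hs hs'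
    rwa [Q.b_symm j i s hs']
  have hcf := entropyConst_nonneg (M := M) i hk hγ hf0
  have hcg := entropyConst_nonneg (M := M) j hk hγ hg0
  have hlf := GasMixture.lintegral_largePart_le (M := M) i hk hγ hL hf hf0 hf1 hfH
  have hlg := GasMixture.lintegral_largePart_le (M := M) j hk hγ hL hg hg0 hg1 hgH
  have hci := M.inLp_one_neg_six i
  have hcj := M.inLp_one_neg_six j
  have hn := angularL1_nonneg b₁
  have g1 := Q.lintegral_gain_le i j hp hk hf hg hf0 hg0 hfp hgp hf1 hg1 hρ hci hcj
    hbm.measurable_mk hC hn hb' hβn (Real.exp_pos _).le hη (by positivity) (by positivity) hlf hlg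
  have g2 := Q.lintegral_gain_le j i hp hk hg hf hg0 hf0 (hsym ▸ hgp) (hsym ▸ hfp) (hsym ▸ hg1)
    (hsym ▸ hf1) hρ' hcj hci hbm.measurable_mk hC hn hb'' hβn (Real.exp_pos (L ^ (k + Q.γ i j + 1))).le
    hη (llf := entropyConst M j k (Q.γ i j) g / L) (llg := entropyConst M i k (Q.γ i j) f / L)
    (by positivity) (by positivity) (by rw [hsym]; exact hlg) (by rw [hsym]; exact hlf)
  rw [hsym] at g2
  have hmeas : Measurable fun x => Q.gain i j f g x *
      ENNReal.ofReal (f x ^ (p - 1) * M.bracket i x ^ (k * p)) := by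
    have := Q.measurable_gain i j hf hg
    have := M.measurable_bracket i
    fun_prop
  have hc1 := Q.cq_nonneg i j p
  have hc2 := Q.cq_nonneg j i p
  have hX : 0 ≤ M.norm i p (Q.γ i j / p + k) f ^ p :=
    Real.rpow_nonneg (GasMixture.norm_nonneg ..) p
  have hY : 0 ≤ M.norm j p (Q.γ i j / p + k) g ^ p :=
    Real.rpow_nonneg (GasMixture.norm_nonneg ..) p
  have hlf0 : 0 ≤ M.norm i 1 (k + Q.γ i j) f := GasMixture.norm_nonneg ..
  have hlg0 : 0 ≤ M.norm j 1 (k + Q.γ i j) g := GasMixture.norm_nonneg ..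
  have hlf'0 : 0 ≤ M.norm i 1 (Q.γ i j / p + k) f := GasMixture.norm_nonneg ..
  have hlg'0 : 0 ≤ M.norm j 1 (Q.γ i j / p + k) g := GasMixture.norm_nonneg ..
  have hci0 : 0 ≤ cHat M i := GasMixture.norm_nonneg ..
  have hcj0 : 0 ≤ cHat M j := GasMixture.norm_nonneg ..
  -- the factor `2^((p - 1) / (2p)) ≥ 1` in `C₁` is not needed
  have htwo : (1 : ℝ) ≤ 2 ^ ((p - 1) / (2 * p)) :=
    Real.one_le_rpow one_le_two (div_nonneg (by linarith) (by positivity))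
  have hC1 : Q.cq i j p * M.norm j 1 (k + Q.γ i j) g +
      (1 - 1 / p) * Q.cq i j p * M.norm i 1 (k + Q.γ i j) f +
      1 / p * Q.cq j i p * M.norm j 1 (k + Q.γ i j) g ≤ Q.C1 i j p k f g :=
    le_mul_of_one_le_left (by positivity) htwo
  have hC1' : Q.cq j i p * M.norm i 1 (k + Q.γ i j) f +
      (1 - 1 / p) * Q.cq j i p * M.norm j 1 (k + Q.γ i j) g +
      1 / p * Q.cq i j p * M.norm i 1 (k + Q.γ i j) f ≤ Q.C1 j i p k g f := by
    unfold C1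
    rw [hsym]
    exact le_mul_of_one_le_left (by positivity) htwo
  rw [gainForm, lintegral_add_left hmeas]
  refine (add_le_add g1 g2).trans ?_
  unfold C2
  rw [hsym]
  set X := M.norm i p (Q.γ i j / p + k) f ^ p
  set Y := M.norm j p (Q.γ i j / p + k) g ^ p
  set lf := M.norm i 1 (k + Q.γ i j) f
  set lg := M.norm j 1 (k + Q.γ i j) g
  set lf' := M.norm i 1 (Q.γ i j / p + k) f
  set lg' := M.norm j 1 (Q.γ i j / p + k) g
  set ef := entropyConst M i k (Q.γ i j) f
  set eg := entropyConst M j k (Q.γ i j) g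
  set c := Q.cq i j p
  set c' := Q.cq j i p
  clear_value X Y lf lg lf' lg' ef eg c c'
  rw [← ENNReal.ofReal_add (by positivity) (by positivity)]
  refine ENNReal.ofReal_le_ofReal ?_
  have k1 := mul_le_mul_of_nonneg_left (add_le_add (mul_le_mul_of_nonneg_right hC1 hX)
    (mul_le_mul_of_nonneg_right hC1' hY)) hn
  refine le_of_eq_of_le ?_ (add_le_add_left k1 _)
  ring

end CollisionKernel

/-! ### The estimate for the bilinear form -/

namespace CollisionKernel

variable {P : ℕ} {M : GasMixture P} (Q : CollisionKernel M)

lemma le_lossForm (i j : Fin P) {p k : ℝ} (hp : 1 ≤ p) {f g : MolState → ℝ}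
    (hf : Measurable f) (hg : Measurable g) (hf0 : ∀ x, 0 ≤ f x)
    (hg0 : ∀ x, 0 ≤ g x) (hfp : M.InLp i p (Q.γ i j / p + k) f)
    (hgp : M.InLp j p (Q.γ i j / p + k) g) (hf1 : M.InLp i 1 (Q.γ i j) f)
    (hg1 : M.InLp j 1 (Q.γ i j) g) (hfpos : 0 < M.norm i 1 0 f) (hgpos : 0 < M.norm j 1 0 g)
    (hfH : FiniteEntropy f) (hgH : FiniteEntropy g)
    (hlb : 0 < Q.blbNorm i j) (hlb' : 0 < Q.blbNorm j i) :
    ENNReal.ofReal (angularL1 (Q.b i j) *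
      (Q.clb i j g * M.norm i p (Q.γ i j / p + k) f ^ p +
        Q.clb j i f * M.norm j p (Q.γ i j / p + k) g ^ p)) ≤ Q.lossForm i j p k f g := by
  have hsym : Q.γ j i = Q.γ i j := Q.γ_symm j i
  have ha := angularL1_nonneg (Q.b i j)
  have hc := (Q.clb_pos i j hgpos hlb).le
  have hc' := (Q.clb_pos j i hfpos hlb').le
  have l1 := Q.le_lintegral_loss i j (k := k) hp hf0 hfp hg hg0 hg1 hgpos hgH hlb
  have l2 := Q.le_lintegral_loss j i (k := k) hp hg0 (hsym ▸ hgp) hf hf0 (hsym ▸ hf1) hfpos hfH hlb'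
  rw [hsym, Q.angularL1_b_symm i j] at l2
  have hX : 0 ≤ M.norm i p (Q.γ i j / p + k) f ^ p :=
    Real.rpow_nonneg (GasMixture.norm_nonneg ..) p
  have hY : 0 ≤ M.norm j p (Q.γ i j / p + k) g ^ p :=
    Real.rpow_nonneg (GasMixture.norm_nonneg ..) p
  refine le_trans ?_ ((add_le_add l1 l2).trans (le_lintegral_add _ _))
  rw [← ENNReal.ofReal_add (by positivity) (by positivity)]
  exact ENNReal.ofReal_le_ofReal (le_of_eq (by ring))

lemma lossForm_lt_top (i j : Fin P) {p k : ℝ} (hp : 1 ≤ p) {f g : MolState → ℝ}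
    (hf : Measurable f) (hg : Measurable g) (hf0 : ∀ x, 0 ≤ f x)
    (hg0 : ∀ x, 0 ≤ g x) (hfp : M.InLp i p (Q.γ i j / p + k) f)
    (hgp : M.InLp j p (Q.γ i j / p + k) g) (hf1 : M.InLp i 1 (Q.γ i j) f)
    (hg1 : M.InLp j 1 (Q.γ i j) g) : Q.lossForm i j p k f g < ⊤ := by
  have hsym : Q.γ j i = Q.γ i j := Q.γ_symm j i
  have hmeas : Measurable fun x => Q.loss i j f g x *
      ENNReal.ofReal (f x ^ (p - 1) * M.bracket i x ^ (k * p)) := by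
    have := Q.measurable_freq i j hg
    have := M.measurable_bracket i
    unfold loss
    fun_prop
  rw [lossForm, lintegral_add_left hmeas]
  exact ENNReal.add_lt_top.2 ⟨Q.lintegral_loss_lt_top i j hp hf0 hfp hg0 hg1,
    Q.lintegral_loss_lt_top j i hp hg0 (hsym ▸ hgp) hf0 (hsym ▸ hf1)⟩

lemma epsTilde_nonneg (i j : Fin P) {p : ℝ} (hp : 1 ≤ p) {f g : MolState → ℝ} {β : ℝ}
    (hβ : 0 ≤ β) (hc : 0 ≤ Q.clb i j g) (hc' : 0 ≤ Q.clb j i f) :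
    0 ≤ Q.epsTilde i j p f g β := by
  have hθ : 0 ≤ 1 - 1 / p := by rw [sub_nonneg, div_le_one (by linarith)]; exact hp
  have ha := angularL1_nonneg (Q.b i j)
  have h1 := Q.cq_nonneg i j p
  have h2 := Q.cq_nonneg j i p
  exact mul_nonneg (by positivity) (le_min (by positivity) (by positivity))

lemma Bconst_nonneg (i j : Fin P) {p k : ℝ} (hp : 1 ≤ p) {f g : MolState → ℝ} {β : ℝ}
    (hβ : 0 ≤ β) (hc : 0 ≤ Q.clb i j g) (hc' : 0 ≤ Q.clb j i f) :
    0 ≤ Q.Bconst i j p k f g β := by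
  have h0 := Q.epsTilde_nonneg i j hp hβ hc hc'
  have h1 := Q.cq_nonneg i j p
  have h2 := Q.cq_nonneg j i p
  have h3 : 0 ≤ cHat M i := GasMixture.norm_nonneg ..
  have h4 : 0 ≤ cHat M j := GasMixture.norm_nonneg ..
  have h5 := GasMixture.norm_nonneg (M := M) i 1 (Q.γ i j / p + k) f
  have h6 := GasMixture.norm_nonneg (M := M) j 1 (Q.γ i j / p + k) g
  have h7 : 0 ≤ Q.truncK i j p k f g β := (Real.exp_pos _).le
  unfold Bconst; positivity

lemma C1_pos (i j : Fin P) {p k γ : ℝ} (hγ : Q.γ i j = γ) (hp : 1 ≤ p) {f g : MolState → ℝ}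
    (hc : 0 < Q.cq i j p) (hc' : 0 ≤ Q.cq j i p) (hf : 0 ≤ M.norm i 1 (k + γ) f)
    (hg : 0 < M.norm j 1 (k + γ) g) : 0 < Q.C1 i j p k f g := by
  have hθ : 0 ≤ 1 - 1 / p := by rw [sub_nonneg, div_le_one (by linarith)]; exact hp
  have hp0 : 0 < p := by linarith
  unfold C1
  rw [hγ]
  positivity

lemma C2_pos (i j : Fin P) {p k γ : ℝ} (hγ : Q.γ i j = γ) (hp : 1 ≤ p) {f g : MolState → ℝ}
    (hc : 0 < Q.cq i j p) (hc' : 0 ≤ Q.cq j i p) (hf : 0 ≤ entropyConst M i k γ f)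
    (hg : 0 < entropyConst M j k γ g) : 0 < Q.C2 i j p k f g := by
  have hθ : 0 ≤ 1 - 1 / p := by rw [sub_nonneg, div_le_one (by linarith)]; exact hp
  have hp0 : 0 < p := by linarith
  unfold C2
  rw [hγ]
  positivity

/-- The choice of the parameter in Young's inequality: `η = ε̃` for `p > 1`; for `p = 1` the
parameter does not enter and `ε̃` is meaningless, so `η = 1` is taken. -/
lemma exists_young_parameter (i j : Fin P) {p : ℝ} (hp : 1 ≤ p) {f g : MolState → ℝ} {β : ℝ}
    (hβ : 0 < β) (ha : 0 < angularL1 (Q.b i j)) (hc : 0 < Q.cq i j p) (hc' : 0 < Q.cq j i p)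
    (hclb : 0 < Q.clb i j g) (hclb' : 0 < Q.clb j i f) :
    ∃ η : ℝ, 0 < η ∧ η ^ (1 - p) = (Q.epsTilde i j p f g β ^ (p - 1))⁻¹ ∧
      64 * Real.pi * β * ((1 - 1 / p) * η) * Q.cq i j p ≤ angularL1 (Q.b i j) * Q.clb i j g ∧
      64 * Real.pi * β * ((1 - 1 / p) * η) * Q.cq j i p ≤
        angularL1 (Q.b i j) * Q.clb j i f := by
  rcases hp.eq_or_lt with rfl | h1
  · refine ⟨1, one_pos, by simp, ?_, ?_⟩
    · simp only [div_one, sub_self, zero_mul, mul_zero]; positivity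
    · simp only [div_one, sub_self, zero_mul, mul_zero]; positivity
  · have hθ : 0 < 1 - 1 / p := by rw [sub_pos, div_lt_one (by linarith)]; exact h1
    have hm : 0 < min (Q.clb i j g / Q.cq i j p) (Q.clb j i f / Q.cq j i p) :=
      lt_min (by positivity) (by positivity)
    have hε : 0 < Q.epsTilde i j p f g β := mul_pos (by positivity) hm
    have e : 64 * Real.pi * β * ((1 - 1 / p) * Q.epsTilde i j p f g β) =
        angularL1 (Q.b i j) * min (Q.clb i j g / Q.cq i j p) (Q.clb j i f / Q.cq j i p) := by
      have hθ := hθ.ne'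
      unfold epsTilde
      generalize 1 - 1 / p = θ at hθ ⊢
      field_simp
    refine ⟨_, hε, ?_, ?_, ?_⟩
    · rw [← Real.rpow_neg hε.le]; congr 1; ring
    · rw [e, mul_assoc]
      exact mul_le_mul_of_nonneg_left ((le_div_iff₀ hc).1 (min_le_left _ _)) ha.le
    · rw [e, mul_assoc]
      exact mul_le_mul_of_nonneg_left ((le_div_iff₀ hc').1 (min_le_right _ _)) ha.le

end CollisionKernel

/-- The gain of the part of `b` which is small in `L¹` takes a quarter of the loss, the large parts
of the densities and the Young remainder of the small parts an eighth each. -/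
lemma gain_le_half_loss {a n β cl cl' C₁ C₁' C₂ C₂' X Y L t c c' B : ℝ} (hX : 0 ≤ X) (hY : 0 ≤ Y)
    (s : n * C₁ ≤ 1 / 4 * a * cl) (s' : n * C₁' ≤ 1 / 4 * a * cl')
    (r : 4 * Real.pi * β * (C₂ / L) ≤ 1 / 8 * (a * cl))
    (r' : 4 * Real.pi * β * (C₂' / L) ≤ 1 / 8 * (a * cl'))
    (h : 64 * Real.pi * β * t * c ≤ a * cl) (h' : 64 * Real.pi * β * t * c' ≤ a * cl') :
    n * (C₁ * X + C₁' * Y) +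
      4 * Real.pi * β * ((C₂ / L + 2 * t * c) * X + (C₂' / L + 2 * t * c') * Y + B) ≤
    1 / 2 * a * (cl * X + cl' * Y) + 4 * Real.pi * β * B := by
  have e : n * C₁ + 4 * Real.pi * β * (C₂ / L) + 8 * Real.pi * β * t * c ≤ 1 / 2 * (a * cl) := by
    linarith
  have e' : n * C₁' + 4 * Real.pi * β * (C₂' / L) + 8 * Real.pi * β * t * c' ≤
      1 / 2 * (a * cl') := by linarith
  linarith [mul_le_mul_of_nonneg_right e hX, mul_le_mul_of_nonneg_right e' hY]

/-- With `L = 32π (β/a) m` and `m ≥ C₂/cl`, the large parts take an eighth of the loss. -/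
lemma large_part_le_eighth {a β cl C₂ m : ℝ} (ha : 0 < a) (hβ : 0 < β) (hcl : 0 < cl)
    (hm : 0 < m) (h : C₂ / cl ≤ m) :
    4 * Real.pi * β * (C₂ / (32 * Real.pi * (β / a) * m)) ≤ 1 / 8 * (a * cl) := by
  have h' := (div_le_iff₀ hcl).1 h
  have h2 : C₂ / m ≤ cl := by rw [div_le_iff₀ hm]; linarith
  calc 4 * Real.pi * β * (C₂ / (32 * Real.pi * (β / a) * m)) = 1 / 8 * (a * (C₂ / m)) := by
        field_simp; ring
    _ ≤ _ := by gcongr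

theorem mainTheorem2 {P : ℕ} (M : GasMixture P) (Q : CollisionKernel M) (i j : Fin P)
    (p k : ℝ) (hp : 1 ≤ p) (hk : 0 ≤ k)
    (f g : MolState → ℝ) (hf_meas : Measurable f) (hg_meas : Measurable g)
    (hf_nonneg : ∀ x, 0 ≤ f x) (hg_nonneg : ∀ x, 0 ≤ g x)
    (hf_Lp : M.InLp i p (Q.γ i j / p + k) f) (hg_Lp : M.InLp j p (Q.γ i j / p + k) g)
    (hf_L1 : M.InLp i 1 (k + Q.γ i j + 1) f) (hg_L1 : M.InLp j 1 (k + Q.γ i j + 1) g)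
    (hf_pos : 0 < M.norm i 1 0 f) (hg_pos : 0 < M.norm j 1 0 g)
    (hf_H : FiniteEntropy f) (hg_H : FiniteEntropy g)
    (hrho_ij : Q.RhoFinite i j p) (hrho_ji : Q.RhoFinite j i p)
    (hlb_ij : 0 < Q.blbNorm i j) (hlb_ji : 0 < Q.blbNorm j i) :
    Q.gainForm i j p k f g < ⊤ ∧ Q.lossForm i j p k f g < ⊤ ∧
    (∃ b₁ bInf : ℝ → ℝ, IsAngularDecomp (Q.b i j) (Q.eps i j p k f g) b₁ bInf) ∧
    ∀ b₁ bInf : ℝ → ℝ, IsAngularDecomp (Q.b i j) (Q.eps i j p k f g) b₁ bInf →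
      Q.bilinForm i j p k f g ≤
        -(1 / 2) * angularL1 (Q.b i j) *
            (Q.clb i j g * M.norm i p (Q.γ i j / p + k) f ^ p +
              Q.clb j i f * M.norm j p (Q.γ i j / p + k) g ^ p) +
          4 * Real.pi * angularLinf bInf * Q.Bconst i j p k f g (angularLinf bInf) := by
  have hsym : Q.γ j i = Q.γ i j := Q.γ_symm j i
  have hp0 : 0 < p := by linarith
  have hθ : 0 ≤ 1 - 1 / p := by rw [sub_nonneg, div_le_one hp0]; exact hp
  have hγ := (Q.γ_mem i j).1
  have hf1 := hf_L1.mono (s := Q.γ i j) (by linarith) hf_meas hf_nonneg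
  have hg1 := hg_L1.mono (s := Q.γ i j) (by linarith) hg_meas hg_nonneg
  have hclb := Q.clb_pos i j hg_pos hlb_ij
  have hclb' := Q.clb_pos j i hf_pos hlb_ji
  have hX : 0 ≤ M.norm i p (Q.γ i j / p + k) f ^ p :=
    Real.rpow_nonneg (GasMixture.norm_nonneg ..) p
  have hY : 0 ≤ M.norm j p (Q.γ i j / p + k) g ^ p :=
    Real.rpow_nonneg (GasMixture.norm_nonneg ..) p
  have hgain := fun {b₁ : ℝ → ℝ} (hb₁ : IntegrableOn b₁ (Icc (-1 : ℝ) 1)) {C L η : ℝ}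
      (hC : 0 ≤ C) (hL : 0 < L) (hη : 0 < η)
      (hb : ∀ᵐ s ∂(volume.restrict (Icc (-1 : ℝ) 1)),
        ENNReal.ofReal (Q.b i j s) ≤ ENNReal.ofReal |b₁ s| + ENNReal.ofReal C) =>
    Q.gainForm_le i j hp hk hf_meas hg_meas hf_nonneg hg_nonneg hf_Lp hg_Lp hf_L1 hg_L1 hf_H hg_H
      hrho_ij hrho_ji hb₁ hC hL hη hb
  have hlossfin := Q.lossForm_lt_top i j (k := k) hp hf_meas hg_meas hf_nonneg hg_nonneg hf_Lp hg_Lp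
    hf1 hg1
  have hloss := Q.le_lossForm i j hp hf_meas hg_meas hf_nonneg hg_nonneg hf_Lp hg_Lp hf1 hg1
    hf_pos hg_pos hf_H hg_H hlb_ij hlb_ji
  -- without a bounded part, the parameters `L` and `η` are immaterial
  have hb0 : ∀ᵐ s ∂(volume.restrict (Icc (-1 : ℝ) 1)),
      ENNReal.ofReal (Q.b i j s) ≤ ENNReal.ofReal |Q.b i j s| + ENNReal.ofReal 0 :=
    ae_of_all _ fun s => le_add_right (ENNReal.ofReal_le_ofReal (le_abs_self _))
  have hgain0 := hgain (C := 0) (L := 1) (η := 1) (Q.b_integrable i j) le_rfl one_pos one_pos hb0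
  have hloss' := (ENNReal.ofReal_le_iff_le_toReal hlossfin.ne).1 hloss
  have ha := angularL1_nonneg (Q.b i j)
  have hcpos : 0 < angularL1 (Q.b i j) → 0 < Q.cq i j p ∧ 0 < Q.cq j i p := fun h =>
    ⟨Q.cq_pos i j h hlb_ij hrho_ij, Q.cq_pos j i (by rwa [Q.angularL1_b_symm]) hlb_ji hrho_ji⟩
  have hNf : 0 < M.norm i 1 (k + Q.γ i j) f := hf_pos.trans_le
    (GasMixture.norm_mono (by positivity) hf_meas hf_nonneg
      (hf_L1.mono (by linarith) hf_meas hf_nonneg))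
  have hNg : 0 < M.norm j 1 (k + Q.γ i j) g := hg_pos.trans_le
    (GasMixture.norm_mono (by positivity) hg_meas hg_nonneg
      (hg_L1.mono (by linarith) hg_meas hg_nonneg))
  have hC1pos : 0 < angularL1 (Q.b i j) → 0 < Q.C1 i j p k f g ∧ 0 < Q.C1 j i p k g f := by
    intro h
    obtain ⟨h1, h2⟩ := hcpos h
    exact ⟨Q.C1_pos i j rfl hp h1 h2.le hNf.le hNg, Q.C1_pos j i hsym hp h2 h1.le hNg.le hNf⟩
  have hgainfin := hgain0.trans_lt ENNReal.ofReal_lt_top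
  refine ⟨hgainfin, hlossfin, ?_, ?_⟩
  · rcases ha.eq_or_lt with h0 | h0
    · have hs : angularL1 (Q.b i j) ≤ Q.eps i j p k f g := by
        rw [CollisionKernel.eps, ← h0]; simp
      exact ⟨Q.b i j, fun _ => 0, ⟨ae_of_all _ fun s => (add_zero _).symm, Q.b_integrable i j, hs,
        memLp_top_const 0⟩⟩
    · obtain ⟨h1, h2⟩ := hC1pos h0
      exact exists_isAngularDecomp (Q.b_integrable i j)
        (mul_pos (by positivity) (lt_min (by positivity) (by positivity)))
  · intro b₁ bInf hdec
    have hβ : 0 ≤ angularLinf bInf := ENNReal.toReal_nonneg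
    have hB := Q.Bconst_nonneg i j (k := k) hp hβ hclb.le hclb'.le
    have hle := hdec.ofReal_le
    have hsmall := hdec.small
    -- it suffices to bound the gain form by half of the loss, up to the constant term
    have key : ∀ G : ℝ, Q.gainForm i j p k f g ≤ ENNReal.ofReal G →
        G ≤ 1 / 2 * angularL1 (Q.b i j) *
          (Q.clb i j g * M.norm i p (Q.γ i j / p + k) f ^ p +
            Q.clb j i f * M.norm j p (Q.γ i j / p + k) g ^ p) +
          4 * Real.pi * angularLinf bInf * Q.Bconst i j p k f g (angularLinf bInf) →
        Q.bilinForm i j p k f g ≤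
          -(1 / 2) * angularL1 (Q.b i j) *
            (Q.clb i j g * M.norm i p (Q.γ i j / p + k) f ^ p +
              Q.clb j i f * M.norm j p (Q.γ i j / p + k) g ^ p) +
          4 * Real.pi * angularLinf bInf * Q.Bconst i j p k f g (angularLinf bInf) := by
      intro G hG hG'
      have hnn : 0 ≤ 1 / 2 * angularL1 (Q.b i j) *
          (Q.clb i j g * M.norm i p (Q.γ i j / p + k) f ^ p +
            Q.clb j i f * M.norm j p (Q.γ i j / p + k) g ^ p) +
          4 * Real.pi * angularLinf bInf * Q.Bconst i j p k f g (angularLinf bInf) := by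
        positivity
      have := ENNReal.toReal_le_of_le_ofReal hnn (hG.trans (ENNReal.ofReal_le_ofReal hG'))
      unfold CollisionKernel.bilinForm
      linarith
    rcases ha.eq_or_lt with h0 | h0
    · apply key _ hgain0
      rw [← h0]
      simp only [mul_zero, zero_mul, zero_add, add_zero]
      positivity
    obtain ⟨hc, hc'⟩ := hcpos h0
    obtain ⟨hC1, hC1'⟩ := hC1pos h0
    have hn := angularL1_nonneg b₁
    have s1 : angularL1 b₁ * Q.C1 i j p k f g ≤ 1 / 4 * angularL1 (Q.b i j) * Q.clb i j g := by
      rw [← le_div_iff₀ hC1, mul_div_assoc]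
      exact hsmall.trans (mul_le_mul_of_nonneg_left (min_le_left _ _) (by positivity))
    have s2 : angularL1 b₁ * Q.C1 j i p k g f ≤ 1 / 4 * angularL1 (Q.b i j) * Q.clb j i f := by
      rw [← le_div_iff₀ hC1', mul_div_assoc]
      exact hsmall.trans (mul_le_mul_of_nonneg_left (min_le_right _ _) (by positivity))
    rcases hβ.eq_or_lt with hβ0 | hβ0
    · rw [← hβ0] at hle key ⊢
      have hG := hgain (C := 0) (L := 1) (η := 1) hdec.integrable le_rfl one_pos one_pos hle
      simp only [mul_zero, zero_mul, add_zero] at hG key ⊢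
      refine key _ hG ?_
      have t1 := mul_le_mul_of_nonneg_right s1 hX
      have t2 := mul_le_mul_of_nonneg_right s2 hY
      have u1 := mul_nonneg (mul_nonneg ha hclb.le) hX
      have u2 := mul_nonneg (mul_nonneg ha hclb'.le) hY
      linarith
    -- `L = log(K)^(1/n)`, and `η = ε̃` unless `p = 1`, where `η` is immaterial
    have hef := CollisionKernel.entropyConst_pos i hk hγ hf_meas hf_nonneg hf_L1 hf_pos
    have heg := CollisionKernel.entropyConst_pos j hk hγ hg_meas hg_nonneg hg_L1 hg_pos
    have hC2 := Q.C2_pos i j rfl hp hc hc'.le hef.le heg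
    obtain ⟨η, hη, hη1, hη2, hη3⟩ :=
      Q.exists_young_parameter i j hp (f := f) (g := g) hβ0 h0 hc hc' hclb hclb'
    set mx := max (Q.C2 i j p k f g / Q.clb i j g) (Q.C2 j i p k g f / Q.clb j i f) with hmx
    have hmx0 : 0 < mx := lt_max_of_lt_left (by positivity)
    have hL : 0 < 32 * Real.pi * (angularLinf bInf / angularL1 (Q.b i j)) * mx := by positivity
    have hG := hgain hdec.integrable hβ hL hη hle
    have hBeq : 1 / p * η ^ (1 - p) * Real.exp ((32 * Real.pi *
          (angularLinf bInf / angularL1 (Q.b i j)) * mx) ^ (k + Q.γ i j + 1)) ^ p *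
        (Q.cq i j p + Q.cq j i p) *
        (CollisionKernel.cHat M j * M.norm i 1 (Q.γ i j / p + k) f ^ p +
          CollisionKernel.cHat M i * M.norm j 1 (Q.γ i j / p + k) g ^ p) =
        Q.Bconst i j p k f g (angularLinf bInf) := by
      rw [hη1, CollisionKernel.Bconst, CollisionKernel.truncK, ← hmx]
      ring
    rw [hBeq] at hG
    exact key _ hG (gain_le_half_loss hX hY s1 s2
      (large_part_le_eighth h0 hβ0 hclb hmx0 (le_max_left _ _))
      (large_part_le_eighth h0 hβ0 hclb' hmx0 (le_max_right _ _)) hη2 hη3)
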